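/- **Theorem 1.4.** Let $E:\ y^2+a_1xy+a_3y=x^3+a_2x^2+a_4x+a_6$ be an elliptic curve over $\mathbb R$, with the usual associated quantities $b_2,c_4,c_6$, and let $\mathbf P=(P_1,\dots,P_n)$ be an $n$-tuple of points of $E(\mathbb R)$ that are linearly independent over $\mathbb Z$. *Lattice and net polynomials.* Let $\Lambda\subset\mathbb C$ be the lattice of $E$, i.e. $g_2(\Lambda)=c_4/12$ and $g_3(\Lambda)=c_6/216$, and let $z_i\in\mathbb C\setminus\Lambda$ correspond to $P_i=(x_i,y_i)$ under $\mathbb C/\Lambda\cong E(\mathbb C)$, i.e. $\wp(z_i)=x_i+b_2/12$ and $\wp'(z_i)=2y_i+a_1x_i+a_3$. For $\mathbf v=(v_1,\dots,v_n)\in\mathbb Z^n$ put $e(\mathbf v)=\sum_{i}v_i^2-\sum_{i<j}v_iv_j-1$ and let $$\Psi_{\mathbf v}(\mathbf P;E)=\Omega_{\mathbf v}(\mathbf z;\Lambda)=(-1)^{e(\mathbf v)}\,\frac{\sigma(v_1z_1+\cdots+v_nz_n;\Lambda)}{\prod_{i}\sigma(z_i;\Lambda)^{2v_i^2-\sum_{j=1}^n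 v_iv_j}\ \prod_{i<j}\sigma(z_i+z_j;\Lambda)^{v_iv_j}}$$ be the value of the $\mathbf v$-th net polynomial, where $\sigma$ is the Weierstrass $\sigma$-function. *Tate parameters.* Let $q\in\mathbb R$, $0<|q|<1$, be such that $E$ is isomorphic over $\mathbb R$ to the Tate curve $E_q:\ y^2+xy=x^3+a_4(q)x+a_6(q)$, where $a_4(q)=-5s_3(q)$, $a_6(q)=-\tfrac{5}{12}s_3(q)-\tfrac{7}{12}s_5(q)$ and $s_k(q)=\sum_{m\ge1}\frac{m^kq^m}{1-q^m}$. Fix such an isomorphism $\pi:E_q\to E$ and let $\psi:\mathbb R^*/q^{\mathbb Z}\to E(\mathbb R)$ be the isomorphism $\pi\circ\phi$, where $\phi$ sends $q^{\mathbb Z}$ to the point at infinity and $$\phi(u)=\Big(\sum_{m\in\mathbb Z}\frac{q^mu}{(1-q^mu)^2}-2s_1(q),\ \sum_{m\in\mathbb Z}\frac{(q^mu)^2}{(1-q^mu)^3}+s_1(q)\Big)\qquad(u\in\mathbb R^*\setminus q^{\mathbb Z}).$$ Let $u_i\in\mathbb R^*$ be the representative of $\psi^{-1}(P_i)$ normalized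 by $q<|u_i|<1$ if $q>0$ and $q^2<u_i<1$ if $q<0$. Assume that for some $0\le k\le n$ we have $u_1,\dots,u_k<0$ and $u_{k+1},\dots,u_n>0$ (so $k=0$ means that all $u_i$ are positive). *Conclusion.* For $x\in\mathbb R^*$ define $\mathrm{Parity}[x]\in\mathbb Z/2\mathbb Z$ by $\mathrm{Sign}[x]=(-1)^{\mathrm{Parity}[x]}$. Put $$\beta_i=\log_q|u_i|\ \text{ if } q>0,\qquad \beta_i=\tfrac12\log_{|q|}u_i\ \text{ if } q<0 .$$ Then $\beta_1,\dots,\beta_n$ are irrational and linearly independent over $\mathbb Q$; every $\Psi_{\mathbf v}(\mathbf P;E)$ is real, and it is nonzero for $\mathbf v\ne\mathbf 0$. Moreover one of the following holds: either for all $\mathbf v\in\mathbb Z^n\setminus\{\mathbf 0\}$ $$\mathrm{Parity}[\Psi_{\mathbf v}(\mathbf P;E)]\equiv F(\mathbf v)\pmod 2,$$ or for all $\mathbf v\in\mathbb Z^n\setminus\{\mathbf 0\}$ $$\mathrm{Parity}\big[(-1)^{e(\mathbf v)}\Psi_{\mathbf v}(\mathbf P;E)\big]\equiv F(\mathbf v)\pmod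 2,$$ where $$F(\mathbf v)=\begin{cases}\displaystyle\sum_{1\le i<j\le k}\lfloor\beta_i+\beta_j\rfloor v_iv_j+\sum_{k+1\le i<j\le n}\lfloor\beta_i+\beta_j\rfloor v_iv_j+\Big\lfloor\sum_{i=1}^nv_i\beta_i\Big\rfloor+\sum_{i=1}^k\Big\lfloor\frac{v_i}{2}\Big\rfloor&\text{if }\sum_{i=1}^kv_i\text{ is even},\\[3mm]\displaystyle\sum_{1\le i<j\le k}\lfloor\beta_i+\beta_j\rfloor v_iv_j+\sum_{k+1\le i<j\le n}\lfloor\beta_i+\beta_j\rfloor v_iv_j+\sum_{i=1}^k\Big\lfloor\frac{v_i}{2}\Big\rfloor&\text{if }\sum_{i=1}^kv_i\text{ is odd}.\end{cases}$$ In particular, if all $u_i>0$ (that is, $k=0$), $F(\mathbf v)=\lfloor\sum_{i}v_i\beta_i\rfloor+\sum_{1\le i<j\le n}\lfloor\beta_i+\beta_j\rfloor v_iv_j$. -/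

import Mathlib

noncomputable section

namespace EllipticNet

/-- The Weierstrass `σ`-function of the lattice `Λ` of `L`:
`σ(z; Λ) = z ∏_{ω ∈ Λ, ω ≠ 0} (1 - z/ω) exp (z/ω + (z/ω)²/2)`. -/
def weierstrassSigma (L : PeriodPair) (z : ℂ) : ℂ :=
  z * ∏' ω : {ω : L.lattice // ω ≠ 0},
    ((1 - z / (ω.1 : ℂ)) * Complex.exp (z / (ω.1 : ℂ) + (z / (ω.1 : ℂ)) ^ 2 / 2))

/-- The integer `∑ vᵢ² - ∑_{i < j} vᵢ vⱼ - 1`. -/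
def twistExponent {n : ℕ} (v : Fin n → ℤ) : ℤ :=
  ∑ i, v i ^ 2 - ∑ i, ∑ j with i < j, v i * v j - 1

/-- The function `Ω_v(z; Λ)`. When `Λ` is the lattice of an elliptic curve `E` and `zᵢ` corresponds
to the point `Pᵢ`, this is the value of the `v`-th net polynomial `Ψ_v(P; E)`. -/
def netValue {n : ℕ} (L : PeriodPair) (v : Fin n → ℤ) (z : Fin n → ℂ) : ℂ :=
  (-1) ^ twistExponent v * weierstrassSigma L (∑ i, v i * z i) /
    ((∏ i, weierstrassSigma L (z i) ^ (2 * v i ^ 2 - ∑ j, v i * v j)) *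
      ∏ i, ∏ j with i < j, weierstrassSigma L (z i + z j) ^ (v i * v j))

/-- `Λ` is the lattice of `E`: the substitution `X = x + b₂/12`, `Y = 2y + a₁x + a₃` turns the
equation of `E` into `Y² = 4X³ - (c₄/12) X - c₆/216`, and this has to be
`Y² = 4X³ - g₂(Λ) X - g₃(Λ)`. -/
def IsLatticeOf (L : PeriodPair) (E : WeierstrassCurve ℝ) : Prop :=
  L.g₂ = (E.c₄ : ℂ) / 12 ∧ L.g₃ = (E.c₆ : ℂ) / 216

/-- `z` corresponds to the affine point `P` of `E` under the isomorphism `ℂ/Λ ≅ E(ℂ)`, which is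
given by `℘(z) = x + b₂/12` and `℘'(z) = 2y + a₁x + a₃`. -/
def CorrespondsToPoint (L : PeriodPair) (E : WeierstrassCurve ℝ) (z : ℂ)
    (P : E.toAffine.Point) : Prop :=
  z ∉ L.lattice ∧ ∃ (x y : ℝ) (h : E.toAffine.Nonsingular x y), P = .some x y h ∧
    L.weierstrassP z = x + E.b₂ / 12 ∧ L.derivWeierstrassP z = 2 * y + E.a₁ * x + E.a₃

/-- `s_k(q) = ∑_{m ≥ 1} mᵏ qᵐ / (1 - qᵐ)`. -/
def tateSum (k : ℕ) (q : ℝ) : ℝ :=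
  ∑' m : ℕ+, (m : ℝ) ^ k * q ^ (m : ℕ) / (1 - q ^ (m : ℕ))

/-- The Tate curve `E_q : y² + xy = x³ + a₄(q) x + a₆(q)`. -/
def tateCurve (q : ℝ) : WeierstrassCurve ℝ where
  a₁ := 1
  a₂ := 0
  a₃ := 0
  a₄ := -5 * tateSum 3 q
  a₆ := -(5 / 12) * tateSum 3 q - 7 / 12 * tateSum 5 q

/-- The `x`-coordinate of the analytic isomorphism `φ : ℝ*/q^ℤ ≅ E_q(ℝ)`. -/
def tateX (q u : ℝ) : ℝ :=
  ∑' m : ℤ, q ^ m * u / (1 - q ^ m * u) ^ 2 - 2 * tateSum 1 q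

/-- The `y`-coordinate of the analytic isomorphism `φ : ℝ*/q^ℤ ≅ E_q(ℝ)`. -/
def tateY (q u : ℝ) : ℝ :=
  ∑' m : ℤ, (q ^ m * u) ^ 2 / (1 - q ^ m * u) ^ 3 + tateSum 1 q

/-- The real number `u` (not in `q^ℤ`) corresponds to the point `P` of `E` under
`ψ = π ∘ φ : ℝ*/q^ℤ ≅ E_q(ℝ) ≅ E(ℝ)`. Here `π : E_q → E` is the isomorphism given by the change of
variables `C`, that is, `(X, Y) ↦ (c²X + r, c³Y + c²sX + t)` for `C = (c, r, s, t)`. -/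
def IsTateParameter (q : ℝ) (E : WeierstrassCurve ℝ) (C : WeierstrassCurve.VariableChange ℝ)
    (u : ℝ) (P : E.toAffine.Point) : Prop :=
  u ≠ 0 ∧ (∀ m : ℤ, u ≠ q ^ m) ∧
    ∃ (x y : ℝ) (h : E.toAffine.Nonsingular x y), P = .some x y h ∧
      x = C.u ^ 2 * tateX q u + C.r ∧
      y = C.u ^ 3 * tateY q u + C.u ^ 2 * C.s * tateX q u + C.t

/-- The normalization of the representative `u` in its class modulo `q^ℤ`. -/
def IsNormalized (q u : ℝ) : Prop :=
  (0 < q → q < |u| ∧ |u| < 1) ∧ (q < 0 → q ^ 2 < u ∧ u < 1)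

/-- `β = log_q |u|` if `q > 0`, and `β = ½ log_{|q|} u` if `q < 0`. -/
def tateBeta (q u : ℝ) : ℝ :=
  if 0 < q then Real.logb q |u| else 1 / 2 * Real.logb |q| u

/-- For `x ≠ 0` this is the class modulo `2` determined by `Sign x = (-1) ^ parity x`. -/
def parity (x : ℝ) : ZMod 2 := if x < 0 then 1 else 0

/-- The integer whose class modulo `2` is the predicted parity at `v`; the first `k` of the
Tate parameters are negative and the other ones positive. With indices starting at `0`, the
range `1 ≤ i < j ≤ k` becomes `i < j < k`, and `k + 1 ≤ i < j ≤ n` becomes `k ≤ i < j`. -/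
def signFormula {n : ℕ} (k : ℕ) (β : Fin n → ℝ) (v : Fin n → ℤ) : ℤ :=
  ∑ i : Fin n, ∑ j : Fin n with i < j ∧ (j : ℕ) < k, ⌊β i + β j⌋ * (v i * v j) +
  ∑ i ∈ Finset.univ.filter (fun i : Fin n => k ≤ (i : ℕ)), ∑ j with i < j,
    ⌊β i + β j⌋ * (v i * v j) +
  (if Even (∑ i ∈ Finset.univ.filter (fun i : Fin n => (i : ℕ) < k), v i) then
    ⌊∑ i, v i * β i⌋ else 0) +
  ∑ i ∈ Finset.univ.filter (fun i : Fin n => (i : ℕ) < k), ⌊(v i : ℝ) / 2⌋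

end EllipticNet

end

open Filter Topology

namespace EllipticNet

/-! ### Differentiation of locally uniformly convergent sums and products. -/

section Series

variable {ι : Type*} {s : Set ℂ}

/-! The sign of `Ψ_v` can be read off once every `σ` in its definition is replaced by the real theta
product `θ(U) = (1 - U) ∏ (1 - qᵐU)(1 - qᵐ/U)`.

Comparing uniformizations. Both `℘` and `c² · tateP q (c ·)`, where `c` is the scaling of the change
of variables, solve `f'' = 6 f² - g₂/2` and have poles exactly on a lattice. For `tateP` the
equation comes from Liouville's theorem (`tateP_equation`). The coordinates of one point `P i` give
equal values and first derivatives at suitable arguments, so by uniqueness for the differential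
equation the two functions are translates of each other with the same poles; the translation turns
out to be a period (`tate_comparison`). Hence `cΛ = ℤ log q + 2πi ℤ`. Integrating `(log σ)'' = -℘`
twice yields `σ(z) = A exp(K z²) e^(-cz/2) θ(e^(cz))` with `A` real and nonzero
(`weierstrassSigma_eq_oddTheta`).

Cancellation. The exponents in the denominator of `Ω_v` are those that express a quadratic form at
`∑ vᵢ xᵢ` through its values at `xᵢ` and `xᵢ + xⱼ`. All Gaussian factors therefore cancel, including
those created by moving arguments modulo `log q`. What survives is real: a power of `A`, the
monomial `∏ uᵢ^(vᵢ(vᵢ-1)/2)`, and a quotient of theta values at products of the `uᵢ`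
(`ofReal_tateNetValue`).

Signs. Let `Q` be `q` for `q > 0` and `q²` for `q < 0`. Then `θ > 0` on `(Q, 1)`, and `U ↦ QU`
reverses the sign of `θ` for `U > 0`, so `θ(U)` has parity `⌊log_Q U⌋` (`parity_theta_of_pos`); for
`q > 0` and `U < 0` it is positive. The monomial contributes the terms `⌊vᵢ/2⌋` of the negative
`uᵢ`, and the sign of `A` decides which alternative of the conclusion holds.

Independence. The addition theorem makes the uniformization additive, so `∏ uᵢ^(vᵢ) ∈ q^ℤ` forces `∑
vᵢ zᵢ ∈ Λ`, then `∑ vᵢ Pᵢ = 0` and `v = 0`. This gives the nonvanishing of all theta values in use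
and the independence and irrationality of the `βᵢ`. -/

theorem summableLocallyUniformlyOn_deriv {f f' : ι → ℂ → ℂ} (hs : IsOpen s)
    (h : SummableLocallyUniformlyOn f s) (hf : ∀ i, ∀ x ∈ s, HasDerivAt (f i) (f' i x) x) :
    SummableLocallyUniformlyOn f' s := by
  obtain ⟨g, hg⟩ := h
  rw [hasSumLocallyUniformlyOn_iff_tendstoLocallyUniformlyOn] at hg
  have hd : ∀ᶠ n : Finset ι in atTop, DifferentiableOn ℂ (fun x ↦ ∑ i ∈ n, f i x) s :=
    .of_forall fun n ↦ DifferentiableOn.fun_sum fun i _ x hx ↦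
      (hf i x hx).differentiableAt.differentiableWithinAt
  refine ⟨deriv g, ?_⟩
  rw [hasSumLocallyUniformlyOn_iff_tendstoLocallyUniformlyOn]
  refine (hg.deriv hd hs).congr fun n x hx ↦ ?_
  exact (HasDerivAt.fun_sum fun i _ ↦ hf i x hx).deriv

theorem hasDerivAt_tsum_of_summableLocallyUniformlyOn {f f' : ι → ℂ → ℂ} (hs : IsOpen s)
    (h : SummableLocallyUniformlyOn f s) (hf : ∀ i, ∀ x ∈ s, HasDerivAt (f i) (f' i x) x)
    {x : ℂ} (hx : x ∈ s) :
    HasDerivAt (fun x ↦ ∑' i, f i x) (∑' i, f' i x) x := by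
  have h' := summableLocallyUniformlyOn_deriv hs h hf
  refine hasDerivAt_of_tendstoLocallyUniformlyOn hs (f' := fun n x ↦ ∑ i ∈ n, f' i x)
    (f := fun n x ↦ ∑ i ∈ n, f i x) (g := fun x ↦ ∑' i, f i x) (g' := fun x ↦ ∑' i, f' i x)
    (l := atTop) ?_ ?_ (fun y hy ↦ ?_) hx
  · exact hasSumLocallyUniformlyOn_iff_tendstoLocallyUniformlyOn.mp
      h'.hasSumLocallyUniformlyOn
  · exact .of_forall fun n y hy ↦ HasDerivAt.fun_sum fun i _ ↦ hf i y hy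
  · exact (h.summable hy).hasSum

/-- The partial products and their derivatives converge locally uniformly, and the limit has no
zeros, so the logarithmic derivatives of the partial products converge as well. These are the
partial sums of `g`; the summability of `g` is thus a consequence, and the series may be
differentiated once more. -/
theorem hasDerivAt_logDeriv_tprod {f g g' : ι → ℂ → ℂ} (hs : IsOpen s)
    (h : MultipliableLocallyUniformlyOn f s) (hf : ∀ i, DifferentiableOn ℂ (f i) s)
    (hf₀ : ∀ i, ∀ x ∈ s, f i x ≠ 0) (hF₀ : ∀ x ∈ s, ∏' i, f i x ≠ 0)
    (hfg : ∀ i, ∀ x ∈ s, logDeriv (f i) x = g i x)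
    (hg : ∀ i, ∀ x ∈ s, HasDerivAt (g i) (g' i x) x) {x : ℂ} (hx : x ∈ s) :
    HasDerivAt (logDeriv fun x ↦ ∏' i, f i x) (∑' i, g' i x) x := by
  have hP := hasProdLocallyUniformlyOn_iff_tendstoLocallyUniformlyOn.mp
    h.hasProdLocallyUniformlyOn
  have hd (n : Finset ι) : DifferentiableOn ℂ (fun x ↦ ∏ i ∈ n, f i x) s :=
    DifferentiableOn.fun_finsetProd fun i _ ↦ hf i
  have hF : DifferentiableOn ℂ (fun x ↦ ∏' i, f i x) s := hP.differentiableOn (.of_forall hd) hs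
  have hL := (hP.deriv (.of_forall hd) hs).div₀ hP (hF.deriv hs).continuousOn hF.continuousOn hF₀
  have hsum : ∀ n : Finset ι, ∀ y ∈ s,
      logDeriv (fun x ↦ ∏ i ∈ n, f i x) y = ∑ i ∈ n, g i y := fun n y hy ↦ by
    rw [logDeriv_prod (fun i _ ↦ hf₀ i y hy)
      (fun i _ ↦ (hf i y hy).differentiableAt (hs.mem_nhds hy))]
    exact Finset.sum_congr rfl fun i _ ↦ hfg i y hy
  have hG : TendstoLocallyUniformlyOn (fun (n : Finset ι) x ↦ ∑ i ∈ n, g i x)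
      (logDeriv fun x ↦ ∏' i, f i x) atTop s :=
    hL.congr fun n y hy ↦ hsum n y hy
  have hS : HasSumLocallyUniformlyOn g (logDeriv fun x ↦ ∏' i, f i x) s :=
    hasSumLocallyUniformlyOn_iff_tendstoLocallyUniformlyOn.mpr hG
  refine (hasDerivAt_tsum_of_summableLocallyUniformlyOn hs hS.summableLocallyUniformlyOn hg
    hx).congr_of_eventuallyEq ?_
  filter_upwards [hs.mem_nhds hx] with y hy using (hS.tsum_eqOn hy).symm

end Series

/-! ### Uniqueness for the differential equation of `℘`. -/

/-- A function with derivative `f'` off the countable closed set `S`, which satisfies the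
differential equation `f'' = 6 f² - g / 2` there and which tends to infinity at the points of `S`. -/
structure EllipticSolution (g : ℂ) (f f' : ℂ → ℂ) (S : Set ℂ) : Prop where
  isClosed : IsClosed S
  countable : S.Countable
  hasDerivAt : ∀ z ∉ S, HasDerivAt f (f' z) z
  hasDerivAt_deriv : ∀ z ∉ S, HasDerivAt f' (6 * f z ^ 2 - g / 2) z
  tendsto : ∀ z ∈ S, Tendsto f (𝓝[≠] z) (Bornology.cobounded ℂ)

theorem isPreconnected_compl_of_countable {S : Set ℂ} (hS : S.Countable) : IsPreconnected Sᶜ :=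
  (hS.isConnected_compl_of_one_lt_rank (by simp)).isPreconnected

theorem eventually_notMem_of_countable {S : Set ℂ} (hS : S.Countable) (z : ℂ) :
    ∃ᶠ w in 𝓝[≠] z, w ∉ S := by
  have h := (hS.union (Set.countable_singleton z)).dense_compl ℝ
  rw [frequently_nhdsWithin_iff]
  refine (mem_closure_iff_frequently.mp (h z)).mono fun w hw ↦ ?_
  simp only [Set.mem_compl_iff, Set.mem_union, not_or] at hw
  exact hw

theorem analyticAt_of_hasDerivAt {S : Set ℂ} (hS : IsClosed S) {f f' : ℂ → ℂ}
    (h : ∀ z ∉ S, HasDerivAt f (f' z) z) {z : ℂ} (hz : z ∉ S) : AnalyticAt ℂ f z :=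
  DifferentiableOn.analyticAt (s := Sᶜ)
    (fun w hw ↦ (h w hw).differentiableAt.differentiableWithinAt) (hS.isOpen_compl.mem_nhds hz)

namespace EllipticSolution

variable {g : ℂ} {f₁ f₁' f₂ f₂' : ℂ → ℂ} {S₁ S₂ : Set ℂ}

theorem comp_add_left (h : EllipticSolution g f₁ f₁' S₁) (a : ℂ) :
    EllipticSolution g (fun t ↦ f₁ (a + t)) (fun t ↦ f₁' (a + t)) ((a + ·) ⁻¹' S₁) where
  isClosed := h.isClosed.preimage (by fun_prop)
  countable := h.countable.preimage (add_right_injective a)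
  hasDerivAt z hz := (h.hasDerivAt _ hz).comp_const_add a z
  hasDerivAt_deriv z hz := (h.hasDerivAt_deriv _ hz).comp_const_add a z
  tendsto z hz := (h.tendsto _ hz).comp <| by
    refine tendsto_nhdsWithin_iff.mpr ⟨?_, ?_⟩
    · exact (Continuous.tendsto (by fun_prop) z).mono_left nhdsWithin_le_nhds
    · filter_upwards [self_mem_nhdsWithin] with w hw using by simpa using hw

/-- The difference `d` satisfies `d'' = 6 (f₁ + f₂) d` and `d = d' = 0` at `a`. If `d` had finite
order there, `d''` would have order two less, while the right side has at least the order of `d`. -/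
theorem eventuallyEq (h₁ : EllipticSolution g f₁ f₁' S₁) (h₂ : EllipticSolution g f₂ f₂' S₂)
    {a : ℂ} (ha₁ : a ∉ S₁) (ha₂ : a ∉ S₂) (hf : f₁ a = f₂ a) (hf' : f₁' a = f₂' a) :
    f₁ =ᶠ[𝓝 a] f₂ := by
  have hA₁ := analyticAt_of_hasDerivAt h₁.isClosed h₁.hasDerivAt ha₁
  have hA₂ := analyticAt_of_hasDerivAt h₂.isClosed h₂.hasDerivAt ha₂
  have hU₁ := h₁.isClosed.isOpen_compl.mem_nhds ha₁
  have hU₂ := h₂.isClosed.isOpen_compl.mem_nhds ha₂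
  have hd : AnalyticAt ℂ (f₁ - f₂) a := hA₁.sub hA₂
  have hd0 : (f₁ - f₂) a = 0 := by simp [hf]
  have e1 : deriv (f₁ - f₂) =ᶠ[𝓝 a] f₁' - f₂' := by
    filter_upwards [hU₁, hU₂] with w hw₁ hw₂
    exact ((h₁.hasDerivAt w hw₁).sub (h₂.hasDerivAt w hw₂)).deriv
  have hd1 : deriv (f₁ - f₂) a = 0 := by rw [e1.eq_of_nhds]; simp [hf']
  have e2 : deriv (deriv (f₁ - f₂)) =ᶠ[𝓝 a] (fun w ↦ 6 * (f₁ w + f₂ w)) * (f₁ - f₂) := by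
    refine e1.deriv.trans ?_
    filter_upwards [hU₁, hU₂] with w hw₁ hw₂
    rw [((h₁.hasDerivAt_deriv w hw₁).sub (h₂.hasDerivAt_deriv w hw₂)).deriv]
    simp only [Pi.mul_apply, Pi.sub_apply]
    ring
  have o1 := hd.analyticOrderAt_deriv_add_one
  have o2 := hd.deriv.analyticOrderAt_deriv_add_one
  rw [hd0] at o1
  rw [hd1] at o2
  simp only [sub_zero] at o1 o2
  rw [analyticOrderAt_congr e2, analyticOrderAt_mul (by fun_prop) hd] at o2
  have key : analyticOrderAt (f₁ - f₂) a = ⊤ := by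
    change analyticOrderAt (deriv (f₁ - f₂)) a + 1 = analyticOrderAt (f₁ - f₂) a at o1
    change _ + 1 = analyticOrderAt (deriv (f₁ - f₂)) a at o2
    generalize analyticOrderAt (f₁ - f₂) a = x at *
    generalize analyticOrderAt (fun w ↦ 6 * (f₁ w + f₂ w)) a = y at *
    generalize analyticOrderAt (deriv (f₁ - f₂)) a = w at *
    subst o2
    by_contra hx
    lift x to ℕ using hx
    cases y with
    | top => simp at o1
    | coe y => norm_cast at o1; omega
  filter_upwards [analyticOrderAt_eq_top.mp key] with w hw
  simpa [sub_eq_zero] using hw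

theorem eqOn (h₁ : EllipticSolution g f₁ f₁' S₁) (h₂ : EllipticSolution g f₂ f₂' S₂)
    {a : ℂ} (ha₁ : a ∉ S₁) (ha₂ : a ∉ S₂) (hf : f₁ a = f₂ a) (hf' : f₁' a = f₂' a) :
    Set.EqOn f₁ f₂ (S₁ ∪ S₂)ᶜ := by
  have hc := isPreconnected_compl_of_countable (h₁.countable.union h₂.countable)
  refine AnalyticOnNhd.eqOn_of_preconnected_of_eventuallyEq (𝕜 := ℂ) (z₀ := a) ?_ ?_ hc
    (by simp [ha₁, ha₂]) (h₁.eventuallyEq h₂ ha₁ ha₂ hf hf')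
  · exact fun z hz ↦ analyticAt_of_hasDerivAt h₁.isClosed h₁.hasDerivAt fun h ↦ hz (.inl h)
  · exact fun z hz ↦ analyticAt_of_hasDerivAt h₂.isClosed h₂.hasDerivAt fun h ↦ hz (.inr h)

/-- Near a point of `S₁` outside `S₂` the function `f₁` would be unbounded and `f₂` bounded,
although they agree at points arbitrarily close by. -/
theorem subset_of_eqOn (h₁ : EllipticSolution g f₁ f₁' S₁) (h₂ : EllipticSolution g f₂ f₂' S₂)
    (h : Set.EqOn f₁ f₂ (S₁ ∪ S₂)ᶜ) : S₁ ⊆ S₂ := by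
  intro z hz₁
  by_contra hz₂
  have hb : ∀ᶠ w in 𝓝[≠] z, ‖f₂ w‖ < ‖f₂ z‖ + 1 :=
    ((h₂.hasDerivAt z hz₂).continuousAt.norm.eventually_lt_const (by linarith)).filter_mono
      nhdsWithin_le_nhds
  have hi : ∀ᶠ w in 𝓝[≠] z, ‖f₂ z‖ + 1 ≤ ‖f₁ w‖ :=
    (tendsto_norm_cobounded_atTop.comp (h₁.tendsto z hz₁)).eventually_ge_atTop _
  obtain ⟨w, hw, hw₁, hw₂⟩ := ((eventually_notMem_of_countable
    (h₁.countable.union h₂.countable) z).and_eventually (hb.and hi)).exists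
  rw [h hw] at hw₂
  linarith

/-- Two solutions of the same differential equation which agree to first order at a point agree
everywhere and have the same poles. -/
theorem rigidity (h₁ : EllipticSolution g f₁ f₁' S₁) (h₂ : EllipticSolution g f₂ f₂' S₂)
    {a₁ a₂ : ℂ} (ha₁ : a₁ ∉ S₁) (ha₂ : a₂ ∉ S₂) (hf : f₁ a₁ = f₂ a₂) (hf' : f₁' a₁ = f₂' a₂) :
    (∀ t, a₁ + t ∈ S₁ ↔ a₂ + t ∈ S₂) ∧ ∀ t, a₁ + t ∉ S₁ → f₁ (a₁ + t) = f₂ (a₂ + t) := by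
  have k₁ := h₁.comp_add_left a₁
  have k₂ := h₂.comp_add_left a₂
  have e := k₁.eqOn k₂ (a := 0) (by simpa) (by simpa) (by simpa) (by simpa)
  have s₁ := k₁.subset_of_eqOn k₂ e
  have s₂ := k₂.subset_of_eqOn k₁ (Set.union_comm _ _ ▸ e.symm)
  refine ⟨fun t ↦ ⟨fun h ↦ s₁ h, fun h ↦ s₂ h⟩, fun t ht ↦ e ?_⟩
  simp only [Set.mem_compl_iff, Set.mem_union, not_or]
  exact ⟨ht, fun h ↦ ht (s₂ h)⟩

end EllipticSolution

/-! ### Addition and duplication theorems for `℘`. -/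

section Addition

variable (L : PeriodPair)

theorem weierstrassP_hasDerivAt {z : ℂ} (hz : z ∉ L.lattice) :
    HasDerivAt L.weierstrassP (L.derivWeierstrassP z) z := by
  have := (L.analyticOnNhd_weierstrassP z hz).differentiableAt.hasDerivAt
  rwa [PeriodPair.deriv_weierstrassP] at this

theorem weierstrassP_tendsto {z : ℂ} (hz : z ∈ L.lattice) :
    Tendsto L.weierstrassP (𝓝[≠] z) (Bornology.cobounded ℂ) := by
  apply tendsto_cobounded_of_meromorphicOrderAt_neg
  rw [L.order_weierstrassP z hz]
  decide

theorem lattice_countable : (L.lattice : Set ℂ).Countable :=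
  Set.countable_coe_iff.mp (inferInstanceAs (Countable L.lattice))

/-- The second-order equation is the derivative of `℘'² = 4℘³ - g₂℘ - g₃` divided by `℘'`. The
division is legitimate on the connected complement of the lattice because `℘'` is not identically
zero there: otherwise `℘` would be constant and have no pole. -/
theorem ellipticSolution_weierstrassP :
    EllipticSolution L.g₂ L.weierstrassP L.derivWeierstrassP L.lattice where
  isClosed := L.isClosed_lattice
  countable := lattice_countable L
  hasDerivAt z hz := weierstrassP_hasDerivAt L hz
  hasDerivAt_deriv := by
    have hO := L.isClosed_lattice.isOpen_compl
    have hP := L.analyticOnNhd_weierstrassP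
    have hP' := L.analyticOnNhd_derivWeierstrassP
    have hmul : ∀ z ∈ (L.latticeᶜ : Set ℂ), L.derivWeierstrassP z *
        (deriv L.derivWeierstrassP z - (6 * L.weierstrassP z ^ 2 - L.g₂ / 2)) = 0 := by
      intro z hz
      have h1 := ((hP' z hz).differentiableAt.hasDerivAt.fun_pow 2).congr_of_eventuallyEq
        (f₁ := fun w ↦ 4 * L.weierstrassP w ^ 3 - L.g₂ * L.weierstrassP w - L.g₃) (by
          filter_upwards [hO.mem_nhds hz] with w hw using (L.derivWeierstrassP_sq w hw).symm)
      have h2 := ((((weierstrassP_hasDerivAt L hz).fun_pow 3).const_mul 4).sub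
        ((weierstrassP_hasDerivAt L hz).const_mul L.g₂)).sub_const L.g₃
      have h3 := h1.unique h2
      simp only [Nat.cast_ofNat, Nat.add_one_sub_one, pow_one] at h3
      linear_combination h3 / 2
    have hzero := AnalyticOnNhd.eq_zero_or_eq_zero_of_mul_eq_zero hP'
      (g := fun z ↦ deriv L.derivWeierstrassP z - (6 * L.weierstrassP z ^ 2 - L.g₂ / 2))
      (fun z hz ↦ by
        have := hP z hz
        have := (hP' z hz).deriv
        fun_prop) hmul
      (isPreconnected_compl_of_countable (lattice_countable L))
    rcases hzero with h | h
    · exfalso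
      obtain ⟨c, hc⟩ := hO.exists_is_const_of_deriv_eq_zero (f := L.weierstrassP)
        (isPreconnected_compl_of_countable (lattice_countable L))
        (fun z hz ↦ (hP z hz).differentiableAt.differentiableWithinAt)
        (fun z hz ↦ by simpa using h z hz)
      have hi : ∀ᶠ w in 𝓝[≠] (0 : ℂ), ‖c‖ + 1 ≤ ‖L.weierstrassP w‖ :=
        (tendsto_norm_cobounded_atTop.comp
          (weierstrassP_tendsto L (zero_mem _))).eventually_ge_atTop _
      obtain ⟨w, hw, hw'⟩ :=
        ((eventually_notMem_of_countable (lattice_countable L) 0).and_eventually hi).exists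
      rw [hc w hw] at hw'
      linarith
    · intro z hz
      have := (hP' z hz).differentiableAt.hasDerivAt
      rwa [sub_eq_zero.mp (h z hz)] at this
  tendsto z hz := weierstrassP_tendsto L hz

variable {L}

theorem derivWeierstrassP_hasDerivAt {z : ℂ} (hz : z ∉ L.lattice) :
    HasDerivAt L.derivWeierstrassP (6 * L.weierstrassP z ^ 2 - L.g₂ / 2) z :=
  (ellipticSolution_weierstrassP L).hasDerivAt_deriv z hz

/-- By rigidity `℘(z + ·)` and `℘(w + ·)` have the same poles; the second has one at `-w`. -/
theorem sub_mem_lattice_of_eq {z w : ℂ} (hz : z ∉ L.lattice) (hw : w ∉ L.lattice)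
    (h : L.weierstrassP z = L.weierstrassP w)
    (h' : L.derivWeierstrassP z = L.derivWeierstrassP w) : z - w ∈ L.lattice := by
  have := ((ellipticSolution_weierstrassP L).rigidity (ellipticSolution_weierstrassP L) hz hw
    h h').1 (-w)
  simpa [← sub_eq_add_neg] using this

theorem sub_mem_or_add_mem_lattice {z w : ℂ} (hz : z ∉ L.lattice) (hw : w ∉ L.lattice)
    (h : L.weierstrassP z = L.weierstrassP w) : z - w ∈ L.lattice ∨ z + w ∈ L.lattice := by
  have h2 : L.derivWeierstrassP z ^ 2 = L.derivWeierstrassP w ^ 2 := by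
    rw [L.derivWeierstrassP_sq z hz, L.derivWeierstrassP_sq w hw, h]
  rcases sq_eq_sq_iff_eq_or_eq_neg.mp h2 with h' | h'
  · exact .inl (sub_mem_lattice_of_eq hz hw h h')
  · right
    simpa using sub_mem_lattice_of_eq (w := -w) hz (by simpa) (by simpa) (by simpa)

theorem weierstrassP_expansion (z : ℂ) :
    L.weierstrassP z = 1 / z ^ 2 + L.weierstrassPExcept 0 z := by
  have := L.weierstrassPExcept_def 0 z
  simp only [ZeroMemClass.coe_zero] at this
  rw [this]
  simp

theorem derivWeierstrassP_expansion (z : ℂ) :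
    L.derivWeierstrassP z = -2 / z ^ 3 + L.derivWeierstrassPExcept 0 z := by
  have := L.derivWeierstrassPExcept_def 0 z
  simp only [ZeroMemClass.coe_zero] at this
  rw [this, sub_zero]
  ring

/-- The slope of the line through the points with parameters `z` and `w`. -/
noncomputable def chordSlope (L : PeriodPair) (z w : ℂ) : ℂ :=
  (L.derivWeierstrassP z - L.derivWeierstrassP w) / (L.weierstrassP z - L.weierstrassP w)

/-- This limit identifies the constant in the addition theorem: the double poles at `0` of the
squared slope and of `℘` cancel. -/
theorem chordSlope_expression_tendsto {s : ℂ} (hs : s ∉ L.lattice) :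
    Tendsto (fun z ↦ chordSlope L z (s - z) ^ 2 / 4 - L.weierstrassP z - L.weierstrassP (s - z))
      (𝓝[≠] 0) (𝓝 (L.weierstrassP s)) := by
  set p := L.weierstrassPExcept 0
  set p' := L.derivWeierstrassPExcept 0
  set W : ℂ → ℂ := fun z ↦ L.weierstrassP (s - z)
  set W' : ℂ → ℂ := fun z ↦ L.derivWeierstrassP (s - z)
  have hp : ContinuousAt p 0 := (L.analyticAt_weierstrassPExcept 0).continuousAt
  have hp' : ContinuousAt p' 0 := (L.analyticAt_derivWeierstrassPExcept 0).continuousAt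
  have hW : ContinuousAt W 0 := by
    refine ContinuousAt.comp (g := L.weierstrassP) (f := fun z ↦ s - z) ?_ (by fun_prop)
    simpa using (weierstrassP_hasDerivAt L hs).continuousAt
  have hW' : ContinuousAt W' 0 := by
    refine ContinuousAt.comp (g := L.derivWeierstrassP) (f := fun z ↦ s - z) ?_ (by fun_prop)
    simpa using (derivWeierstrassP_hasDerivAt hs).continuousAt
  set A : ℂ → ℂ := fun z ↦ z ^ 3 * (p' z - W' z) / 2
  set B : ℂ → ℂ := fun z ↦ z ^ 2 * (p z - W z)
  have hA : ContinuousAt A 0 := by fun_prop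
  have hB : ContinuousAt B 0 := by fun_prop
  have hB0 : B 0 = 0 := by simp [B]
  have hB1 : ∀ᶠ z in 𝓝 (0 : ℂ), 1 + B z ≠ 0 := by
    have : ContinuousAt (fun z ↦ 1 + B z) 0 := by fun_prop
    exact this.eventually_ne (by simp [hB0])
  -- The slope is `(-2 + 2A) / (z (1 + B))`, so after subtracting `1/z²` the numerator is `(1 - A)²
  -- - (1 + B)² = (-A - B)(2 - A + B)`. The factor `-A - B` is divisible by `z²`, and `E` is the
  -- result of that division.
  set E : ℂ → ℂ := fun z ↦ (-(z * (p' z - W' z) / 2) - (p z - W z)) * (2 - A z + B z) /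
    (1 + B z) ^ 2 - p z - W z
  have hE : ContinuousAt E 0 := by
    have : (1 + B 0) ^ 2 ≠ 0 := by simp [hB0]
    fun_prop (disch := assumption)
  have hE0 : E 0 = L.weierstrassP s := by
    simp only [E, A, B, p, W, PeriodPair.weierstrassPExcept_zero, sub_zero]
    ring
  rw [← hE0]
  refine (hE.tendsto.mono_left nhdsWithin_le_nhds).congr' ?_
  filter_upwards [self_mem_nhdsWithin, hB1.filter_mono nhdsWithin_le_nhds] with z hz hz1
  replace hz : z ≠ 0 := hz
  have e : chordSlope L z (s - z) = (-2 + 2 * A z) / (z * (1 + B z)) := by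
    rw [chordSlope, weierstrassP_expansion, derivWeierstrassP_expansion]
    have e1 : -2 / z ^ 3 + L.derivWeierstrassPExcept 0 z - L.derivWeierstrassP (s - z) =
        (-2 + 2 * A z) / z ^ 3 := by
      simp only [A, p', W']; field_simp; ring
    have e2 : 1 / z ^ 2 + L.weierstrassPExcept 0 z - L.weierstrassP (s - z) =
        (1 + B z) / z ^ 2 := by
      simp only [B, p, W]; field_simp; ring
    rw [e1, e2]
    field_simp
  rw [e, weierstrassP_expansion]
  change _ = _ - (1 / z ^ 2 + p z) - W z
  have key : (-(z * (p' z - W' z) / 2) - (p z - W z)) * z ^ 2 = -(A z) - B z := by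
    simp only [A, B]; ring
  have key' : -(z * (p' z - W' z) / 2) - (p z - W z) = (-(A z) - B z) / z ^ 2 := by
    rw [← key]; field_simp
  simp only [E]
  rw [key']
  field_simp
  ring

/-- The derivative vanishes modulo the cubic equations at `z` and `s - z`; they enter through their
difference, from which `g₃` drops out. -/
theorem chordSlope_expression_hasDerivAt {z s : ℂ} (hz : z ∉ L.lattice) (hsz : s - z ∉ L.lattice)
    (hne : L.weierstrassP z ≠ L.weierstrassP (s - z)) :
    HasDerivAt
      (fun z ↦ chordSlope L z (s - z) ^ 2 / 4 - L.weierstrassP z - L.weierstrassP (s - z)) 0 z := by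
  have hx := weierstrassP_hasDerivAt L hz
  have hu := derivWeierstrassP_hasDerivAt hz
  have hy := (weierstrassP_hasDerivAt L hsz).comp_const_sub s z
  have hv := (derivWeierstrassP_hasDerivAt hsz).comp_const_sub s z
  have hne' := sub_ne_zero.mpr hne
  have h := ((((hu.fun_sub hv).fun_div (hx.fun_sub hy) hne').fun_pow 2).div_const 4).fun_sub hx
    |>.fun_sub hy
  refine h.congr_deriv ?_
  have q1 := L.derivWeierstrassP_sq z hz
  have q2 := L.derivWeierstrassP_sq _ hsz
  generalize L.weierstrassP z = x at *
  generalize L.weierstrassP (s - z) = y at *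
  generalize L.derivWeierstrassP z = u at *
  generalize L.derivWeierstrassP (s - z) = v at *
  simp only [Nat.cast_ofNat, Nat.add_one_sub_one, pow_one]
  field_simp
  linear_combination (-2 * u + 2 * v) * (q1 - q2)

/-- The addition theorem for the Weierstrass `℘`-function. -/
theorem weierstrassP_add {z w : ℂ} (hz : z ∉ L.lattice) (hw : w ∉ L.lattice)
    (hs : z + w ∉ L.lattice) (hd : z - w ∉ L.lattice) :
    L.weierstrassP (z + w) = chordSlope L z w ^ 2 / 4 - L.weierstrassP z - L.weierstrassP w := by
  generalize hs' : z + w = s at *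
  obtain rfl : w = s - z := by rw [← hs']; ring
  -- The sum `s` is held fixed. Off this countable closed set the right side is holomorphic in `z`
  -- with zero derivative, and the complement is connected, so it is constant.
  set S : Set ℂ := L.lattice ∪ ((fun t ↦ s - t) ⁻¹' L.lattice ∪
    (fun t ↦ t - (s - t)) ⁻¹' L.lattice) with hS
  have hScl : IsClosed S := L.isClosed_lattice.union
    ((L.isClosed_lattice.preimage (by fun_prop)).union (L.isClosed_lattice.preimage (by fun_prop)))
  have hSco : S.Countable := (lattice_countable L).union
    (((lattice_countable L).preimage (sub_right_injective)).union
      ((lattice_countable L).preimage (fun a b h ↦ by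
        linear_combination h / 2)))
  have hU : ∀ t ∈ Sᶜ, t ∉ L.lattice ∧ s - t ∉ L.lattice ∧
      L.weierstrassP t ≠ L.weierstrassP (s - t) := by
    intro t ht
    simp only [hS, Set.mem_compl_iff, Set.mem_union, Set.mem_preimage, not_or,
      SetLike.mem_coe] at ht
    refine ⟨ht.1, ht.2.1, fun h ↦ ?_⟩
    rcases sub_mem_or_add_mem_lattice ht.1 ht.2.1 h with h | h
    · exact ht.2.2 h
    · exact hs (by simpa using h)
  obtain ⟨c, hc⟩ := hScl.isOpen_compl.exists_is_const_of_deriv_eq_zero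
    (f := fun z ↦ chordSlope L z (s - z) ^ 2 / 4 - L.weierstrassP z - L.weierstrassP (s - z))
    (isPreconnected_compl_of_countable hSco)
    (fun t ht ↦ (chordSlope_expression_hasDerivAt (hU t ht).1 (hU t ht).2.1
      (hU t ht).2.2).differentiableAt.differentiableWithinAt)
    (fun t ht ↦ (chordSlope_expression_hasDerivAt (hU t ht).1 (hU t ht).2.1
      (hU t ht).2.2).deriv)
  have hzS : z ∈ Sᶜ := by
    simp only [hS, Set.mem_compl_iff, Set.mem_union, Set.mem_preimage, not_or,
      SetLike.mem_coe]
    exact ⟨hz, hw, hd⟩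
  rw [hc z hzS]
  -- The constant is found from the limit at `0`, which lies in `S` but is approached by points
  -- outside `S`.
  exact isClosed_singleton.mem_of_frequently_of_tendsto
    ((eventually_notMem_of_countable hSco 0).mono fun t ht ↦ hc t ht)
    (chordSlope_expression_tendsto hs)

theorem ne_of_sub_notMem {z w : ℂ} (hz : z ∉ L.lattice) (hw : w ∉ L.lattice)
    (hs : z + w ∉ L.lattice) (hd : z - w ∉ L.lattice) : L.weierstrassP z ≠ L.weierstrassP w :=
  fun h ↦ (sub_mem_or_add_mem_lattice hz hw h).elim hd hs

/-- Obtained by differentiating the addition theorem in `z` with `w` fixed and simplifying with the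
two cubic equations. -/
theorem derivWeierstrassP_add {z w : ℂ} (hz : z ∉ L.lattice) (hw : w ∉ L.lattice)
    (hs : z + w ∉ L.lattice) (hd : z - w ∉ L.lattice) :
    L.derivWeierstrassP (z + w) =
      -(chordSlope L z w * (L.weierstrassP (z + w) - L.weierstrassP z) +
        L.derivWeierstrassP z) := by
  have hne := sub_ne_zero.mpr (ne_of_sub_notMem hz hw hs hd)
  have hx := weierstrassP_hasDerivAt L hz
  have hu := derivWeierstrassP_hasDerivAt hz
  have h := ((((hu.sub_const (L.derivWeierstrassP w)).fun_div
    (hx.sub_const (L.weierstrassP w)) hne).fun_pow 2).div_const 4).fun_sub hx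
    |>.sub_const (L.weierstrassP w)
  have h' := (weierstrassP_hasDerivAt L hs).comp_add_const z w
  have hO := L.isClosed_lattice.isOpen_compl
  have e := h'.congr_of_eventuallyEq (f₁ := fun z ↦ ((L.derivWeierstrassP z -
      L.derivWeierstrassP w) / (L.weierstrassP z - L.weierstrassP w)) ^ 2 / 4 -
      L.weierstrassP z - L.weierstrassP w) (by
    filter_upwards [hO.mem_nhds hz,
      (hO.preimage (f := fun t ↦ t + w) (by fun_prop)).mem_nhds hs,
      (hO.preimage (f := fun t ↦ t - w) (by fun_prop)).mem_nhds hd] with t h1 h2 h3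
    exact (weierstrassP_add h1 hw h2 h3).symm)
  rw [e.unique h, weierstrassP_add hz hw hs hd, chordSlope]
  have q1 := L.derivWeierstrassP_sq z hz
  have q2 := L.derivWeierstrassP_sq _ hw
  generalize L.weierstrassP z = x at *
  generalize L.weierstrassP w = y at *
  generalize L.derivWeierstrassP z = u at *
  generalize L.derivWeierstrassP w = v at *
  simp only [Nat.cast_ofNat, Nat.add_one_sub_one, pow_one]
  field_simp
  linear_combination (-(u - v)) * (q1 - q2)

theorem tangentSlope_tendsto {z : ℂ} (hz : z ∉ L.lattice) (hz' : L.derivWeierstrassP z ≠ 0) :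
    Tendsto (fun w ↦ chordSlope L z w) (𝓝[≠] z)
      (𝓝 ((6 * L.weierstrassP z ^ 2 - L.g₂ / 2) / L.derivWeierstrassP z)) := by
  have h1 := hasDerivAt_iff_tendsto_slope.mp (weierstrassP_hasDerivAt L hz)
  have h2 := hasDerivAt_iff_tendsto_slope.mp (derivWeierstrassP_hasDerivAt hz)
  refine (h2.div h1 hz').congr' ?_
  filter_upwards [self_mem_nhdsWithin] with w hw
  have hw' : w - z ≠ 0 := sub_ne_zero.mpr hw
  simp only [Pi.div_apply, slope_def_field, chordSlope]
  rw [div_div_div_cancel_right₀ hw', ← neg_div_neg_eq]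
  simp

theorem two_mul_mem_of_derivWeierstrassP_eq_zero {z : ℂ} (hz : z ∉ L.lattice)
    (h : L.derivWeierstrassP z = 0) : z + z ∈ L.lattice := by
  simpa using sub_mem_lattice_of_eq (w := -z) hz (by simpa) (by simp) (by simp [h])

/-- The duplication formula for the Weierstrass `℘`-function and its derivative. -/
theorem weierstrassP_add_self {z : ℂ} (hz : z ∉ L.lattice) (hs : z + z ∉ L.lattice) :
    L.weierstrassP (z + z) = ((6 * L.weierstrassP z ^ 2 - L.g₂ / 2) / L.derivWeierstrassP z) ^ 2 / 4
        - L.weierstrassP z - L.weierstrassP z ∧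
      L.derivWeierstrassP (z + z) =
        -((6 * L.weierstrassP z ^ 2 - L.g₂ / 2) / L.derivWeierstrassP z *
          (L.weierstrassP (z + z) - L.weierstrassP z) + L.derivWeierstrassP z) := by
  have hz' : L.derivWeierstrassP z ≠ 0 :=
    fun h ↦ hs (two_mul_mem_of_derivWeierstrassP_eq_zero hz h)
  have hO := L.isClosed_lattice.isOpen_compl
  -- Both formulas are limits of the addition formulas as `w → z`. Since `℘'(z) ≠ 0`, nearby `w ≠ z`
  -- have `℘(w) ≠ ℘(z)`, hence `z - w ∉ Λ`.
  have hl := tangentSlope_tendsto hz hz'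
  have hP : Tendsto L.weierstrassP (𝓝[≠] z) (𝓝 (L.weierstrassP z)) :=
    (weierstrassP_hasDerivAt L hz).continuousAt.tendsto.mono_left nhdsWithin_le_nhds
  have hadd : Tendsto (fun w ↦ z + w) (𝓝[≠] z) (𝓝 (z + z)) :=
    (Continuous.tendsto (by fun_prop) z).mono_left nhdsWithin_le_nhds
  have hPs : Tendsto (fun w ↦ L.weierstrassP (z + w)) (𝓝[≠] z) (𝓝 (L.weierstrassP (z + z))) :=
    (weierstrassP_hasDerivAt L hs).continuousAt.tendsto.comp hadd
  have hPs' : Tendsto (fun w ↦ L.derivWeierstrassP (z + w)) (𝓝[≠] z)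
      (𝓝 (L.derivWeierstrassP (z + z))) :=
    (derivWeierstrassP_hasDerivAt hs).continuousAt.tendsto.comp hadd
  have hev : ∀ᶠ w in 𝓝[≠] z, w ∉ L.lattice ∧ z + w ∉ L.lattice ∧ z - w ∉ L.lattice := by
    have h3 := (weierstrassP_hasDerivAt L hz).eventually_ne hz' (c := L.weierstrassP z)
    filter_upwards [nhdsWithin_le_nhds (hO.mem_nhds hz),
      hadd (hO.mem_nhds hs), h3] with w h1 h2 h3
    refine ⟨h1, h2, fun h ↦ h3 ?_⟩
    have := L.weierstrassP_add_coe w ⟨_, h⟩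
    simpa using this.symm
  refine ⟨?_, ?_⟩
  · refine tendsto_nhds_unique hPs
      (((((hl.pow 2).div_const 4).sub_const (L.weierstrassP z)).sub hP).congr' ?_)
    filter_upwards [hev] with w ⟨h1, h2, h3⟩ using (weierstrassP_add hz h1 h2 h3).symm
  · refine tendsto_nhds_unique hPs'
      (((hl.mul (hPs.sub_const (L.weierstrassP z))).add_const _).neg.congr' ?_)
    filter_upwards [hev] with w ⟨h1, h2, h3⟩ using (derivWeierstrassP_add hz h1 h2 h3).symm

end Addition

/-! ### Compatibility of the uniformization with the group law. -/

section Uniformization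

variable {L : PeriodPair} {E : WeierstrassCurve ℝ}

/-- `z` is mapped to the point `P` of `E` under `ℂ → ℂ/Λ ≅ E(ℂ)`. -/
def Uniformizes (L : PeriodPair) (E : WeierstrassCurve ℝ) (z : ℂ) (P : E.toAffine.Point) : Prop :=
  (z ∈ L.lattice ∧ P = 0) ∨ CorrespondsToPoint L E z P

theorem correspondsToPoint_neg {z : ℂ} {P : E.toAffine.Point} (h : CorrespondsToPoint L E z P) :
    CorrespondsToPoint L E (-z) (-P) := by
  obtain ⟨hz, x, y, hxy, rfl, hX, hY⟩ := h
  refine ⟨by simpa, x, _, (WeierstrassCurve.Affine.nonsingular_neg ..).mpr hxy, rfl, by simpa, ?_⟩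
  simp only [PeriodPair.derivWeierstrassP_neg, hY, WeierstrassCurve.Affine.negY]
  push_cast
  ring

/-- In the coordinates `x + b₂/12` and `2y + a₁x + a₃` a line of slope `λ` acquires slope `2λ + a₁`.
With this dictionary the addition formulas for `℘` and `℘'` become those of the Weierstrass curve.
-/
theorem uniformizes_of_slope {z w : ℂ} {x₁ y₁ x₂ y₂ : ℝ}
    (h₁ : E.toAffine.Nonsingular x₁ y₁) (h₂ : E.toAffine.Nonsingular x₂ y₂)
    (hX₁ : L.weierstrassP z = x₁ + E.b₂ / 12)
    (hY₁ : L.derivWeierstrassP z = 2 * y₁ + E.a₁ * x₁ + E.a₃)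
    (hX₂ : L.weierstrassP w = x₂ + E.b₂ / 12) (hs : z + w ∉ L.lattice)
    (hxy : ¬(x₁ = x₂ ∧ y₁ = E.toAffine.negY x₂ y₂)) {m : ℂ}
    (hm : m = 2 * (E.toAffine.slope x₁ x₂ y₁ y₂ : ℝ) + E.a₁)
    (hX : L.weierstrassP (z + w) = m ^ 2 / 4 - L.weierstrassP z - L.weierstrassP w)
    (hY : L.derivWeierstrassP (z + w) =
      -(m * (L.weierstrassP (z + w) - L.weierstrassP z) + L.derivWeierstrassP z)) :
    CorrespondsToPoint L E (z + w) (.some _ _ h₁ + .some _ _ h₂) := by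
  have hX' : L.weierstrassP (z + w) =
      (E.toAffine.addX x₁ x₂ (E.toAffine.slope x₁ x₂ y₁ y₂) : ℝ) + E.b₂ / 12 := by
    rw [hX, hX₁, hX₂, hm, WeierstrassCurve.Affine.addX, WeierstrassCurve.b₂]
    push_cast
    ring
  refine ⟨hs, _, _, _, WeierstrassCurve.Affine.Point.add_some hxy, hX', ?_⟩
  rw [hY, hX', hX₁, hY₁, hm, WeierstrassCurve.Affine.addY, WeierstrassCurve.Affine.negAddY,
    WeierstrassCurve.Affine.negY]
  push_cast
  ring

theorem uniformizes_add (hL : IsLatticeOf L E) {z w : ℂ} {P Q : E.toAffine.Point}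
    (hP : CorrespondsToPoint L E z P) (hQ : CorrespondsToPoint L E w Q) :
    Uniformizes L E (z + w) (P + Q) := by
  obtain ⟨hz, x₁, y₁, h₁, rfl, hX₁, hY₁⟩ := hP
  obtain ⟨hw, x₂, y₂, h₂, rfl, hX₂, hY₂⟩ := hQ
  by_cases hs : z + w ∈ L.lattice
  · refine .inl ⟨hs, ?_⟩
    have e1 : L.weierstrassP z = L.weierstrassP w := by
      have := L.weierstrassP_add_coe (-w) ⟨_, hs⟩
      simpa using this
    have e2 : L.derivWeierstrassP z = -L.derivWeierstrassP w := by
      have := L.derivWeierstrassP_add_coe (-w) ⟨_, hs⟩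
      simpa using this
    have hx : x₁ = x₂ := by
      rw [hX₁, hX₂] at e1
      exact_mod_cast add_right_cancel e1
    refine WeierstrassCurve.Affine.Point.add_of_Y_eq hx ?_
    rw [hY₁, hY₂, hx] at e2
    rw [WeierstrassCurve.Affine.negY]
    norm_cast at e2
    linarith
  · right
    by_cases hd : z - w ∈ L.lattice
    · have e1 : L.weierstrassP z = L.weierstrassP w := by
        have := L.weierstrassP_add_coe w ⟨_, hd⟩
        simpa using this
      have e2 : L.derivWeierstrassP z = L.derivWeierstrassP w := by
        have := L.derivWeierstrassP_add_coe w ⟨_, hd⟩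
        simpa using this
      have hs2 : z + z ∉ L.lattice := fun h ↦ hs (by
        have := sub_mem h hd
        rwa [add_sub_sub_cancel] at this)
      have e3 : L.weierstrassP (z + w) = L.weierstrassP (z + z) := by
        have := L.weierstrassP_sub_coe (z + z) ⟨_, hd⟩
        rw [← this]; congr 1; simp
      have e4 : L.derivWeierstrassP (z + w) = L.derivWeierstrassP (z + z) := by
        have := L.derivWeierstrassP_sub_coe (z + z) ⟨_, hd⟩
        rw [← this]; congr 1; simp
      have hx : x₁ = x₂ := by
        rw [hX₁, hX₂] at e1
        exact_mod_cast add_right_cancel e1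
      subst hx
      have hy : y₁ = y₂ := by
        rw [hY₁, hY₂] at e2
        norm_cast at e2
        linarith
      subst hy
      have hY0 : L.derivWeierstrassP z ≠ 0 :=
        fun h ↦ hs2 (two_mul_mem_of_derivWeierstrassP_eq_zero hz h)
      have hY0' : (2 * y₁ + E.a₁ * x₁ + E.a₃ : ℝ) ≠ 0 := by
        rw [hY₁] at hY0
        exact_mod_cast hY0
      have hy : y₁ ≠ E.toAffine.negY x₁ y₁ := by
        rw [WeierstrassCurve.Affine.negY]
        intro h
        apply hY0'
        linarith
      obtain ⟨d1, d2⟩ := weierstrassP_add_self hz hs2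
      -- In the tangent case the slopes are matched through `g₂ = c₄/12`.
      refine uniformizes_of_slope h₁ h₂ hX₁ hY₁ hX₂ hs (fun h ↦ hy h.2) ?_
        (by rw [e3, ← e1]; exact d1) (by rw [e3, e4]; exact d2)
      rw [WeierstrassCurve.Affine.slope_of_Y_ne rfl hy, hX₁, hY₁, hL.1,
        WeierstrassCurve.Affine.negY, WeierstrassCurve.c₄, WeierstrassCurve.b₂,
        WeierstrassCurve.b₄]
      have : (2 * y₁ + E.a₁ * x₁ + E.a₃ : ℂ) ≠ 0 := by exact_mod_cast hY0'
      have h' : (y₁ - (-y₁ - E.a₁ * x₁ - E.a₃) : ℂ) = 2 * y₁ + E.a₁ * x₁ + E.a₃ := by ring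
      push_cast
      rw [h', div_eq_iff this, add_mul, mul_assoc, div_mul_cancel₀ _ this]
      ring
    · have hx : x₁ ≠ x₂ := by
        have := ne_of_sub_notMem hz hw hs hd
        rw [hX₁, hX₂] at this
        rintro rfl
        exact this rfl
      refine uniformizes_of_slope h₁ h₂ hX₁ hY₁ hX₂ hs (fun h ↦ hx h.1) ?_
        (weierstrassP_add hz hw hs hd) (derivWeierstrassP_add hz hw hs hd)
      rw [WeierstrassCurve.Affine.slope_of_X_ne hx, chordSlope, hX₁, hX₂, hY₁, hY₂]
      have : (x₁ - x₂ : ℂ) ≠ 0 := by exact_mod_cast sub_ne_zero.mpr hx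
      push_cast
      rw [add_sub_add_right_eq_sub, add_sub_add_right_eq_sub, div_eq_iff this, add_mul, mul_assoc,
        div_mul_cancel₀ _ this]
      ring

/-- The graph of the uniformization `ℂ → E(ℂ)`, restricted to the real points. -/
def uniformizationGraph (hL : IsLatticeOf L E) : AddSubgroup (ℂ × E.toAffine.Point) where
  carrier := {p | Uniformizes L E p.1 p.2}
  zero_mem' := .inl ⟨zero_mem _, rfl⟩
  neg_mem' {p} hp := by
    rcases hp with ⟨h, h'⟩ | h
    · exact .inl ⟨by simpa using h, by simp [h']⟩
    · exact .inr (correspondsToPoint_neg h)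
  add_mem' {p r} hp hr := by
    have key : ∀ {z w : ℂ} {Q : E.toAffine.Point}, w ∈ L.lattice → CorrespondsToPoint L E z Q →
        CorrespondsToPoint L E (z + w) Q := by
      rintro z w Q hw ⟨hz, x, y, h, rfl, hX, hY⟩
      refine ⟨fun h ↦ hz (by simpa using sub_mem h hw), x, y, h, rfl, ?_, ?_⟩
      · rw [← hX]; exact L.weierstrassP_add_coe z ⟨w, hw⟩
      · rw [← hY]; exact L.derivWeierstrassP_add_coe z ⟨w, hw⟩
    rcases hp with ⟨h₁, h₁'⟩ | h₁ <;> rcases hr with ⟨h₂, h₂'⟩ | h₂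
    · exact .inl ⟨add_mem h₁ h₂, by simp [h₁', h₂']⟩
    · right
      simp only [Prod.fst_add, Prod.snd_add, h₁', zero_add]
      rw [add_comm]
      exact key h₁ h₂
    · right
      simp only [Prod.fst_add, Prod.snd_add, h₂', add_zero]
      exact key h₂ h₁
    · exact uniformizes_add hL h₁ h₂

/-- The graph is a subgroup, so it contains the corresponding integer combination of the pairs `(zᵢ,
Pᵢ)`; the only point over a lattice element is `0`. -/
theorem sum_zsmul_eq_zero (hL : IsLatticeOf L E) {ι : Type*} (s : Finset ι) {z : ι → ℂ}
    {P : ι → E.toAffine.Point} (hz : ∀ i, CorrespondsToPoint L E (z i) (P i)) (v : ι → ℤ)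
    (h : ∑ i ∈ s, v i * z i ∈ L.lattice) : ∑ i ∈ s, v i • P i = 0 := by
  have hmem : ∑ i ∈ s, v i • (z i, P i) ∈ uniformizationGraph hL :=
    sum_mem fun i _ ↦ zsmul_mem (show _ ∈ uniformizationGraph hL from Or.inr (hz i)) _
  have e : ∑ i ∈ s, v i • (z i, P i) = (∑ i ∈ s, v i * z i, ∑ i ∈ s, v i • P i) := by
    ext <;> simp [Prod.fst_sum, Prod.snd_sum]
  rw [e] at hmem
  rcases hmem with h' | h'
  · exact h'.2
  · exact absurd h h'.1

end Uniformization

/-! ### The rational functions summed in the Tate parametrization. -/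

section Kernels

/-- `V / (1 - V)²`, the first of three functions related by `V d/dV`. -/
noncomputable def kernel₀ (V : ℂ) : ℂ := V / (1 - V) ^ 2

/-- `V (1 + V) / (1 - V)³`. -/
noncomputable def kernel₁ (V : ℂ) : ℂ := V * (1 + V) / (1 - V) ^ 3

/-- `V (1 + 4 V + V²) / (1 - V)⁴`. -/
noncomputable def kernel₂ (V : ℂ) : ℂ := V * (1 + 4 * V + V ^ 2) / (1 - V) ^ 4

theorem hasDerivAt_mul_exp (a w : ℂ) :
    HasDerivAt (fun w ↦ a * Complex.exp w) (a * Complex.exp w) w :=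
  (Complex.hasDerivAt_exp w).const_mul a

theorem kernel₀_hasDerivAt {a w : ℂ} (h : a * Complex.exp w ≠ 1) :
    HasDerivAt (fun w ↦ kernel₀ (a * Complex.exp w)) (kernel₁ (a * Complex.exp w)) w := by
  have h' : 1 - a * Complex.exp w ≠ 0 := sub_ne_zero.mpr h.symm
  have e := hasDerivAt_mul_exp a w
  refine (e.fun_div ((e.const_sub 1).fun_pow 2) (pow_ne_zero 2 h')).congr_deriv ?_
  rw [kernel₁]
  generalize a * Complex.exp w = V at *
  simp only [Nat.cast_ofNat, Nat.add_one_sub_one, pow_one]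
  field_simp
  ring

theorem kernel₁_hasDerivAt {a w : ℂ} (h : a * Complex.exp w ≠ 1) :
    HasDerivAt (fun w ↦ kernel₁ (a * Complex.exp w)) (kernel₂ (a * Complex.exp w)) w := by
  have h' : 1 - a * Complex.exp w ≠ 0 := sub_ne_zero.mpr h.symm
  have e := hasDerivAt_mul_exp a w
  refine ((e.fun_mul (e.const_add 1)).fun_div ((e.const_sub 1).fun_pow 3)
    (pow_ne_zero 3 h')).congr_deriv ?_
  rw [kernel₂]
  generalize a * Complex.exp w = V at *
  simp only [Nat.cast_ofNat, Nat.add_one_sub_one]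
  field_simp
  ring

/-- Inversion symmetry turns the terms with negative exponent of `q` into terms with positive
exponent, which gives convergence at both ends of a sum over `ℤ`. -/
theorem kernel₀_inv (V : ℂ) : kernel₀ V⁻¹ = kernel₀ V := by
  rcases eq_or_ne V 0 with rfl | h0
  · simp [kernel₀]
  rcases eq_or_ne V 1 with rfl | h1
  · simp [kernel₀]
  have h1' : 1 - V ≠ 0 := sub_ne_zero.mpr h1.symm
  have h2 : 1 - V⁻¹ ≠ 0 := by rw [sub_ne_zero]; exact fun h ↦ h1 (by simpa using h.symm)
  have h3 : 1 - V⁻¹ = -(1 - V) / V := by field_simp; ring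
  rw [kernel₀, kernel₀, h3]
  field_simp

theorem kernel₁_inv (V : ℂ) : kernel₁ V⁻¹ = -kernel₁ V := by
  rcases eq_or_ne V 0 with rfl | h0
  · simp [kernel₁]
  rcases eq_or_ne V 1 with rfl | h1
  · simp [kernel₁]
  have h1' : 1 - V ≠ 0 := sub_ne_zero.mpr h1.symm
  have h3 : 1 - V⁻¹ = -(1 - V) / V := by field_simp; ring
  rw [kernel₁, kernel₁, h3]
  field_simp
  ring

theorem kernel₂_inv (V : ℂ) : kernel₂ V⁻¹ = kernel₂ V := by
  rcases eq_or_ne V 0 with rfl | h0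
  · simp [kernel₂]
  rcases eq_or_ne V 1 with rfl | h1
  · simp [kernel₂]
  have h1' : 1 - V ≠ 0 := sub_ne_zero.mpr h1.symm
  have h3 : 1 - V⁻¹ = -(1 - V) / V := by field_simp; ring
  rw [kernel₂, kernel₂, h3]
  field_simp
  ring

theorem norm_kernel₀_le {V : ℂ} (h : ‖V‖ ≤ 1 / 2) : ‖kernel₀ V‖ ≤ 4 * ‖V‖ := by
  have h1 : 1 / 2 ≤ ‖1 - V‖ := by
    have := norm_sub_norm_le 1 V
    rw [norm_one] at this
    linarith
  rw [kernel₀, norm_div, norm_pow, div_le_iff₀ (by positivity)]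
  have : (1 / 2) ^ 2 ≤ ‖1 - V‖ ^ 2 := by gcongr
  nlinarith [norm_nonneg V]

/-- This is the differential equation at `q = 0`: the function `f = kernel₀ + 1/12` of `log V`
satisfies `f'' = 6f² - 1/24`. It accounts for the shift by `1/12` in `tateP`. -/
theorem kernel₂_eq {V : ℂ} (h : V ≠ 1) : kernel₂ V = 6 * kernel₀ V ^ 2 + kernel₀ V := by
  have h' : 1 - V ≠ 0 := sub_ne_zero.mpr h.symm
  rw [kernel₂, kernel₀]
  field_simp
  ring

theorem tsum_pnat_mul_pow {x : ℂ} (hx : ‖x‖ < 1) : ∑' c : ℕ+, (c : ℂ) ^ 1 * x ^ (c : ℕ) = kernel₀ x := by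
  rw [tsum_pnat_eq_tsum_succ (f := fun c ↦ (c : ℂ) ^ 1 * x ^ c)]
  have := tsum_coe_mul_geometric_of_norm_lt_one hx
  rw [(hasSum_coe_mul_geometric_of_norm_lt_one hx).summable.tsum_eq_zero_add] at this
  simpa [kernel₀] using this

theorem tsum_pnat_cube_mul_pow {x : ℂ} (hx : ‖x‖ < 1) :
    ∑' c : ℕ+, (c : ℂ) ^ 3 * x ^ (c : ℕ) = kernel₂ x := by
  have h1 : 1 - x ≠ 0 := sub_ne_zero.mpr (by rintro rfl; simp at hx)
  have hch : ∀ n : ℕ, ((n + 3).choose 3 : ℂ) = (n + 3) * (n + 2) * (n + 1) / 6 ∧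
      ((n + 2).choose 2 : ℂ) = (n + 2) * (n + 1) / 2 := by
    intro n
    induction n with
    | zero => norm_num
    | succ n ih =>
      have a1 : (n + 1 + 2).choose 2 = (n + 2).choose 2 + (n + 2) := by
        rw [Nat.choose_succ_succ' (n + 2) 1, Nat.choose_one_right, add_comm]
      have a2 : (n + 1 + 3).choose 3 = (n + 3).choose 3 + (n + 1 + 2).choose 2 := by
        rw [Nat.choose_succ_succ' (n + 3) 2, add_comm]
      rw [a2, a1]
      push_cast
      rw [ih.1, ih.2]
      constructor <;> ring
  have hs : HasSum (fun n : ℕ ↦ (n : ℂ) ^ 3 * x ^ n) (kernel₂ x) := by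
    -- The expansion used is `n³ = 6 C(n+3,3) - 12 C(n+2,2) + 7 C(n+1,1) - 1`.
    have := ((((hasSum_choose_mul_geometric_of_norm_lt_one 3 hx).mul_left 6).sub
      ((hasSum_choose_mul_geometric_of_norm_lt_one 2 hx).mul_left 12)).add
      ((hasSum_choose_mul_geometric_of_norm_lt_one 1 hx).mul_left 7)).sub
      (hasSum_geometric_of_norm_lt_one hx)
    have e : kernel₂ x = 6 * (1 / (1 - x) ^ (3 + 1)) - 12 * (1 / (1 - x) ^ (2 + 1)) +
        7 * (1 / (1 - x) ^ (1 + 1)) - (1 - x)⁻¹ := by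
      simp only [kernel₂]
      field_simp
      ring
    rw [e]
    refine this.congr_fun fun n ↦ ?_
    rw [(hch n).1, (hch n).2, Nat.choose_one_right]
    push_cast
    ring
  rw [tsum_pnat_eq_tsum_succ (f := fun c ↦ (c : ℂ) ^ 3 * x ^ c)]
  have := hs.tsum_eq
  rw [hs.summable.tsum_eq_zero_add] at this
  simpa using this

end Kernels

/-! ### Lambert series as sums of kernel values. -/

section Lambert

variable {q : ℂ}

theorem norm_pow_pnat_lt_one (hq₁ : ‖q‖ < 1) (d : ℕ+) : ‖q ^ (d : ℕ)‖ < 1 := by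
  rw [norm_pow]
  exact pow_lt_one₀ (norm_nonneg _) hq₁ d.ne_zero

/-- Both sides equal the double sum of `cᵏ q^(dc)`, that is, the power series with divisor sums as
coefficients. -/
theorem lambert_eq_tsum (hq₁ : ‖q‖ < 1) (k : ℕ) (K : ℂ → ℂ)
    (hK : ∀ x : ℂ, ‖x‖ < 1 → ∑' c : ℕ+, (c : ℂ) ^ k * x ^ (c : ℕ) = K x) :
    ∑' m : ℕ+, (m : ℂ) ^ k * q ^ (m : ℕ) / (1 - q ^ (m : ℕ)) = ∑' d : ℕ+, K (q ^ (d : ℕ)) := by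
  rw [tsum_pow_div_one_sub_eq_tsum_sigma hq₁, ← tsum_prod_pow_eq_tsum_sigma k hq₁]
  refine tsum_congr fun d ↦ ?_
  rw [← hK _ (norm_pow_pnat_lt_one hq₁ d)]
  simp only [pow_mul]

end Lambert

/-! ### The period lattice of the Tate curve. -/

section Periods

variable {q : ℂ}

/-- The lattice `ℤ log q + 2πi ℤ` of the Tate curve with parameter `q`. -/
noncomputable def tatePeriods (q : ℂ) (hq₀ : q ≠ 0) (hq₁ : ‖q‖ < 1) : PeriodPair where
  ω₁ := Complex.log q
  ω₂ := 2 * Real.pi * Complex.I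
  indep := by
    rw [LinearIndependent.pair_iff]
    intro s t h
    have hre := congrArg Complex.re h
    have him := congrArg Complex.im h
    simp [Complex.log_re] at hre him
    have hn1 : ‖q‖ ≠ -1 := by linarith [norm_nonneg q]
    have hs : s = 0 := by
      rcases hre with h | h | h | h
      exacts [h, absurd h hq₀, absurd h hq₁.ne, absurd h hn1]
    subst hs
    simpa [Real.pi_ne_zero] using him

theorem mem_tatePeriods (hq₀ : q ≠ 0) (hq₁ : ‖q‖ < 1) {w : ℂ} :
    w ∈ (tatePeriods q hq₀ hq₁).lattice ↔ ∃ m : ℤ, Complex.exp w = q ^ m := by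
  rw [PeriodPair.mem_lattice]
  simp only [tatePeriods]
  constructor
  · rintro ⟨m, n, rfl⟩
    refine ⟨m, ?_⟩
    rw [Complex.exp_add, Complex.exp_int_mul, Complex.exp_log hq₀,
      Complex.exp_int_mul_two_pi_mul_I, mul_one]
  · rintro ⟨m, hm⟩
    rw [← Complex.exp_log hq₀, ← Complex.exp_int_mul, Complex.exp_eq_exp_iff_exists_int] at hm
    obtain ⟨n, hn⟩ := hm
    exact ⟨m, n, hn.symm⟩

theorem notMem_tatePeriods (hq₀ : q ≠ 0) (hq₁ : ‖q‖ < 1) {w : ℂ} :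
    w ∉ (tatePeriods q hq₀ hq₁).lattice ↔ ∀ m : ℤ, q ^ m * Complex.exp w ≠ 1 := by
  rw [mem_tatePeriods, not_exists]
  refine ⟨fun h m e ↦ h (-m) ?_, fun h m e ↦ h (-m) ?_⟩
  · rw [zpow_neg]
    exact eq_inv_of_mul_eq_one_right e
  · rw [e, zpow_neg, inv_mul_cancel₀ (zpow_ne_zero m hq₀)]

end Periods

/-! ### Convergence, derivatives and periodicity of the Tate series. -/

section TateSeries

variable {q : ℂ}

theorem summable_norm_pow_natAbs (hq₁ : ‖q‖ < 1) : Summable fun m : ℤ ↦ ‖q‖ ^ m.natAbs := by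
  have h := summable_geometric_of_lt_one (norm_nonneg q) hq₁
  exact Summable.of_nat_of_neg (by simpa using h) (by simpa using h)

/-- The sum of `K (q ^ m e ^ w)` over the integers `m` in `M`. -/
noncomputable def tateSeries (K : ℂ → ℂ) (q : ℂ) (M : Set ℤ) (w : ℂ) : ℂ :=
  ∑' m : ℤ, M.indicator (fun m ↦ K (q ^ m * Complex.exp w)) m

/-- The complement of the poles of `tateSeries K q M`. -/
def tateDomain (q : ℂ) (M : Set ℤ) : Set ℂ := {w | ∀ m ∈ M, q ^ m * Complex.exp w ≠ 1}

theorem isOpen_tateDomain (hq₀ : q ≠ 0) (hq₁ : ‖q‖ < 1) (M : Set ℤ) :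
    IsOpen (tateDomain q M) := by
  rw [← isClosed_compl_iff]
  refine (tatePeriods q hq₀ hq₁).isClosed_of_subset_lattice fun w hw ↦ ?_
  by_contra h
  exact hw fun m _ ↦ (notMem_tatePeriods hq₀ hq₁).mp h m

theorem exists_exp_bound {K : Set ℂ} (hK : IsCompact K) :
    ∃ C : ℝ, 0 ≤ C ∧ ∀ w ∈ K, ‖Complex.exp w‖ ≤ C ∧ ‖(Complex.exp w)⁻¹‖ ≤ C := by
  obtain ⟨C₁, h₁⟩ := hK.exists_bound_of_continuousOn Complex.continuous_exp.continuousOn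
  obtain ⟨C₂, h₂⟩ := hK.exists_bound_of_continuousOn
    (f := fun w ↦ (Complex.exp w)⁻¹) (Complex.continuous_exp.inv₀ Complex.exp_ne_zero).continuousOn
  refine ⟨max 0 (max C₁ C₂), by simp, fun w hw ↦ ⟨?_, ?_⟩⟩
  · exact (h₁ w hw).trans (by simp)
  · exact (h₂ w hw).trans (by simp)

theorem norm_kernel₀_mul_exp_le {C : ℝ} {U : ℂ} (h₁ : ‖U‖ ≤ C) (h₂ : ‖U⁻¹‖ ≤ C) {m : ℤ}
    (hm : C * ‖q‖ ^ m.natAbs ≤ 1 / 2) : ‖kernel₀ (q ^ m * U)‖ ≤ 4 * (C * ‖q‖ ^ m.natAbs) := by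
  obtain ⟨n, rfl | rfl⟩ := m.eq_nat_or_neg
  · simp only [zpow_natCast, Int.natAbs_natCast] at *
    have hb : ‖q ^ n * U‖ ≤ C * ‖q‖ ^ n := by
      rw [norm_mul, norm_pow, mul_comm]
      gcongr
    exact (norm_kernel₀_le (hb.trans hm)).trans (by gcongr)
  · simp only [zpow_neg, zpow_natCast, Int.natAbs_neg, Int.natAbs_natCast] at *
    have hb : ‖q ^ n * U⁻¹‖ ≤ C * ‖q‖ ^ n := by
      rw [norm_mul, norm_pow, mul_comm]
      gcongr
    rw [← kernel₀_inv, mul_inv, inv_inv]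
    exact (norm_kernel₀_le (hb.trans hm)).trans (by gcongr)

theorem summableLocallyUniformlyOn_kernel₀ (hq₀ : q ≠ 0) (hq₁ : ‖q‖ < 1) (M : Set ℤ) :
    SummableLocallyUniformlyOn
      (fun m w ↦ M.indicator (fun m ↦ kernel₀ (q ^ m * Complex.exp w)) m) (tateDomain q M) := by
  refine SummableLocallyUniformlyOn.of_locally_bounded_eventually (isOpen_tateDomain hq₀ hq₁ M)
    fun K _ hK ↦ ?_
  obtain ⟨C, hC, hb⟩ := exists_exp_bound hK
  have hs := (summable_norm_pow_natAbs hq₁).mul_left C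
  refine ⟨_, hs.mul_left 4, ?_⟩
  filter_upwards [hs.tendsto_cofinite_zero.eventually_le_const (by norm_num : (0 : ℝ) < 1 / 2)]
    with m hm w hw
  refine (norm_indicator_le_norm_self _ _).trans ?_
  exact norm_kernel₀_mul_exp_le (hb w hw).1 (hb w hw).2 hm

theorem indicator_hasDerivAt {f f' : ℤ → ℂ → ℂ} {M : Set ℤ} {m : ℤ} {w : ℂ}
    (h : m ∈ M → HasDerivAt (f m) (f' m w) w) :
    HasDerivAt (fun w ↦ M.indicator (fun m ↦ f m w) m) (M.indicator (fun m ↦ f' m w) m) w := by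
  by_cases hm : m ∈ M
  · simpa [hm] using h hm
  · simpa [hm] using hasDerivAt_const w 0

theorem tateSeries_kernel₀_hasDerivAt (hq₀ : q ≠ 0) (hq₁ : ‖q‖ < 1) {M : Set ℤ} {w : ℂ}
    (hw : w ∈ tateDomain q M) :
    HasDerivAt (tateSeries kernel₀ q M) (tateSeries kernel₁ q M w) w :=
  hasDerivAt_tsum_of_summableLocallyUniformlyOn (isOpen_tateDomain hq₀ hq₁ M)
    (summableLocallyUniformlyOn_kernel₀ hq₀ hq₁ M)
    (fun m _ hx ↦ indicator_hasDerivAt (f := fun m w ↦ kernel₀ (q ^ m * Complex.exp w))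
      (f' := fun m w ↦ kernel₁ (q ^ m * Complex.exp w)) fun hm ↦ kernel₀_hasDerivAt (hx m hm)) hw

theorem summableLocallyUniformlyOn_kernel₁ (hq₀ : q ≠ 0) (hq₁ : ‖q‖ < 1) (M : Set ℤ) :
    SummableLocallyUniformlyOn
      (fun m w ↦ M.indicator (fun m ↦ kernel₁ (q ^ m * Complex.exp w)) m) (tateDomain q M) :=
  summableLocallyUniformlyOn_deriv (isOpen_tateDomain hq₀ hq₁ M)
    (summableLocallyUniformlyOn_kernel₀ hq₀ hq₁ M)
    (fun m _ hx ↦ indicator_hasDerivAt (f := fun m w ↦ kernel₀ (q ^ m * Complex.exp w))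
      (f' := fun m w ↦ kernel₁ (q ^ m * Complex.exp w)) fun hm ↦ kernel₀_hasDerivAt (hx m hm))

theorem tateSeries_kernel₁_hasDerivAt (hq₀ : q ≠ 0) (hq₁ : ‖q‖ < 1) {M : Set ℤ} {w : ℂ}
    (hw : w ∈ tateDomain q M) :
    HasDerivAt (tateSeries kernel₁ q M) (tateSeries kernel₂ q M w) w :=
  hasDerivAt_tsum_of_summableLocallyUniformlyOn (isOpen_tateDomain hq₀ hq₁ M)
    (summableLocallyUniformlyOn_kernel₁ hq₀ hq₁ M)
    (fun m _ hx ↦ indicator_hasDerivAt (f := fun m w ↦ kernel₁ (q ^ m * Complex.exp w))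
      (f' := fun m w ↦ kernel₂ (q ^ m * Complex.exp w)) fun hm ↦ kernel₁_hasDerivAt (hx m hm)) hw

theorem summableLocallyUniformlyOn_kernel₂ (hq₀ : q ≠ 0) (hq₁ : ‖q‖ < 1) (M : Set ℤ) :
    SummableLocallyUniformlyOn
      (fun m w ↦ M.indicator (fun m ↦ kernel₂ (q ^ m * Complex.exp w)) m) (tateDomain q M) :=
  summableLocallyUniformlyOn_deriv (isOpen_tateDomain hq₀ hq₁ M)
    (summableLocallyUniformlyOn_kernel₁ hq₀ hq₁ M)
    (fun m _ hx ↦ indicator_hasDerivAt (f := fun m w ↦ kernel₁ (q ^ m * Complex.exp w))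
      (f' := fun m w ↦ kernel₂ (q ^ m * Complex.exp w)) fun hm ↦ kernel₁_hasDerivAt (hx m hm))

theorem mem_tateDomain_univ (hq₀ : q ≠ 0) (hq₁ : ‖q‖ < 1) {w : ℂ} :
    w ∈ tateDomain q Set.univ ↔ w ∉ (tatePeriods q hq₀ hq₁).lattice := by
  rw [notMem_tatePeriods]
  simp [tateDomain]

theorem zpow_ne_one_of_norm_lt_one (hq₁ : ‖q‖ < 1) {m : ℤ} (hm : m ≠ 0) :
    q ^ m ≠ 1 := by
  intro h
  have := congrArg norm h
  rw [norm_zpow, norm_one, zpow_eq_one_iff_right₀ (norm_nonneg q) hq₁.ne] at this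
  exact hm this

theorem zero_mem_tateDomain (hq₁ : ‖q‖ < 1) : (0 : ℂ) ∈ tateDomain q {0}ᶜ := by
  intro m hm
  simpa using zpow_ne_one_of_norm_lt_one hq₁ hm

theorem tateSeries_univ_eq {K : ℂ → ℂ} {w : ℂ}
    (h : Summable fun m : ℤ ↦ K (q ^ m * Complex.exp w)) :
    tateSeries K q Set.univ w = K (Complex.exp w) + tateSeries K q {0}ᶜ w := by
  simp only [tateSeries, Set.indicator_univ]
  rw [h.tsum_eq_add_tsum_ite 0]
  simp only [zpow_zero, one_mul, Set.indicator, Set.mem_compl_iff, Set.mem_singleton_iff, ite_not]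

theorem tateSeries_add_period (K : ℂ → ℂ) (hq₀ : q ≠ 0) (hq₁ : ‖q‖ < 1) (w : ℂ) {l : ℂ}
    (hl : l ∈ (tatePeriods q hq₀ hq₁).lattice) :
    tateSeries K q Set.univ (w + l) = tateSeries K q Set.univ w := by
  obtain ⟨n, hn⟩ := (mem_tatePeriods hq₀ hq₁).mp hl
  simp only [tateSeries, Set.indicator_univ]
  rw [← (Equiv.addRight n).tsum_eq (fun m ↦ K (q ^ m * Complex.exp w))]
  refine tsum_congr fun m ↦ ?_
  rw [Complex.exp_add, hn, Equiv.coe_addRight, zpow_add₀ hq₀]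
  congr 1
  ring

theorem tsum_compl_zero_of_even {K : ℂ → ℂ} (hK : ∀ V, K V⁻¹ = K V)
    (h : Summable fun m : ℤ ↦ ({0}ᶜ : Set ℤ).indicator (fun m ↦ K (q ^ m)) m) :
    ∑' m : ℤ, ({0}ᶜ : Set ℤ).indicator (fun m ↦ K (q ^ m)) m =
      2 * ∑' d : ℕ+, K (q ^ (d : ℕ)) := by
  rw [tsum_int_eq_zero_add_two_mul_tsum_pnat]
  · simp
  · intro m
    by_cases hm : m = 0 <;> simp [hm, zpow_neg, hK]
  · exact h

end TateSeries

/-! ### The differential equation of the Tate series. -/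

section TateEquation

variable {q : ℂ}

/-- The Lambert series `∑ mᵏ qᵐ / (1 - qᵐ)`. -/
noncomputable def lambert (k : ℕ) (q : ℂ) : ℂ :=
  ∑' m : ℕ+, (m : ℂ) ^ k * q ^ (m : ℕ) / (1 - q ^ (m : ℕ))

/-- Together with the next two lemmas this gives the Taylor coefficients at `0`, up to order two, of
the part of the series that is regular there. -/
theorem tateSeries_kernel₀_zero (hq₀ : q ≠ 0) (hq₁ : ‖q‖ < 1) :
    tateSeries kernel₀ q {0}ᶜ 0 = 2 * lambert 1 q := by
  have h := (summableLocallyUniformlyOn_kernel₀ hq₀ hq₁ {0}ᶜ).summable (zero_mem_tateDomain hq₁)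
  simp only [Complex.exp_zero, mul_one] at h
  rw [lambert, lambert_eq_tsum hq₁ 1 kernel₀ fun x hx ↦ tsum_pnat_mul_pow hx,
    ← tsum_compl_zero_of_even kernel₀_inv h]
  simp [tateSeries]

theorem tateSeries_kernel₂_zero (hq₀ : q ≠ 0) (hq₁ : ‖q‖ < 1) :
    tateSeries kernel₂ q {0}ᶜ 0 = 2 * lambert 3 q := by
  have h := (summableLocallyUniformlyOn_kernel₂ hq₀ hq₁ {0}ᶜ).summable (zero_mem_tateDomain hq₁)
  simp only [Complex.exp_zero, mul_one] at h
  rw [lambert, lambert_eq_tsum hq₁ 3 kernel₂ fun x hx ↦ tsum_pnat_cube_mul_pow hx,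
    ← tsum_compl_zero_of_even kernel₂_inv h]
  simp [tateSeries]

theorem tateSeries_kernel₁_zero : tateSeries kernel₁ q {0}ᶜ 0 = 0 := by
  rw [← CharZero.eq_neg_self_iff, tateSeries, ← tsum_neg, ← (Equiv.neg ℤ).tsum_eq]
  refine tsum_congr fun m ↦ ?_
  by_cases hm : m = 0 <;> simp [hm, zpow_neg, kernel₁_inv]

/-- The `℘`-function of the lattice `ℤ log q + 2πi ℤ`, as a series in `q`. -/
noncomputable def tateP (q w : ℂ) : ℂ :=
  tateSeries kernel₀ q Set.univ w + (1 / 12 - 2 * lambert 1 q)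

theorem tateP_eq (hq₀ : q ≠ 0) (hq₁ : ‖q‖ < 1) {w : ℂ} (hw : w ∈ tateDomain q Set.univ) :
    tateP q w = kernel₀ (Complex.exp w) +
      (tateSeries kernel₀ q {0}ᶜ w - tateSeries kernel₀ q {0}ᶜ 0) + 1 / 12 := by
  have h := (summableLocallyUniformlyOn_kernel₀ hq₀ hq₁ Set.univ).summable hw
  simp only [Set.indicator_univ] at h
  rw [tateP, tateSeries_univ_eq h, tateSeries_kernel₀_zero hq₀ hq₁]
  ring

theorem tateSeries_kernel₂_eq (hq₀ : q ≠ 0) (hq₁ : ‖q‖ < 1) {w : ℂ}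
    (hw : w ∈ tateDomain q Set.univ) :
    tateSeries kernel₂ q Set.univ w =
      kernel₂ (Complex.exp w) + tateSeries kernel₂ q {0}ᶜ w := by
  have h := (summableLocallyUniformlyOn_kernel₂ hq₀ hq₁ Set.univ).summable hw
  simp only [Set.indicator_univ] at h
  exact tateSeries_univ_eq h

theorem analyticAt_dslope {f : ℂ → ℂ} {z : ℂ} (hf : AnalyticAt ℂ f z) :
    AnalyticAt ℂ (dslope f z) z := by
  obtain ⟨p, hp⟩ := hf
  exact ⟨_, hp.has_fpower_series_dslope_fslope⟩

theorem eq_add_mul_dslope (f : ℂ → ℂ) (w : ℂ) : f w = f 0 + w * dslope f 0 w := by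
  have := sub_smul_dslope f 0 w
  rw [sub_zero, smul_eq_mul] at this
  rw [this]
  ring

/-- A function with vanishing derivative `f'` at `0` is `f 0 + w² Q`, and `f'' 0 = 2 Q 0`. -/
theorem exists_eq_add_sq_mul {f f' : ℂ → ℂ} {c : ℂ} (hf : AnalyticAt ℂ f 0)
    (h₁ : ∀ᶠ w in 𝓝 0, HasDerivAt f (f' w) w) (h₁0 : f' 0 = 0) (h₂ : HasDerivAt f' c 0) :
    ∃ Q : ℂ → ℂ, ContinuousAt Q 0 ∧ Q 0 = c / 2 ∧ ∀ w, f w = f 0 + w ^ 2 * Q w := by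
  set S := dslope f 0
  have hS : AnalyticAt ℂ S 0 := analyticAt_dslope hf
  have hS0 : S 0 = 0 := by
    simp only [S, dslope_same]
    rw [h₁.self_of_nhds.deriv, h₁0]
  have hSd := hS.differentiableAt.hasDerivAt
  have hS1 : HasDerivAt (fun w ↦ S w + w * deriv S w) (deriv S 0 + (1 * deriv S 0 + 0 * _)) 0 :=
    hSd.add ((hasDerivAt_id' 0).mul hS.deriv.differentiableAt.hasDerivAt)
  have e : f' =ᶠ[𝓝 0] fun w ↦ S w + w * deriv S w := by
    filter_upwards [h₁, hS.eventually_analyticAt] with w hw hSw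
    have hd : HasDerivAt (fun w ↦ f 0 + w * S w) (1 * S w + w * deriv S w) w :=
      ((hasDerivAt_id' w).mul hSw.differentiableAt.hasDerivAt).const_add _
    have : f = fun w ↦ f 0 + w * S w := funext fun w ↦ eq_add_mul_dslope f w
    rw [this] at hw
    rw [hw.unique hd, one_mul]
  have hc := h₂.unique (hS1.congr_of_eventuallyEq e)
  refine ⟨dslope S 0, (analyticAt_dslope hS).continuousAt, ?_, fun w ↦ ?_⟩
  · rw [dslope_same, hc]
    ring
  · rw [eq_add_mul_dslope f w]
    change f 0 + w * S w = _
    rw [eq_add_mul_dslope S w, hS0]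
    ring

/-- Writing `exp w - 1 = w D(w)` with `D` continuous and `D(0) = 1` isolates the double pole of the
term `m = 0`. -/
theorem kernel₀_exp_mul_sq {w : ℂ} (hw : Complex.exp w ≠ 1) :
    kernel₀ (Complex.exp w) * w ^ 2 = Complex.exp w / dslope Complex.exp 0 w ^ 2 := by
  have h := eq_add_mul_dslope Complex.exp w
  have h1 : 1 - Complex.exp w = -(w * dslope Complex.exp 0 w) := by
    rw [Complex.exp_zero] at h
    linear_combination -h
  have h2 : w * dslope Complex.exp 0 w ≠ 0 := by
    rw [← neg_ne_zero, ← h1]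
    exact sub_ne_zero.mpr hw.symm
  rw [kernel₀, h1]
  have h3 := left_ne_zero_of_mul h2
  have h4 := right_ne_zero_of_mul h2
  field_simp

/-- By `kernel₂_eq` the polar parts at `0` cancel. The remaining cross term `12 · kernel₀ · (T -
T(0))` is finite because `T - T(0)` vanishes to second order, with coefficient `T''(0)/2`. -/
theorem tateSeries_kernel₂_sub_tendsto (hq₀ : q ≠ 0) (hq₁ : ‖q‖ < 1) :
    Tendsto (fun w ↦ tateSeries kernel₂ q Set.univ w -
      (6 * tateP q w ^ 2 - (20 * lambert 3 q + 1 / 12) / 2)) (𝓝[tateDomain q Set.univ] 0) (𝓝 0) := by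
  set T := tateSeries kernel₀ q {0}ᶜ
  set T₂ := tateSeries kernel₂ q {0}ᶜ
  have hO := isOpen_tateDomain hq₀ hq₁ {0}ᶜ
  have h0 := zero_mem_tateDomain hq₁
  have hT : ∀ w ∈ tateDomain q {0}ᶜ, HasDerivAt T (tateSeries kernel₁ q {0}ᶜ w) w :=
    fun w hw ↦ tateSeries_kernel₀_hasDerivAt hq₀ hq₁ hw
  have hTa : AnalyticAt ℂ T 0 := DifferentiableOn.analyticAt
    (fun w hw ↦ (hT w hw).differentiableAt.differentiableWithinAt) (hO.mem_nhds h0)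
  obtain ⟨Q, hQ, hQ0, hTQ⟩ := exists_eq_add_sq_mul hTa
    ((hO.eventually_mem h0).mono hT) tateSeries_kernel₁_zero
    (tateSeries_kernel₁_hasDerivAt hq₀ hq₁ h0)
  set D := dslope Complex.exp 0
  have hD : ContinuousAt D 0 := (analyticAt_dslope (by fun_prop)).continuousAt
  have hD0 : D 0 = 1 := by simp [D]
  have hT₂ : ContinuousAt T₂ 0 := by
    have hs : ∀ w ∈ tateDomain q {0}ᶜ, T₂ w = deriv (tateSeries kernel₁ q {0}ᶜ) w :=
      fun w hw ↦ (tateSeries_kernel₁_hasDerivAt hq₀ hq₁ hw).deriv.symm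
    have ha : AnalyticAt ℂ (tateSeries kernel₁ q {0}ᶜ) 0 := DifferentiableOn.analyticAt
      (fun w hw ↦ (tateSeries_kernel₁_hasDerivAt hq₀ hq₁ hw).differentiableAt.differentiableWithinAt)
      (hO.mem_nhds h0)
    exact ha.deriv.continuousAt.congr (by
      filter_upwards [hO.mem_nhds h0] with w hw using (hs w hw).symm)
  have hTc : ContinuousAt T 0 := hTa.continuousAt
  set F : ℂ → ℂ := fun w ↦ -12 * (Complex.exp w / D w ^ 2) * Q w + T₂ w -
    6 * (T w - T 0 + 1 / 12) ^ 2 + (20 * lambert 3 q + 1 / 12) / 2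
  have hF : ContinuousAt F 0 := by
    have : D 0 ^ 2 ≠ 0 := by simp [hD0]
    fun_prop (disch := assumption)
  -- With `s = lambert 3 q` the value is `-12 s + 2 s - 1/24 + (20 s + 1/12)/2 = 0`, which is why
  -- the constant of the equation is `20 s + 1/12`.
  have hF0 : F 0 = 0 := by
    have : T₂ 0 = 2 * lambert 3 q := tateSeries_kernel₂_zero hq₀ hq₁
    simp only [F, hQ0, hD0, Complex.exp_zero]
    change _ * (T₂ 0 / 2) + _ - _ + _ = _
    rw [this]
    ring
  have := hF.tendsto.mono_left (nhdsWithin_le_nhds (s := tateDomain q Set.univ))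
  rw [hF0] at this
  refine this.congr' ?_
  filter_upwards [self_mem_nhdsWithin] with w hw
  have hw1 : Complex.exp w ≠ 1 := by simpa using hw 0 trivial
  rw [tateSeries_kernel₂_eq hq₀ hq₁ hw, tateP_eq hq₀ hq₁ hw, kernel₂_eq hw1]
  simp only [F]
  rw [← kernel₀_exp_mul_sq hw1]
  have := hTQ w
  change _ = _ + T₂ w - (6 * (_ + (T w - T 0) + _) ^ 2 - _)
  rw [this]
  ring

theorem tateP_hasDerivAt (hq₀ : q ≠ 0) (hq₁ : ‖q‖ < 1) {w : ℂ}
    (hw : w ∈ tateDomain q Set.univ) :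
    HasDerivAt (tateP q) (tateSeries kernel₁ q Set.univ w) w :=
  (tateSeries_kernel₀_hasDerivAt hq₀ hq₁ hw).add_const _

/-- The difference of the two sides is doubly periodic, holomorphic off the lattice and tends to `0`
at the lattice points. It extends to a bounded entire function vanishing at `0`, hence is zero by
Liouville's theorem. -/
theorem tateP_equation (hq₀ : q ≠ 0) (hq₁ : ‖q‖ < 1) {w : ℂ} (hw : w ∈ tateDomain q Set.univ) :
    tateSeries kernel₂ q Set.univ w = 6 * tateP q w ^ 2 - (20 * lambert 3 q + 1 / 12) / 2 := by
  classical
  set Λ := (tatePeriods q hq₀ hq₁).lattice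
  set V := tateDomain q Set.univ
  have hV : V = (Λ : Set ℂ)ᶜ := Set.ext fun w ↦ mem_tateDomain_univ hq₀ hq₁
  have hO : IsOpen V := isOpen_tateDomain hq₀ hq₁ _
  set h : ℂ → ℂ := fun w ↦ tateSeries kernel₂ q Set.univ w -
      (6 * tateP q w ^ 2 - (20 * lambert 3 q + 1 / 12) / 2)
  have hh : DifferentiableOn ℂ h V := by
    have h0 : DifferentiableOn ℂ (tateP q) V := fun w hw ↦
      (tateP_hasDerivAt hq₀ hq₁ hw).differentiableAt.differentiableWithinAt
    have h1 : DifferentiableOn ℂ (tateSeries kernel₁ q Set.univ) V := fun w hw ↦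
      (tateSeries_kernel₁_hasDerivAt hq₀ hq₁ hw).differentiableAt.differentiableWithinAt
    have h2 : DifferentiableOn ℂ (tateSeries kernel₂ q Set.univ) V :=
      (h1.deriv hO).congr fun w hw ↦ (tateSeries_kernel₁_hasDerivAt hq₀ hq₁ hw).deriv.symm
    fun_prop
  -- The value `0` on the lattice is the limit just computed, so this is the removable extension.
  set H : ℂ → ℂ := fun w ↦ if w ∈ V then h w else 0
  have hHV : ∀ w ∈ V, H =ᶠ[𝓝 w] h := fun w hw ↦ by
    filter_upwards [hO.mem_nhds hw] with t ht using if_pos ht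
  have hHd : ∀ w ∈ V, DifferentiableAt ℂ H w := fun w hw ↦
    (hh.differentiableAt (hO.mem_nhds hw)).congr_of_eventuallyEq (hHV w hw)
  have hper : ∀ w l, l ∈ Λ → H (w + l) = H w := by
    intro w l hl
    have e1 : w + l ∈ V ↔ w ∈ V := by
      rw [hV]
      simp only [Set.mem_compl_iff, SetLike.mem_coe]
      rw [Submodule.add_mem_iff_left _ hl]
    simp only [H, e1, h, tateP, tateSeries_add_period _ hq₀ hq₁ w hl]
  have h0V : (0 : ℂ) ∉ V := by rw [hV]; simp
  have hH0 : H 0 = 0 := if_neg h0V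
  have hnear : ∀ᶠ w in 𝓝[≠] (0 : ℂ), w ∈ V := by
    filter_upwards [self_mem_nhdsWithin, nhdsWithin_le_nhds
      ((tatePeriods q hq₀ hq₁).compl_lattice_sdiff_singleton_mem_nhds 0)] with w hw hw'
    rw [hV]
    exact fun h ↦ hw' ⟨h, hw⟩
  have hHc : ContinuousAt H 0 := by
    rw [continuousAt_iff_punctured_nhds, hH0]
    have e := tateSeries_kernel₂_sub_tendsto hq₀ hq₁
    have e' : Tendsto h (𝓝[≠] 0) (𝓝 0) := e.mono_left (by
      rw [nhdsWithin, nhdsWithin]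
      exact le_inf inf_le_left (le_principal_iff.mpr hnear))
    exact e'.congr' (by filter_upwards [hnear] with w hw using (if_pos hw).symm)
  have hHd0 : DifferentiableAt ℂ H 0 :=
    (Complex.analyticAt_of_differentiable_on_punctured_nhds_of_continuousAt
      (hnear.mono hHd) hHc).differentiableAt
  have hHdiff : Differentiable ℂ H := by
    intro w
    by_cases hw : w ∈ V
    · exact hHd w hw
    · have hwΛ : w ∈ Λ := by
        rw [hV] at hw
        simpa using hw
      have : H = fun t ↦ H (t - w) := funext fun t ↦ by
        rw [sub_eq_add_neg, hper t (-w) (neg_mem hwΛ)]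
      rw [this]
      exact DifferentiableAt.comp w (g := H) (by simpa using hHd0) (by fun_prop)
  have hconst := hHdiff.apply_eq_apply_of_bounded
    (IsZLattice.isCompact_range_of_periodic Λ H hHdiff.continuous hper).isBounded w 0
  rw [hH0] at hconst
  simp only [H, if_pos hw, h] at hconst
  exact sub_eq_zero.mp hconst

/-- At `0` the product `w² · tateP q w` has the limit `1`; periodicity carries this to the other
lattice points. -/
theorem tateP_tendsto (hq₀ : q ≠ 0) (hq₁ : ‖q‖ < 1) {w : ℂ}
    (hw : w ∈ (tatePeriods q hq₀ hq₁).lattice) :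
    Tendsto (tateP q) (𝓝[≠] w) (Bornology.cobounded ℂ) := by
  have h0 : Tendsto (tateP q) (𝓝[≠] 0) (Bornology.cobounded ℂ) := by
    set T := tateSeries kernel₀ q {0}ᶜ
    have hT : ContinuousAt T 0 :=
      (tateSeries_kernel₀_hasDerivAt hq₀ hq₁ (zero_mem_tateDomain hq₁)).continuousAt
    set D := dslope Complex.exp 0
    have hD : ContinuousAt D 0 := (analyticAt_dslope (by fun_prop)).continuousAt
    have hD0 : D 0 = 1 := by simp [D]
    set B : ℂ → ℂ := fun w ↦ Complex.exp w / D w ^ 2 + w ^ 2 * (T w - T 0 + 1 / 12)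
    have hB : ContinuousAt B 0 := by
      have : D 0 ^ 2 ≠ 0 := by simp [hD0]
      fun_prop (disch := assumption)
    have hB0 : B 0 ≠ 0 := by simp [B, hD0]
    have hi : Tendsto (fun w ↦ w ^ 2 / B w) (𝓝[≠] 0) (𝓝[≠] 0) := by
      refine tendsto_nhdsWithin_iff.mpr ⟨?_, ?_⟩
      · have : ContinuousAt (fun w ↦ w ^ 2 / B w) 0 := by fun_prop (disch := assumption)
        simpa using this.tendsto.mono_left nhdsWithin_le_nhds
      · filter_upwards [self_mem_nhdsWithin, nhdsWithin_le_nhds (hB.eventually_ne hB0)]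
          with w hw hBw
        exact div_ne_zero (pow_ne_zero 2 hw) hBw
    refine (tendsto_inv₀_nhdsNE_zero.comp hi).congr' ?_
    filter_upwards [self_mem_nhdsWithin, nhdsWithin_le_nhds
      ((tatePeriods q hq₀ hq₁).compl_lattice_sdiff_singleton_mem_nhds 0)] with w hw hw'
    have hV : w ∈ tateDomain q Set.univ :=
      (mem_tateDomain_univ hq₀ hq₁).mpr fun h ↦ hw' ⟨h, hw⟩
    have hw1 : Complex.exp w ≠ 1 := by simpa using hV 0 trivial
    have hw0 : w ≠ 0 := hw
    rw [Function.comp_apply, inv_div, tateP_eq hq₀ hq₁ hV]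
    simp only [B]
    rw [← kernel₀_exp_mul_sq hw1]
    field_simp
    ring
  have : tateP q = fun t ↦ tateP q (t - w) := funext fun t ↦ by
    rw [sub_eq_add_neg, tateP, tateP, tateSeries_add_period _ hq₀ hq₁ t (neg_mem hw)]
  rw [this]
  refine h0.comp (tendsto_nhdsWithin_iff.mpr ⟨?_, ?_⟩)
  · have : Tendsto (fun t ↦ t - w) (𝓝 w) (𝓝 (w - w)) := Continuous.tendsto (by fun_prop) w
    rw [sub_self] at this
    exact this.mono_left nhdsWithin_le_nhds
  · filter_upwards [self_mem_nhdsWithin] with t ht using sub_ne_zero.mpr ht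

theorem ellipticSolution_tateP (hq₀ : q ≠ 0) (hq₁ : ‖q‖ < 1) :
    EllipticSolution (20 * lambert 3 q + 1 / 12) (tateP q) (tateSeries kernel₁ q Set.univ)
      (tatePeriods q hq₀ hq₁).lattice where
  isClosed := PeriodPair.isClosed_lattice _
  countable := lattice_countable _
  hasDerivAt w hw := tateP_hasDerivAt hq₀ hq₁ ((mem_tateDomain_univ hq₀ hq₁).mpr hw)
  hasDerivAt_deriv w hw := by
    have hw' := (mem_tateDomain_univ hq₀ hq₁).mpr hw
    rw [← tateP_equation hq₀ hq₁ hw']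
    exact tateSeries_kernel₁_hasDerivAt hq₀ hq₁ hw'
  tendsto w hw := tateP_tendsto hq₀ hq₁ hw

end TateEquation

/-! ### Comparison of the Weierstrass and Tate uniformizations. -/

section Comparison

variable {q c : ℝ}

theorem ofReal_tateSum (k : ℕ) (q : ℝ) : (tateSum k q : ℂ) = lambert k q := by
  rw [tateSum, lambert, Complex.ofReal_tsum]
  push_cast
  rfl

theorem mem_tateDomain_of_exp_eq {w : ℂ} {u : ℝ}
    (hw : Complex.exp w = u) (hu : ∀ m : ℤ, u ≠ q ^ m) :
    w ∈ tateDomain q Set.univ := by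
  intro m _ h
  rw [hw] at h
  norm_cast at h
  apply hu (-m)
  rw [zpow_neg]
  exact eq_inv_of_mul_eq_one_right h

theorem ofReal_tateX {w : ℂ} {u : ℝ} (hw : Complex.exp w = u) :
    (tateX q u : ℂ) + 1 / 12 = tateP q w := by
  rw [tateX, tateP, tateSeries]
  push_cast
  rw [ofReal_tateSum]
  simp only [Set.indicator_univ, kernel₀, hw]
  ring

/-- Termwise this is `V²/(1 - V)³ = (kernel₁ V - kernel₀ V)/2`. -/
theorem ofReal_tateY {w : ℂ} {u : ℝ} (hq₀ : q ≠ 0) (hq₁ : |q| < 1) (hw : Complex.exp w = u)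
    (hu : ∀ m : ℤ, u ≠ q ^ m) :
    (2 * tateY q u + tateX q u : ℂ) = tateSeries kernel₁ q Set.univ w := by
  have hD := mem_tateDomain_of_exp_eq hw hu
  have hq₀' : (q : ℂ) ≠ 0 := by exact_mod_cast hq₀
  have hq₁' : ‖(q : ℂ)‖ < 1 := by simpa using hq₁
  have h0 := (summableLocallyUniformlyOn_kernel₀ hq₀' hq₁' Set.univ).summable hD
  have h1 := (summableLocallyUniformlyOn_kernel₁ hq₀' hq₁' Set.univ).summable hD
  simp only [Set.indicator_univ] at h0 h1
  have e : ∀ m : ℤ, ((q : ℂ) ^ m * u) ^ 2 / (1 - (q : ℂ) ^ m * u) ^ 3 =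
      (kernel₁ ((q : ℂ) ^ m * Complex.exp w) - kernel₀ ((q : ℂ) ^ m * Complex.exp w)) / 2 := by
    intro m
    have hne : 1 - (q : ℂ) ^ m * Complex.exp w ≠ 0 := sub_ne_zero.mpr (hD m trivial).symm
    rw [← hw, kernel₀, kernel₁]
    field_simp
    ring
  have hX := ofReal_tateX (q := q) hw
  rw [tateP] at hX
  have hY : (tateY q u : ℂ) = (tateSeries kernel₁ q Set.univ w -
      tateSeries kernel₀ q Set.univ w) / 2 + lambert 1 q := by
    rw [tateY]
    push_cast
    rw [ofReal_tateSum]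
    simp only [e, tateSeries, Set.indicator_univ]
    rw [tsum_div_const, h1.tsum_sub h0]
  rw [hY]
  linear_combination hX

theorem ellipticSolution_scaled {g : ℂ} {f f' : ℂ → ℂ} {S : Set ℂ} (h : EllipticSolution g f f' S)
    {c : ℂ} (hc : c ≠ 0) :
    EllipticSolution (c ^ 4 * g) (fun z ↦ c ^ 2 * f (c * z)) (fun z ↦ c ^ 3 * f' (c * z))
      ((c * ·) ⁻¹' S) where
  isClosed := h.isClosed.preimage (by fun_prop)
  countable := h.countable.preimage (mul_right_injective₀ hc)
  hasDerivAt z hz := by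
    refine (((h.hasDerivAt _ hz).comp z ((hasDerivAt_id' z).const_mul c)).const_mul
      (c ^ 2)).congr_deriv ?_
    ring
  hasDerivAt_deriv z hz := by
    refine (((h.hasDerivAt_deriv _ hz).comp z ((hasDerivAt_id' z).const_mul c)).const_mul
      (c ^ 3)).congr_deriv ?_
    ring
  tendsto z hz := by
    refine (tendsto_mul_left_cobounded (pow_ne_zero 2 hc)).comp ((h.tendsto _ hz).comp ?_)
    refine tendsto_nhdsWithin_iff.mpr ⟨?_, ?_⟩
    · exact (Continuous.tendsto (by fun_prop) z).mono_left nhdsWithin_le_nhds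
    · filter_upwards [self_mem_nhdsWithin] with w hw using
        fun h ↦ hw (mul_left_cancel₀ hc h)

/-- The Tate curve has `c₄ = 1 + 240 s₃(q)`, and `c₄` has weight four under changes of variables. -/
theorem g₂_eq {E : WeierstrassCurve ℝ} {L : PeriodPair} (hL : IsLatticeOf L E)
    {C : WeierstrassCurve.VariableChange ℝ} (hC : C • E = tateCurve q) :
    L.g₂ = (C.u : ℝ) ^ 4 * (20 * lambert 3 q + 1 / 12) := by
  have h := WeierstrassCurve.variableChange_c₄ E C
  have hu : (C.u : ℝ) ≠ 0 := C.u.ne_zero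
  rw [hC, WeierstrassCurve.c₄, WeierstrassCurve.b₂, WeierstrassCurve.b₄] at h
  simp only [tateCurve, Units.val_inv_eq_inv_val] at h
  have h' : E.c₄ = (C.u : ℝ) ^ 4 * (1 + 240 * tateSum 3 q) := by
    field_simp at h
    linear_combination -h
  rw [hL.1, h', ← ofReal_tateSum]
  push_cast
  ring

/-- The coordinates `x + b₂/12` and `2y + a₁x + a₃` are only rescaled by a change of variables; `r`,
`s` and `t` drop out of them. -/
theorem coordinates_eq {E : WeierstrassCurve ℝ} {L : PeriodPair} (hq₀ : q ≠ 0) (hq₁ : |q| < 1)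
    {C : WeierstrassCurve.VariableChange ℝ} (hC : C • E = tateCurve q) {z w : ℂ} {u : ℝ}
    {P : E.toAffine.Point} (hz : CorrespondsToPoint L E z P) (hu : IsTateParameter q E C u P)
    (hw : Complex.exp w = u) :
    L.weierstrassP z = (C.u : ℝ) ^ 2 * tateP q w ∧
      L.derivWeierstrassP z = (C.u : ℝ) ^ 3 * tateSeries kernel₁ q Set.univ w := by
  obtain ⟨hz, x, y, h, hP, hX, hY⟩ := hz
  obtain ⟨hu₀, hu₁, x', y', h', hP', hx, hy⟩ := hu
  rw [hP] at hP'
  obtain ⟨rfl, rfl⟩ := WeierstrassCurve.Affine.Point.some.inj hP'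
  have hc : (C.u : ℝ) ≠ 0 := C.u.ne_zero
  have h₂ := WeierstrassCurve.variableChange_b₂ E C
  have h₁ := WeierstrassCurve.variableChange_a₁ E C
  have h₃ := WeierstrassCurve.variableChange_a₃ E C
  rw [hC] at h₁ h₂ h₃
  rw [WeierstrassCurve.b₂] at h₂
  simp only [tateCurve, Units.val_inv_eq_inv_val] at h₁ h₂ h₃
  have k₁ : E.a₁ = C.u - 2 * C.s := by field_simp at h₁; linear_combination -h₁
  have k₂ : E.b₂ = (C.u : ℝ) ^ 2 - 12 * C.r := by field_simp at h₂; linear_combination -h₂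
  have k₃ : E.a₃ = -C.r * E.a₁ - 2 * C.t := by
    have : E.a₃ + C.r * E.a₁ + 2 * C.t = 0 := by
      simpa [hc] using h₃.symm
    linear_combination this
  rw [hX, hY, ← ofReal_tateX hw, ← ofReal_tateY hq₀ hq₁ hw hu₁, k₂, k₃, k₁, hx, hy]
  push_cast
  constructor <;> ring

/-- The uniformization of `E` by the lattice `L` agrees with the one by the Tate curve. -/
theorem tate_comparison {E : WeierstrassCurve ℝ} {L : PeriodPair} (hL : IsLatticeOf L E)
    (hq₀ : q ≠ 0) (hq₁ : |q| < 1) (hq₀' : (q : ℂ) ≠ 0) (hq₁' : ‖(q : ℂ)‖ < 1)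
    {C : WeierstrassCurve.VariableChange ℝ} (hC : C • E = tateCurve q) {z w : ℂ} {u : ℝ}
    {P : E.toAffine.Point} (hz : CorrespondsToPoint L E z P) (hu : IsTateParameter q E C u P)
    (hw : Complex.exp w = u) :
    w - (C.u : ℝ) * z ∈ (tatePeriods q hq₀' hq₁').lattice ∧
      (∀ t, t ∈ L.lattice ↔ (C.u : ℝ) * t ∈ (tatePeriods q hq₀' hq₁').lattice) ∧
      ∀ t ∉ L.lattice, L.weierstrassP t = (C.u : ℝ) ^ 2 * tateP q ((C.u : ℝ) * t) := by
  obtain ⟨e₁, e₂⟩ := coordinates_eq hq₀ hq₁ hC hz hu hw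
  have hg := g₂_eq hL hC
  have hc : ((C.u : ℝ) : ℂ) ≠ 0 := by simp
  generalize ((C.u : ℝ) : ℂ) = c at *
  have hcw : c * (w / c) = w := by field_simp
  have hD := mem_tateDomain_of_exp_eq hw hu.2.1
  rw [mem_tateDomain_univ hq₀' hq₁'] at hD
  have hL2 := ellipticSolution_weierstrassP L
  rw [hg] at hL2
  obtain ⟨r₁, r₂⟩ := hL2.rigidity (ellipticSolution_scaled (ellipticSolution_tateP hq₀' hq₁') hc)
    hz.1 (a₂ := w / c) (by simpa [hcw] using hD) (by simpa [hcw] using e₁)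
    (by simpa [hcw] using e₂)
  -- Taking `t = -z` in the comparison of poles matches the pole of `℘` at `0` with one of the Tate
  -- series, so the translation between the two functions is a period.
  have hm : w - c * z ∈ (tatePeriods q hq₀' hq₁').lattice := by
    have := (r₁ (-z)).mp (by simp)
    simpa [mul_add, hcw, sub_eq_add_neg] using this
  have hm' : ∀ t, c * (w / c + (t - z)) = c * t + (w - c * z) := fun t ↦ by
    rw [mul_add, hcw]; ring
  refine ⟨hm, fun t ↦ ?_, fun t ht ↦ ?_⟩
  · have := r₁ (t - z)
    rw [add_sub_cancel, Set.mem_preimage, hm'] at this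
    refine this.trans ?_
    simp only [SetLike.mem_coe]
    exact Submodule.add_mem_iff_left _ hm
  · have := r₂ (t - z) (by rwa [add_sub_cancel])
    rw [add_sub_cancel, hm'] at this
    rw [this, tateP, tateP, tateSeries_add_period _ hq₀' hq₁' _ hm]

end Comparison

/-! ### Infinite products and odd entire functions. -/

section Products

variable {ι : Type*} {s : Set ℂ}

theorem multipliableLocallyUniformlyOn_of_locally_bounded {f : ι → ℂ → ℂ} (hs : IsOpen s)
    (hf : ∀ i, ContinuousOn (f i) s)
    (hb : ∀ K ⊆ s, IsCompact K → ∃ b : ι → ℝ, Summable b ∧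
      ∀ᶠ i in cofinite, ∀ x ∈ K, ‖f i x - 1‖ ≤ b i) :
    MultipliableLocallyUniformlyOn f s := by
  refine HasProdLocallyUniformlyOn.multipliableLocallyUniformlyOn (g := fun x ↦ ∏' i, f i x)
    (hasProdLocallyUniformlyOn_of_forall_compact hs fun K hKs hK ↦ ?_)
  obtain ⟨b, hb₁, hb₂⟩ := hb K hKs hK
  have := hb₁.hasProdUniformlyOn_one_add hK hb₂ fun i ↦ ((hf i).mono hKs).sub continuousOn_const
  simpa using this

theorem tprod_ne_zero_of_bounded {R : Type*} [NormedField R] [CompleteSpace R] {f : ι → R}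
    {b : ι → ℝ} (hb : Summable b) (h : ∀ᶠ i in cofinite, ‖f i - 1‖ ≤ b i)
    (hf : ∀ i, f i ≠ 0) : ∏' i, f i ≠ 0 := by
  have := tprod_one_add_ne_zero_of_summable (f := fun i ↦ f i - 1) (by simpa using hf)
    (hb.of_norm_bounded_eventually (by simpa using h))
  simpa using this

theorem differentiableOn_tprod {f : ι → ℂ → ℂ} (hs : IsOpen s)
    (h : MultipliableLocallyUniformlyOn f s) (hf : ∀ i, DifferentiableOn ℂ (f i) s) :
    DifferentiableOn ℂ (fun x ↦ ∏' i, f i x) s :=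
  (hasProdLocallyUniformlyOn_iff_tendstoLocallyUniformlyOn.mp
    h.hasProdLocallyUniformlyOn).differentiableOn
      (.of_forall fun _ ↦ DifferentiableOn.fun_finsetProd fun i _ ↦ hf i) hs

theorem logDeriv_neg_of_odd {F : ℂ → ℂ} (h : ∀ z, F (-z) = -F z) (z : ℂ) :
    logDeriv F (-z) = -logDeriv F z := by
  have h1 : deriv F (-z) = deriv F z := by
    have e : (fun z ↦ F (-z)) = fun z ↦ -F z := funext h
    have := congrFun (congrArg deriv e) z
    rw [deriv_comp_neg, deriv.fun_neg] at this
    exact neg_injective this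
  rw [logDeriv_apply, logDeriv_apply, h1, h, div_neg]

/-- Two odd entire functions whose logarithmic derivatives have derivatives that differ by a
constant agree up to a Gaussian factor. -/
theorem exists_gaussian_factor {F₁ F₂ p₁ p₂ : ℂ → ℂ} {S : Set ℂ} {K : ℂ} (hS : IsClosed S)
    (hSc : S.Countable) (hSn : ∀ z ∉ S, -z ∉ S)
    (hF₁ : Differentiable ℂ F₁) (hF₂ : Differentiable ℂ F₂)
    (ho₁ : ∀ z, F₁ (-z) = -F₁ z) (ho₂ : ∀ z, F₂ (-z) = -F₂ z)
    (h₁ : ∀ z ∉ S, F₁ z ≠ 0) (h₂ : ∀ z ∉ S, F₂ z ≠ 0)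
    (hp₁ : ∀ z ∉ S, HasDerivAt (logDeriv F₁) (p₁ z) z)
    (hp₂ : ∀ z ∉ S, HasDerivAt (logDeriv F₂) (p₂ z) z)
    (hp : ∀ z ∉ S, p₁ z = p₂ z + K) :
    ∃ A : ℂ, ∀ z, F₁ z = A * Complex.exp (K / 2 * z ^ 2) * F₂ z := by
  have hO := hS.isOpen_compl
  have hconn := isPreconnected_compl_of_countable hSc
  have hd : ∀ z ∉ S, HasDerivAt (fun z ↦ logDeriv F₁ z - logDeriv F₂ z - K * z) 0 z := by
    intro z hz
    refine (((hp₁ z hz).sub (hp₂ z hz)).sub ((hasDerivAt_id' z).const_mul K)).congr_deriv ?_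
    rw [hp z hz]
    ring
  obtain ⟨b, hb⟩ := hO.exists_is_const_of_deriv_eq_zero hconn
    (fun z hz ↦ (hd z hz).differentiableAt.differentiableWithinAt) fun z hz ↦ (hd z hz).deriv
  -- Logarithmic derivatives of odd functions are odd, so comparing `z` with `-z` gives `b = -b` and
  -- the constant of integration vanishes.
  have hlog : ∀ z ∉ S, logDeriv F₁ z = logDeriv F₂ z + K * z := by
    intro z hz
    have e₁ := hb z hz
    have e₂ := hb (-z) (hSn z hz)
    rw [logDeriv_neg_of_odd ho₁, logDeriv_neg_of_odd ho₂] at e₂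
    linear_combination (e₁ - e₂) / 2
  have hE : ∀ z, HasDerivAt (fun z ↦ Complex.exp (-(K / 2 * z ^ 2)))
      (Complex.exp (-(K / 2 * z ^ 2)) * (-(K * z))) z := by
    intro z
    refine (((hasDerivAt_pow 2 z).const_mul (K / 2)).neg.cexp).congr_deriv ?_
    simp only [Pi.neg_apply]
    ring
  have hd' : ∀ z ∉ S, HasDerivAt (fun z ↦ F₁ z / F₂ z * Complex.exp (-(K / 2 * z ^ 2))) 0 z := by
    intro z hz
    refine ((((hF₁ z).hasDerivAt).fun_div (hF₂ z).hasDerivAt (h₂ z hz)).fun_mul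
      (hE z)).congr_deriv ?_
    have e := hlog z hz
    rw [logDeriv_apply, logDeriv_apply] at e
    have n₁ := h₁ z hz
    have n₂ := h₂ z hz
    field_simp at e ⊢
    linear_combination Complex.exp (-(K * z ^ 2 / 2)) * e
  obtain ⟨A, hA⟩ := hO.exists_is_const_of_deriv_eq_zero hconn
    (fun z hz ↦ (hd' z hz).differentiableAt.differentiableWithinAt) fun z hz ↦ (hd' z hz).deriv
  refine ⟨A, fun z ↦ ?_⟩
  -- Continuity extends the identity to the points of `S`, where `F₂` may vanish.
  have hdense : Dense Sᶜ := hSc.dense_compl ℝ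
  have heq : Set.EqOn F₁ (fun z ↦ A * Complex.exp (K / 2 * z ^ 2) * F₂ z) Sᶜ := by
    intro z hz
    have := hA z hz
    have n₂ := h₂ z hz
    simp only
    rw [← this, Complex.exp_neg]
    have := Complex.exp_ne_zero (K / 2 * z ^ 2)
    field_simp
  have hc : Continuous fun z ↦ A * Complex.exp (K / 2 * z ^ 2) * F₂ z := by
    have := hF₂.continuous
    fun_prop
  exact congrFun (hF₁.continuous.ext_on hdense hc heq) z

end Products

/-! ### The Weierstrass `σ`-function. -/

section Sigma

variable (L : PeriodPair)

/-- The factor of the Weierstrass `σ`-function which vanishes at `ω`. -/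
noncomputable def sigmaFactor (ω z : ℂ) : ℂ :=
  (1 - z / ω) * Complex.exp (z / ω + (z / ω) ^ 2 / 2)

/-- The derivative of `(1 - t) exp(t + t²/2)` is `-t² exp(t + t²/2)`, so the mean value inequality
gives a cubic bound. The sum of `‖ω‖⁻³` over a planar lattice converges, which makes the product for
`σ` converge. -/
theorem norm_primaryFactor_sub_one_le {t : ℂ} (ht : ‖t‖ ≤ 1) :
    ‖(1 - t) * Complex.exp (t + t ^ 2 / 2) - 1‖ ≤ Real.exp 2 * ‖t‖ ^ 3 := by
  set E : ℂ → ℂ := fun t ↦ (1 - t) * Complex.exp (t + t ^ 2 / 2)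
  have hE : ∀ x, HasDerivAt E (-x ^ 2 * Complex.exp (x + x ^ 2 / 2)) x := by
    intro x
    have h1 : HasDerivAt (fun x : ℂ ↦ x + x ^ 2 / 2) (1 + x) x := by
      refine ((hasDerivAt_id' x).add ((hasDerivAt_pow 2 x).div_const 2)).congr_deriv ?_
      ring
    refine (((hasDerivAt_id' x).const_sub 1).fun_mul h1.cexp).congr_deriv ?_
    ring
  have hb : ∀ x ∈ Metric.closedBall (0 : ℂ) ‖t‖,
      ‖-x ^ 2 * Complex.exp (x + x ^ 2 / 2)‖ ≤ ‖t‖ ^ 2 * Real.exp 2 := by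
    intro x hx
    have hx' : ‖x‖ ≤ ‖t‖ := by simpa using hx
    have hx1 : ‖x‖ ≤ 1 := hx'.trans ht
    rw [norm_mul, norm_neg, norm_pow, Complex.norm_exp]
    gcongr
    refine (Complex.re_le_norm _).trans ((norm_add_le _ _).trans ?_)
    rw [norm_div, norm_pow, RCLike.norm_ofNat]
    nlinarith [norm_nonneg x]
  have := (convex_closedBall (0 : ℂ) ‖t‖).norm_image_sub_le_of_norm_hasDerivWithin_le
    (fun x _ ↦ (hE x).hasDerivWithinAt) hb (x := 0) (y := t) (by simp) (by simp)
  have hE0 : E 0 = 1 := by simp [E]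
  rw [hE0, sub_zero] at this
  refine this.trans (le_of_eq ?_)
  ring

theorem summable_norm_lattice :
    Summable fun ω : {ω : L.lattice // ω ≠ 0} ↦ (‖(ω.1 : ℂ)‖ ^ 3)⁻¹ := by
  have h := ZLattice.summable_norm_rpow L.lattice (-3) (by simp; norm_num)
  refine (h.comp_injective Subtype.val_injective).congr fun ω ↦ ?_
  simp only [Function.comp_apply]
  rw [Real.rpow_neg (norm_nonneg _)]
  norm_cast

theorem sigmaFactor_bound {K : Set ℂ} (hK : IsCompact K) :
    ∃ b : {ω : L.lattice // ω ≠ 0} → ℝ, Summable b ∧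
      ∀ᶠ ω in cofinite, ∀ z ∈ K, ‖sigmaFactor (ω.1 : ℂ) z - 1‖ ≤ b ω := by
  obtain ⟨R, hR⟩ := hK.exists_bound_of_continuousOn (f := fun z ↦ z) continuousOn_id
  set R' := max R 1
  have hs := (summable_norm_lattice L).mul_left (R' ^ 3)
  refine ⟨_, hs.mul_left (Real.exp 2), ?_⟩
  filter_upwards [hs.tendsto_cofinite_zero.eventually_le_const one_pos] with ω hω z hz
  have hω0 : 0 < ‖(ω.1 : ℂ)‖ := norm_pos_iff.mpr (by simpa using ω.2)
  have hzR : ‖z‖ ≤ R' := (hR z hz).trans (le_max_left _ _)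
  have ht3 : ‖z / (ω.1 : ℂ)‖ ^ 3 ≤ R' ^ 3 * (‖(ω.1 : ℂ)‖ ^ 3)⁻¹ := by
    rw [norm_div, div_pow, div_eq_mul_inv]
    gcongr
  have ht : ‖z / (ω.1 : ℂ)‖ ≤ 1 := by
    by_contra! h
    have : 1 < ‖z / (ω.1 : ℂ)‖ ^ 3 := one_lt_pow₀ h (by norm_num)
    linarith
  exact (norm_primaryFactor_sub_one_le ht).trans (by gcongr)

theorem sigmaFactor_differentiable (ω : ℂ) : Differentiable ℂ (sigmaFactor ω) := by
  unfold sigmaFactor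
  fun_prop

theorem sigmaFactor_multipliable : MultipliableLocallyUniformlyOn
    (fun (ω : {ω : L.lattice // ω ≠ 0}) z ↦ sigmaFactor (ω.1 : ℂ) z) Set.univ :=
  multipliableLocallyUniformlyOn_of_locally_bounded isOpen_univ
    (fun _ ↦ (sigmaFactor_differentiable _).continuous.continuousOn)
    fun _ _ hK ↦ sigmaFactor_bound L hK

theorem sigmaFactor_ne_zero {z : ℂ} (hz : z ∉ L.lattice) (ω : {ω : L.lattice // ω ≠ 0}) :
    sigmaFactor (ω.1 : ℂ) z ≠ 0 := by
  have hω0 : (ω.1 : ℂ) ≠ 0 := by simpa using ω.2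
  refine mul_ne_zero (sub_ne_zero.mpr fun h ↦ hz ?_) (Complex.exp_ne_zero _)
  rw [eq_div_iff hω0, one_mul] at h
  rw [← h]
  exact ω.1.2

/-- The product in the definition of the Weierstrass `σ`-function. -/
noncomputable def sigmaProduct (z : ℂ) : ℂ :=
  ∏' ω : {ω : L.lattice // ω ≠ 0}, sigmaFactor (ω.1 : ℂ) z

theorem sigmaProduct_ne_zero {z : ℂ} (hz : z ∉ L.lattice) :
    sigmaProduct L z ≠ 0 := by
  obtain ⟨b, hb, h⟩ := sigmaFactor_bound L (isCompact_singleton (x := z))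
  exact tprod_ne_zero_of_bounded hb (h.mono fun ω hω ↦ hω z rfl) (sigmaFactor_ne_zero L hz)

theorem sigmaProduct_differentiable : Differentiable ℂ (sigmaProduct L) :=
  differentiableOn_univ.mp (differentiableOn_tprod isOpen_univ (sigmaFactor_multipliable L)
    fun _ ↦ (sigmaFactor_differentiable _).differentiableOn)

theorem weierstrassSigma_differentiable : Differentiable ℂ (weierstrassSigma L) :=
  differentiable_id.mul (sigmaProduct_differentiable L)

theorem weierstrassSigma_neg (z : ℂ) : weierstrassSigma L (-z) = -weierstrassSigma L z := by
  let e : {ω : L.lattice // ω ≠ 0} ≃ {ω : L.lattice // ω ≠ 0} :=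
    (Equiv.neg L.lattice).subtypeEquiv (by simp)
  rw [weierstrassSigma, weierstrassSigma, ← e.tprod_eq]
  simp [e, neg_div_neg_eq]

theorem weierstrassSigma_ne_zero {z : ℂ} (hz : z ∉ L.lattice) : weierstrassSigma L z ≠ 0 :=
  mul_ne_zero (fun h ↦ hz (h ▸ zero_mem _)) (sigmaProduct_ne_zero L hz)

theorem weierstrassSigma_hasDerivAt_zero : HasDerivAt (weierstrassSigma L) 1 0 := by
  have h := (hasDerivAt_id' (0 : ℂ)).mul (sigmaProduct_differentiable L 0).hasDerivAt
  refine h.congr_deriv ?_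
  simp [sigmaProduct, sigmaFactor]

theorem logDeriv_sigmaFactor {ω z : ℂ} (hω : ω ≠ 0) (hz : z ≠ ω) :
    logDeriv (sigmaFactor ω) z = 1 / (z - ω) + (1 / ω + z / ω ^ 2) := by
  have hzω : z - ω ≠ 0 := sub_ne_zero.mpr hz
  have h1 : HasDerivAt (fun z : ℂ ↦ z / ω + (z / ω) ^ 2 / 2) (1 / ω + z / ω ^ 2) z := by
    refine (((hasDerivAt_id' z).div_const ω).add
      ((((hasDerivAt_id' z).div_const ω).fun_pow 2).div_const 2)).congr_deriv ?_
    simp only [Nat.cast_ofNat, Nat.add_one_sub_one, pow_one]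
    field_simp
  have h2 := (((hasDerivAt_id' z).div_const ω).const_sub 1).fun_mul h1.cexp
  have hne : 1 - z / ω ≠ 0 := by
    rw [sub_ne_zero, ne_eq, eq_div_iff hω, one_mul]
    exact fun h ↦ hz h.symm
  have hne' : ω - z ≠ 0 := sub_ne_zero.mpr hz.symm
  rw [logDeriv_apply, show deriv (sigmaFactor ω) z = _ from h2.deriv, sigmaFactor]
  have := Complex.exp_ne_zero (z / ω + (z / ω) ^ 2 / 2)
  have e : 1 - z / ω = -(z - ω) / ω := by field_simp; ring
  rw [e]
  field_simp
  ring

theorem tsum_subtype_ne_zero (z : ℂ) :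
    ∑' ω : {ω : L.lattice // ω ≠ 0}, (1 / (z - (ω.1 : ℂ)) ^ 2 - 1 / (ω.1 : ℂ) ^ 2) =
      L.weierstrassPExcept 0 z := by
  rw [PeriodPair.weierstrassPExcept]
  refine (tsum_subtype {ω : L.lattice | ω ≠ 0}
    fun ω : L.lattice ↦ (1 / (z - (ω : ℂ)) ^ 2 - 1 / (ω : ℂ) ^ 2)).trans ?_
  refine tsum_congr fun ω ↦ ?_
  by_cases h : ω = 0 <;> simp [h, Set.indicator]

theorem logDeriv_sigmaFactor_hasDerivAt {ω z : ℂ} (hz : z ≠ ω) :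
    HasDerivAt (fun z ↦ 1 / (z - ω) + (1 / ω + z / ω ^ 2)) (-(1 / (z - ω) ^ 2 - 1 / ω ^ 2)) z := by
  simp only [one_div]
  refine ((((hasDerivAt_id' z).sub_const ω).fun_inv (sub_ne_zero.mpr hz)).add
    (((hasDerivAt_id' z).div_const (ω ^ 2)).const_add ω⁻¹)).congr_deriv ?_
  ring

theorem logDeriv_sigmaProduct_hasDerivAt {z : ℂ} (hz : z ∉ L.lattice) :
    HasDerivAt (logDeriv (sigmaProduct L)) (-L.weierstrassPExcept 0 z) z := by
  have hω0 : ∀ ω : {ω : L.lattice // ω ≠ 0}, (ω.1 : ℂ) ≠ 0 := fun ω ↦ by simpa using ω.2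
  have hne : ∀ x ∈ (L.lattice : Set ℂ)ᶜ, ∀ ω : {ω : L.lattice // ω ≠ 0}, x ≠ ω.1 :=
    fun x hx ω h ↦ hx (h ▸ ω.1.2)
  rw [← tsum_subtype_ne_zero, ← tsum_neg]
  exact hasDerivAt_logDeriv_tprod (s := (L.lattice : Set ℂ)ᶜ)
    (f := fun (ω : {ω : L.lattice // ω ≠ 0}) z ↦ sigmaFactor (ω.1 : ℂ) z)
    (g := fun ω z ↦ 1 / (z - (ω.1 : ℂ)) + (1 / (ω.1 : ℂ) + z / (ω.1 : ℂ) ^ 2))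
    (g' := fun ω z ↦ -(1 / (z - (ω.1 : ℂ)) ^ 2 - 1 / (ω.1 : ℂ) ^ 2))
    L.isClosed_lattice.isOpen_compl
    ((sigmaFactor_multipliable L).mono (Set.subset_univ _))
    (fun ω ↦ (sigmaFactor_differentiable _).differentiableOn)
    (fun ω x hx ↦ sigmaFactor_ne_zero L hx ω) (fun x hx ↦ sigmaProduct_ne_zero L hx)
    (fun ω x hx ↦ logDeriv_sigmaFactor (hω0 ω) (hne x hx ω))
    (fun ω x hx ↦ logDeriv_sigmaFactor_hasDerivAt (hne x hx ω)) hz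

theorem logDeriv_weierstrassSigma_hasDerivAt {z : ℂ} (hz : z ∉ L.lattice) :
    HasDerivAt (logDeriv (weierstrassSigma L)) (-L.weierstrassP z) z := by
  have hne : ∀ x ∉ L.lattice, x ≠ 0 := fun x hx h ↦ hx (h ▸ zero_mem _)
  have hQ := (hasDerivAt_inv (hne z hz)).fun_add (logDeriv_sigmaProduct_hasDerivAt L hz)
  rw [weierstrassP_expansion]
  refine (hQ.congr_deriv (by ring)).congr_of_eventuallyEq ?_
  filter_upwards [L.isClosed_lattice.isOpen_compl.mem_nhds hz] with x hx
  have := logDeriv_mul (f := fun z ↦ z) x (hne x hx) (sigmaProduct_ne_zero L hx)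
    differentiableAt_id (sigmaProduct_differentiable L x)
  refine this.trans ?_
  simp [logDeriv_apply]

end Sigma

/-! ### The theta product and its functional equations. -/

section Theta

variable {R : Type*} [NormedField R]

/-- The factor of the theta product which vanishes at `U = q ^ (-m)`. -/
def thetaFactor (q U : R) (m : ℤ) : R :=
  if 0 ≤ m then 1 - q ^ m * U else 1 - (q ^ m * U)⁻¹

/-- The theta function `(1 - U) ∏ (1 - qᵐ U) (1 - qᵐ / U)` of the Tate curve. -/
noncomputable def theta (q U : R) : R := ∏' m : ℤ, thetaFactor q U m

theorem thetaFactor_ne_zero {q U : R} {m : ℤ} (h : q ^ m * U ≠ 1) : thetaFactor q U m ≠ 0 := by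
  rw [thetaFactor]
  split_ifs
  · exact sub_ne_zero.mpr h.symm
  · exact sub_ne_zero.mpr fun h' ↦ h (by rw [← inv_inv (q ^ m * U), ← h', inv_one])

theorem norm_thetaFactor_sub_one_le {q U : R} {C : ℝ} (h₁ : ‖U‖ ≤ C) (h₂ : ‖U⁻¹‖ ≤ C) (m : ℤ) :
    ‖thetaFactor q U m - 1‖ ≤ C * ‖q‖ ^ m.natAbs := by
  rw [thetaFactor]
  split_ifs with hm
  · obtain ⟨n, rfl⟩ := Int.eq_ofNat_of_zero_le hm
    rw [sub_sub_cancel_left, norm_neg, norm_mul, mul_comm]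
    simp only [zpow_natCast, norm_pow, Int.natAbs_natCast]
    gcongr
  · obtain ⟨n, hn⟩ := Int.eq_ofNat_of_zero_le (by omega : 0 ≤ -m)
    obtain rfl : m = -n := by omega
    rw [sub_sub_cancel_left, norm_neg, mul_inv, norm_mul, mul_comm]
    simp only [zpow_neg, zpow_natCast, inv_inv, norm_pow, Int.natAbs_neg, Int.natAbs_natCast]
    gcongr

theorem summable_thetaFactor_bound {q : R} (hq₁ : ‖q‖ < 1) (C : ℝ) :
    Summable fun m : ℤ ↦ C * ‖q‖ ^ m.natAbs := by
  have h := summable_geometric_of_lt_one (norm_nonneg q) hq₁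
  exact (Summable.of_nat_of_neg (f := fun m : ℤ ↦ ‖q‖ ^ m.natAbs) (by simpa using h)
    (by simpa using h)).mul_left C

variable [CompleteSpace R]

theorem thetaFactor_multipliable {q : R} (hq₁ : ‖q‖ < 1) (U : R) :
    Multipliable (thetaFactor q U) := by
  have := multipliable_one_add_of_summable (f := fun m ↦ thetaFactor q U m - 1)
    (Summable.of_nonneg_of_le (fun _ ↦ norm_nonneg _)
      (norm_thetaFactor_sub_one_le (le_max_left _ _) (le_max_right ‖U‖ ‖U⁻¹‖))
      (summable_thetaFactor_bound hq₁ _))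
  simpa using this

theorem theta_ne_zero {q U : R} (hq₁ : ‖q‖ < 1) (h : ∀ m : ℤ, q ^ m * U ≠ 1) : theta q U ≠ 0 :=
  tprod_ne_zero_of_bounded (summable_thetaFactor_bound hq₁ (max ‖U‖ ‖U⁻¹‖))
    (.of_forall (norm_thetaFactor_sub_one_le (le_max_left _ _) (le_max_right _ _)))
    fun m ↦ thetaFactor_ne_zero (h m)

/-- A functional equation of `theta` is a permutation of the factors that is exact except at one
index `k`, where a factor `a` is lost or gained. -/
theorem theta_eq_of_factor {q U V a : R} (hq₁ : ‖q‖ < 1) (k : ℤ) (e : ℤ ≃ ℤ)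
    (h : ∀ m, thetaFactor q V m = thetaFactor q U (e m) * if m = k then a else 1) :
    theta q V = a * theta q U := by
  have hm : HasProd (fun m ↦ thetaFactor q U (e m)) (theta q U) :=
    (Equiv.hasProd_iff (f := thetaFactor q U) e).mpr (thetaFactor_multipliable hq₁ U).hasProd
  have h₁ : HasProd (fun m : ℤ ↦ if m = k then a else 1) a := hasProd_ite_eq k a
  have h₂ : HasProd (thetaFactor q V) (theta q U * a) := (funext h) ▸ hm.mul h₁
  exact h₂.tprod_eq.trans (mul_comm _ _)

/-- The shift of the index changes the shape of a factor only at `m = -1`, where `1 - U⁻¹ = -U⁻¹ (1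
- U)`. -/
theorem theta_mul_left {q U : R} (hq₀ : q ≠ 0) (hq₁ : ‖q‖ < 1) (hU : U ≠ 0) :
    theta q (q * U) = -U⁻¹ * theta q U := by
  refine theta_eq_of_factor hq₁ (-1) (Equiv.addRight 1) fun m ↦ ?_
  have hq : q ^ m * (q * U) = q ^ (m + 1) * U := by rw [zpow_add_one₀ hq₀]; ring
  have he : (Equiv.addRight (1 : ℤ)) m = m + 1 := rfl
  rw [he]
  simp only [thetaFactor, hq]
  rcases lt_trichotomy m (-1) with h | rfl | h
  · rw [if_neg (by omega : ¬0 ≤ m), if_neg (by omega : ¬0 ≤ m + 1), if_neg (by omega), mul_one]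
  · norm_num
    field_simp
    ring
  · rw [if_pos (by omega : 0 ≤ m), if_pos (by omega : 0 ≤ m + 1), if_neg (by omega), mul_one]

theorem theta_inv {q U : R} (hq₁ : ‖q‖ < 1) (hU : U ≠ 0) :
    theta q U⁻¹ = -U⁻¹ * theta q U := by
  refine theta_eq_of_factor hq₁ 0 (Equiv.neg ℤ) fun m ↦ ?_
  have hq : q ^ m * U⁻¹ = (q ^ (-m) * U)⁻¹ := by rw [zpow_neg, mul_inv, inv_inv]
  simp only [thetaFactor, Equiv.neg_apply, hq, inv_inv]
  rcases lt_trichotomy m 0 with h | rfl | h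
  · rw [if_neg (by omega), if_pos (by omega), if_neg (by omega), mul_one]
  · norm_num
    field_simp
    ring
  · rw [if_pos (by omega), if_neg (by omega), if_neg (by omega), mul_one]

theorem ofReal_theta {q : ℝ} (hq₁ : ‖q‖ < 1) (U : ℝ) : ((theta q U : ℝ) : ℂ) = theta (q : ℂ) U := by
  refine ((thetaFactor_multipliable hq₁ U).map_tprod Complex.ofRealHom
    Complex.continuous_ofReal).trans (tprod_congr fun m ↦ ?_)
  simp only [thetaFactor]
  split_ifs <;> simp

end Theta

/-! ### The `σ`-function expressed by theta. -/

section AnalyticTheta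

variable {q : ℂ}

theorem thetaFactor_exp_differentiable (q : ℂ) (m : ℤ) :
    Differentiable ℂ fun w ↦ thetaFactor q (Complex.exp w) m := by
  unfold thetaFactor
  split_ifs
  · fun_prop
  · have : ∀ w, (q ^ m * Complex.exp w)⁻¹ = (q ^ m)⁻¹ * Complex.exp (-w) := fun w ↦ by
      rw [mul_inv, Complex.exp_neg]
    simp only [this]
    fun_prop

theorem thetaFactor_exp_multipliable (hq₁ : ‖q‖ < 1) : MultipliableLocallyUniformlyOn
    (fun m w ↦ thetaFactor q (Complex.exp w) m) Set.univ := by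
  refine multipliableLocallyUniformlyOn_of_locally_bounded isOpen_univ
    (fun m ↦ (thetaFactor_exp_differentiable q m).continuous.continuousOn) fun K _ hK ↦ ?_
  obtain ⟨C, -, hC⟩ := exists_exp_bound hK
  exact ⟨_, summable_thetaFactor_bound hq₁ C, .of_forall fun m w hw ↦
    norm_thetaFactor_sub_one_le (hC w hw).1 (hC w hw).2 m⟩

theorem theta_exp_differentiable (hq₁ : ‖q‖ < 1) :
    Differentiable ℂ fun w ↦ theta q (Complex.exp w) :=
  differentiableOn_univ.mp (differentiableOn_tprod isOpen_univ (thetaFactor_exp_multipliable hq₁)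
    fun m ↦ (thetaFactor_exp_differentiable q m).differentiableOn)

/-- The two shapes of a factor have logarithmic derivatives differing by the constant `1`, so one
more differentiation gives `-kernel₀` for all `m` alike. -/
theorem logDeriv_thetaFactor_exp (hq₀ : q ≠ 0) {m : ℤ} {w : ℂ} (h : q ^ m * Complex.exp w ≠ 1) :
    logDeriv (fun w ↦ thetaFactor q (Complex.exp w) m) w =
      (if 0 ≤ m then 1 else 0) - (1 - q ^ m * Complex.exp w)⁻¹ := by
  have h' : 1 - q ^ m * Complex.exp w ≠ 0 := sub_ne_zero.mpr h.symm
  have e := hasDerivAt_mul_exp (q ^ m) w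
  have hV : q ^ m * Complex.exp w ≠ 0 := mul_ne_zero (zpow_ne_zero m hq₀) (Complex.exp_ne_zero w)
  by_cases hm : 0 ≤ m
  · simp only [thetaFactor, if_pos hm, logDeriv_apply, (e.const_sub 1).deriv]
    field_simp
    ring
  · simp only [thetaFactor, if_neg hm, logDeriv_apply, ((e.fun_inv hV).const_sub 1).deriv]
    generalize q ^ m * Complex.exp w = V at *
    have h2 : 1 - V⁻¹ = -(1 - V) / V := by field_simp; ring
    rw [h2]
    field_simp
    ring

theorem logDeriv_theta_exp_hasDerivAt (hq₀ : q ≠ 0) (hq₁ : ‖q‖ < 1) {w : ℂ}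
    (hw : w ∈ tateDomain q Set.univ) :
    HasDerivAt (logDeriv fun w ↦ theta q (Complex.exp w)) (-tateSeries kernel₀ q Set.univ w) w := by
  rw [tateSeries, ← tsum_neg]
  simp only [Set.indicator_univ]
  refine hasDerivAt_logDeriv_tprod (s := tateDomain q Set.univ)
    (f := fun m w ↦ thetaFactor q (Complex.exp w) m)
    (g := fun m w ↦ (if 0 ≤ m then 1 else 0) - (1 - q ^ m * Complex.exp w)⁻¹)
    (g' := fun m w ↦ -kernel₀ (q ^ m * Complex.exp w))
    (isOpen_tateDomain hq₀ hq₁ _) ((thetaFactor_exp_multipliable hq₁).mono (Set.subset_univ _))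
    (fun m ↦ (thetaFactor_exp_differentiable q m).differentiableOn)
    (fun m x hx ↦ thetaFactor_ne_zero (hx m trivial))
    (fun x hx ↦ theta_ne_zero hq₁ fun m ↦ hx m trivial)
    (fun m x hx ↦ logDeriv_thetaFactor_exp hq₀ (hx m trivial)) (fun m x hx ↦ ?_) hw
  have h' : 1 - q ^ m * Complex.exp x ≠ 0 := sub_ne_zero.mpr (hx m trivial).symm
  refine ((((hasDerivAt_mul_exp (q ^ m) x).const_sub 1).fun_inv h').const_sub _).congr_deriv ?_
  rw [kernel₀]
  ring

/-- The odd normalization of the theta function, in the additive variable. -/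
noncomputable def oddTheta (q w : ℂ) : ℂ := Complex.exp (-(w / 2)) * theta q (Complex.exp w)

theorem oddTheta_differentiable (hq₁ : ‖q‖ < 1) : Differentiable ℂ (oddTheta q) :=
  Differentiable.mul (by fun_prop) (theta_exp_differentiable hq₁)

theorem oddTheta_neg (hq₁ : ‖q‖ < 1) (w : ℂ) : oddTheta q (-w) = -oddTheta q w := by
  rw [oddTheta, oddTheta, Complex.exp_neg w, theta_inv hq₁ (Complex.exp_ne_zero w)]
  have h : Complex.exp (-(-w / 2)) * (Complex.exp w)⁻¹ = Complex.exp (-(w / 2)) := by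
    rw [← Complex.exp_neg, ← Complex.exp_add]
    ring_nf
  linear_combination -theta q (Complex.exp w) * h

theorem oddTheta_ne_zero (hq₀ : q ≠ 0) (hq₁ : ‖q‖ < 1) {w : ℂ}
    (hw : w ∉ (tatePeriods q hq₀ hq₁).lattice) : oddTheta q w ≠ 0 :=
  mul_ne_zero (Complex.exp_ne_zero _) (theta_ne_zero hq₁ ((notMem_tatePeriods hq₀ hq₁).mp hw))

theorem logDeriv_oddTheta_hasDerivAt (hq₀ : q ≠ 0) (hq₁ : ‖q‖ < 1) {w : ℂ}
    (hw : w ∉ (tatePeriods q hq₀ hq₁).lattice) :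
    HasDerivAt (logDeriv (oddTheta q)) (-tateSeries kernel₀ q Set.univ w) w := by
  have hD := (mem_tateDomain_univ hq₀ hq₁).mpr hw
  refine ((logDeriv_theta_exp_hasDerivAt hq₀ hq₁ hD).const_add (-(1 / 2))).congr_of_eventuallyEq ?_
  filter_upwards [(isOpen_tateDomain hq₀ hq₁ _).mem_nhds hD] with x hx
  have e : HasDerivAt (fun w : ℂ ↦ Complex.exp (-(w / 2)))
      (Complex.exp (-(x / 2)) * (-(1 / 2))) x := ((hasDerivAt_id' x).div_const 2).neg.cexp
  refine (logDeriv_mul (f := fun w ↦ Complex.exp (-(w / 2)))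
    (g := fun w ↦ theta q (Complex.exp w)) x (Complex.exp_ne_zero _)
    (theta_ne_zero hq₁ fun m ↦ hx m trivial) e.differentiableAt
    (theta_exp_differentiable hq₁ x)).trans ?_
  rw [logDeriv_apply, e.deriv, mul_div_cancel_left₀ _ (Complex.exp_ne_zero _)]

/-- For real `q` the function is real on the real axis. This is what makes the constant `A` relating
`σ` to theta real, so that its sign makes sense. -/
theorem oddTheta_deriv_im {q : ℝ} (hq₁ : ‖q‖ < 1) : (deriv (oddTheta q) 0).im = 0 := by
  have hq₁' : ‖(q : ℂ)‖ < 1 := by simpa using hq₁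
  have h : HasDerivAt (fun x : ℝ ↦ oddTheta q x) (deriv (oddTheta q) 0) 0 :=
    HasDerivAt.comp_ofReal (z := 0) (by simpa using (oddTheta_differentiable hq₁' 0).hasDerivAt)
  have h2 := Complex.imCLM.hasFDerivAt.comp_hasDerivAt (0 : ℝ) h
  have e : (Complex.imCLM ∘ fun x : ℝ ↦ oddTheta q x) = fun _ ↦ 0 := by
    funext x
    simp only [Function.comp_apply, oddTheta, Complex.imCLM_apply]
    have : Complex.exp (-(x / 2 : ℂ)) * theta (q : ℂ) (Complex.exp x) =
        ((Real.exp (-(x / 2)) * theta q (Real.exp x) : ℝ) : ℂ) := by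
      push_cast
      rw [ofReal_theta hq₁]
      push_cast
      rfl
    rw [this, Complex.ofReal_im]
  rw [e] at h2
  simpa using (h2.unique (hasDerivAt_const (0 : ℝ) (0 : ℝ)))

/-- The Weierstrass `σ`-function as a theta function. -/
theorem weierstrassSigma_eq_oddTheta {q c : ℝ} (L : PeriodPair) (hq₀ : (q : ℂ) ≠ 0)
    (hq₁ : ‖(q : ℂ)‖ < 1)
    (hΛ : ∀ t, t ∈ L.lattice ↔ c * t ∈ (tatePeriods q hq₀ hq₁).lattice)
    (hP : ∀ t ∉ L.lattice, L.weierstrassP t = (c : ℂ) ^ 2 * tateP q (c * t)) :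
    ∃ (A : ℝ) (K : ℂ), A ≠ 0 ∧
      ∀ z, weierstrassSigma L z = A * Complex.exp (K * z ^ 2) * oddTheta q (c * z) := by
  have hmul : ∀ z : ℂ, HasDerivAt (fun z : ℂ ↦ (c : ℂ) * z) c z := fun z ↦ by
    simpa using (hasDerivAt_id' z).const_mul (c : ℂ)
  have hlog : logDeriv (fun z ↦ oddTheta q (c * z)) = fun z ↦ c * logDeriv (oddTheta q) (c * z) := by
    funext z
    have := ((oddTheta_differentiable hq₁ (c * z)).hasDerivAt.comp z (hmul z)).deriv
    rw [logDeriv_apply, logDeriv_apply]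
    refine (congrArg (· / oddTheta q (c * z)) this).trans ?_
    ring
  -- The constant `K` comes from the additive constant `1/12 - 2 s₁` by which `tateP` differs from
  -- the bare series.
  obtain ⟨A, hA⟩ := exists_gaussian_factor (F₁ := weierstrassSigma L)
    (F₂ := fun z ↦ oddTheta q (c * z)) (p₁ := fun z ↦ -L.weierstrassP z)
    (p₂ := fun z ↦ -((c : ℂ) ^ 2 * tateSeries kernel₀ q Set.univ (c * z)))
    (K := -((c : ℂ) ^ 2 * (1 / 12 - 2 * lambert 1 q)))
    L.isClosed_lattice (lattice_countable L) (fun z hz ↦ by simpa using hz)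
    (weierstrassSigma_differentiable L) ((oddTheta_differentiable hq₁).comp (by fun_prop))
    (weierstrassSigma_neg L) (fun z ↦ by rw [mul_neg, oddTheta_neg hq₁])
    (fun z hz ↦ weierstrassSigma_ne_zero L hz)
    (fun z hz ↦ oddTheta_ne_zero hq₀ hq₁ (mt (hΛ z).mpr hz))
    (fun z hz ↦ logDeriv_weierstrassSigma_hasDerivAt L hz)
    (fun z hz ↦ by
      rw [hlog]
      refine (((logDeriv_oddTheta_hasDerivAt hq₀ hq₁ (mt (hΛ z).mpr hz)).comp z
        (hmul z)).const_mul (c : ℂ)).congr_deriv ?_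
      ring)
    (fun z hz ↦ by rw [hP z hz, tateP]; ring)
  set D := deriv (oddTheta q) 0
  set K : ℂ := -((c : ℂ) ^ 2 * (1 / 12 - 2 * lambert 1 q))
  have hθ0 : oddTheta q 0 = 0 := by
    have := oddTheta_neg hq₁ 0
    rw [neg_zero, CharZero.eq_neg_self_iff] at this
    exact this
  -- Since `σ'(0) = 1`, comparing derivatives at `0` determines `A`, and `A` is real because `D` and
  -- `c` are.
  have h1 : A * (D * c) = 1 := by
    have e0 : HasDerivAt (fun z ↦ oddTheta q (c * z)) (D * c) 0 :=
      HasDerivAt.comp (h₂ := oddTheta q) 0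
        (by rw [mul_zero]; exact (oddTheta_differentiable hq₁ 0).hasDerivAt) (hmul 0)
    have e1 : HasDerivAt (fun z : ℂ ↦ A * Complex.exp (K / 2 * z ^ 2)) 0 0 := by
      refine (((hasDerivAt_pow 2 (0 : ℂ)).const_mul (K / 2)).cexp.const_mul A).congr_deriv ?_
      simp
    have e2 := e1.fun_mul e0
    have e3 := weierstrassSigma_hasDerivAt_zero L
    rw [show weierstrassSigma L = _ from funext hA] at e3
    have := e3.unique e2
    simpa using this.symm
  have hDim : D.im = 0 := oddTheta_deriv_im (by simpa using hq₁)
  have hD : D = (D.re : ℂ) := Complex.ext (by simp) (by simp [hDim])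
  have hDc : D.re * c ≠ 0 := by
    rw [hD] at h1
    norm_cast at h1
    intro h
    simp [h] at h1
  refine ⟨(D.re * c)⁻¹, K / 2, inv_ne_zero hDc, fun z ↦ ?_⟩
  have hAD : A = (((D.re * c)⁻¹ : ℝ) : ℂ) := by
    push_cast
    rw [← hD]
    exact eq_inv_of_mul_eq_one_left h1
  rw [← hAD]
  exact hA z

end AnalyticTheta

/-! ### Exponent identities for the denominator of a net polynomial. -/

section NetQuotient

theorem sum_sum_eq_diag_add_triangle {ι R : Type*} [Fintype ι] [LinearOrder ι] [AddCommMonoid R]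
    (F : ι → ι → R) :
    ∑ i, ∑ j, F i j = ∑ i, F i i + ∑ i, ∑ j with i < j, (F i j + F j i) := by
  have h : ∀ i, ∑ j, F i j = F i i + ∑ j with i < j, F i j + ∑ j with j < i, F i j := fun i ↦ by
    rw [← Finset.sum_filter_add_sum_filter_not Finset.univ (fun j ↦ j = i),
      Finset.sum_filter, Finset.sum_ite_eq' Finset.univ, if_pos (Finset.mem_univ i), add_assoc,
      ← Finset.sum_filter_add_sum_filter_not (Finset.univ.filter fun j ↦ ¬j = i) (fun j ↦ i < j),
      Finset.filter_filter, Finset.filter_filter]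
    congr 3 <;> ext j <;> simp only [Finset.mem_filter, Finset.mem_univ, true_and] <;> grind
  have h' : ∑ i, ∑ j with j < i, F i j = ∑ i, ∑ j with i < j, F j i := by
    simp only [Finset.sum_filter]
    exact Finset.sum_comm
  simp only [h, Finset.sum_add_distrib, h', add_assoc]

variable {K : Type*} [Field K] {n : ℕ}

/-- The denominator of a net polynomial: `D` and `T` play the roles of `σ(zᵢ)` and `σ(zᵢ + zⱼ)`. -/
def netDenominator (v : Fin n → ℤ) (D : Fin n → K) (T : Fin n → Fin n → K) : K :=
  (∏ i, D i ^ (2 * v i ^ 2 - ∑ j, v i * v j)) * ∏ i, ∏ j with i < j, T i j ^ (v i * v j)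

theorem netDenominator_mul (v : Fin n → ℤ) (D D' : Fin n → K) (T T' : Fin n → Fin n → K) :
    netDenominator v (fun i ↦ D i * D' i) (fun i j ↦ T i j * T' i j) =
      netDenominator v D T * netDenominator v D' T' := by
  simp only [netDenominator, mul_zpow, Finset.prod_mul_distrib]
  ring

theorem map_netDenominator {K' : Type*} [Field K'] (f : K →+* K') (v : Fin n → ℤ) (D : Fin n → K)
    (T : Fin n → Fin n → K) :
    f (netDenominator v D T) = netDenominator v (fun i ↦ f (D i)) fun i j ↦ f (T i j) := by
  simp only [netDenominator, map_mul, map_prod, map_zpow₀]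

theorem netDenominator_ne_zero {v : Fin n → ℤ} {D : Fin n → K} {T : Fin n → Fin n → K}
    (hD : ∀ i, D i ≠ 0) (hT : ∀ i j, i < j → T i j ≠ 0) : netDenominator v D T ≠ 0 :=
  mul_ne_zero (Finset.prod_ne_zero_iff.mpr fun i _ ↦ zpow_ne_zero _ (hD i))
    (Finset.prod_ne_zero_iff.mpr fun i _ ↦ Finset.prod_ne_zero_iff.mpr fun j hj ↦
      zpow_ne_zero _ (hT i j (Finset.mem_filter.mp hj).2))

/-- The additive counterpart of `netDenominator`. -/
def netSum (v : Fin n → ℤ) (D : Fin n → K) (T : Fin n → Fin n → K) : K :=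
  ∑ i, (2 * (v i : K) ^ 2 - ∑ j, (v i : K) * v j) * D i + ∑ i, ∑ j with i < j, v i * v j * T i j

theorem netDenominator_exp (v : Fin n → ℤ) (D : Fin n → ℂ) (T : Fin n → Fin n → ℂ) :
    netDenominator v (fun i ↦ Complex.exp (D i)) (fun i j ↦ Complex.exp (T i j)) =
      Complex.exp (netSum v D T) := by
  simp only [netDenominator, netSum, Complex.exp_add, Complex.exp_sum, ← Complex.exp_int_mul]
  push_cast
  rfl

/-- The exponents in the denominator add up to `e(v) + 1`, so a constant multiple of `σ` contributes
its power `-e(v)`. -/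
theorem netSum_const (v : Fin n → ℤ) (a : K) :
    a - netSum v (fun _ ↦ a) (fun _ _ ↦ a) = -(twistExponent v) * a := by
  have h := sum_sum_eq_diag_add_triangle fun i j ↦ (v i : K) * v j
  have e : ∑ i, ∑ j with i < j, ((v i : K) * v j + v j * v i) =
      ∑ i, ∑ j with i < j, 2 * ((v i : K) * v j) :=
    Finset.sum_congr rfl fun i _ ↦ Finset.sum_congr rfl fun j _ ↦ by ring
  rw [e] at h
  simp only [← pow_two, ← Finset.mul_sum, ← Finset.sum_mul] at h
  simp only [netSum, twistExponent, ← Finset.sum_mul, Finset.sum_sub_distrib, ← Finset.mul_sum]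
  push_cast
  linear_combination a * h

theorem netSum_linear (v : Fin n → ℤ) (x : Fin n → K) :
    ∑ i, v i * x i - netSum v x (fun i j ↦ x i + x j) = ∑ i, (v i - (v i : K) ^ 2) * x i := by
  have h := sum_sum_eq_diag_add_triangle fun i j ↦ (v i : K) * v j * x i
  have e : ∑ i, ∑ j with i < j, (v i : K) * v j * (x i + x j) =
      ∑ i, ∑ j with i < j, ((v i : K) * v j * x i + v j * v i * x j) :=
    Finset.sum_congr rfl fun i _ ↦ Finset.sum_congr rfl fun j _ ↦ by ring
  simp only [netSum, e, sub_mul, Finset.sum_sub_distrib, Finset.sum_mul]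
  rw [← sub_eq_zero]
  simp only [mul_assoc, ← Finset.mul_sum, pow_two] at h ⊢
  linear_combination h

/-- A quadratic form at `∑ vᵢ xᵢ` is determined by its values at `xᵢ` and `xᵢ + xⱼ`, and the
exponents of the denominator are the coefficients. Gaussian factors therefore cancel in `Ω_v`. -/
theorem netSum_quadratic (v : Fin n → ℤ) (x : Fin n → K) :
    netSum v (fun i ↦ x i ^ 2) (fun i j ↦ (x i + x j) ^ 2) = (∑ i, v i * x i) ^ 2 := by
  have h := sum_sum_eq_diag_add_triangle fun i j ↦ (v i : K) * v j * (x i ^ 2 + x i * x j)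
  have e : ∑ i, ∑ j with i < j, (v i : K) * v j * (x i + x j) ^ 2 =
      ∑ i, ∑ j with i < j, ((v i : K) * v j * (x i ^ 2 + x i * x j) +
        v j * v i * (x j ^ 2 + x j * x i)) :=
    Finset.sum_congr rfl fun i _ ↦ Finset.sum_congr rfl fun j _ ↦ by ring
  have e₁ : (∑ i, v i * x i) ^ 2 = ∑ i, ∑ j, (v i : K) * v j * (x i * x j) := by
    rw [pow_two, Finset.sum_mul_sum]
    exact Finset.sum_congr rfl fun i _ ↦ Finset.sum_congr rfl fun j _ ↦ by ring
  have e₂ : ∑ i, (v i : K) * v i * (x i ^ 2 + x i * x i) = ∑ i, 2 * (v i : K) ^ 2 * x i ^ 2 :=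
    Finset.sum_congr rfl fun i _ ↦ by ring
  simp only [netSum, e, e₁, sub_mul, Finset.sum_sub_distrib,
    Finset.sum_mul]
  rw [e₂] at h
  simp only [mul_add, Finset.sum_add_distrib] at h ⊢
  linear_combination -h

end NetQuotient

/-! ### The net polynomial as a real expression in the Tate parameters. -/

section Evaluation

variable {q : ℂ}

theorem oddTheta_add_log {ℓ : ℂ} (hq₁ : ‖q‖ < 1) (hℓ : Complex.exp ℓ = q) (w : ℂ) :
    oddTheta q (w + ℓ) = -Complex.exp (-w - ℓ / 2) * oddTheta q w := by
  have hq₀ : q ≠ 0 := hℓ ▸ Complex.exp_ne_zero ℓ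
  rw [oddTheta, oddTheta, Complex.exp_add, hℓ, mul_comm _ q,
    theta_mul_left hq₀ hq₁ (Complex.exp_ne_zero w), ← Complex.exp_neg]
  have h : Complex.exp (-((w + ℓ) / 2)) * Complex.exp (-w) =
      Complex.exp (-w - ℓ / 2) * Complex.exp (-(w / 2)) := by
    rw [← Complex.exp_add, ← Complex.exp_add]
    ring_nf
  linear_combination -theta q (Complex.exp w) * h

theorem oddTheta_add_int_mul_log {ℓ : ℂ} (hq₁ : ‖q‖ < 1) (hℓ : Complex.exp ℓ = q) (w : ℂ)
    (m : ℤ) :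
    oddTheta q (w + m * ℓ) =
      Complex.exp (Real.pi * Complex.I * m - m * w - m ^ 2 * ℓ / 2) * oddTheta q w := by
  have step : ∀ m : ℤ, oddTheta q (w + (m + 1 : ℤ) * ℓ) =
      Complex.exp (Real.pi * Complex.I - (w + m * ℓ) - ℓ / 2) * oddTheta q (w + m * ℓ) := by
    intro m
    have e : w + (m + 1 : ℤ) * ℓ = w + m * ℓ + ℓ := by push_cast; ring
    rw [e, oddTheta_add_log hq₁ hℓ]
    rw [sub_sub (Real.pi * Complex.I), sub_eq_add_neg (Real.pi * Complex.I), neg_add',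
      neg_add', Complex.exp_add (Real.pi * Complex.I), Complex.exp_pi_mul_I, neg_one_mul, neg_add']
  induction m using Int.induction_on with
  | zero => simp
  | succ m ih =>
    rw [step, ih, ← mul_assoc, ← Complex.exp_add]
    congr 2
    push_cast
    ring
  | pred m ih =>
    have h := step (-m - 1)
    rw [sub_add_cancel, ih] at h
    refine mul_left_cancel₀ (Complex.exp_ne_zero _) (h.symm.trans ?_)
    rw [← mul_assoc, ← Complex.exp_add]
    congr 2
    push_cast
    ring

/-- The value of a sigma function given by a theta function, as a function of a representative `w`
of its argument modulo `ℤ log q`. -/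
theorem sigma_eval {σ : ℂ → ℂ} {c κ b ℓ : ℂ} (hq₁ : ‖q‖ < 1) (hℓ : Complex.exp ℓ = q)
    (hσ : ∀ z, σ z = Complex.exp κ * Complex.exp (b * z ^ 2) * oddTheta q (c * z)) {z w : ℂ}
    {m : ℤ} (h : c * z = w + m * ℓ) :
    σ z = Complex.exp (κ + (b - c ^ 2 / (2 * ℓ)) * z ^ 2 + 1 / (2 * ℓ) * w ^ 2 + -(1 / 2) * w +
      Real.pi * Complex.I * m) * theta q (Complex.exp w) := by
  have hℓ₀ : ℓ ≠ 0 := by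
    rintro rfl
    rw [Complex.exp_zero] at hℓ
    simp [← hℓ] at hq₁
  rw [hσ, h, oddTheta_add_int_mul_log hq₁ hℓ, oddTheta, ← mul_assoc, ← mul_assoc,
    ← Complex.exp_add, ← Complex.exp_add, ← Complex.exp_add]
  congr 2
  -- Squaring `cz = w + mℓ` gives `-mw - m²ℓ/2 = w²/(2ℓ) - c²z²/(2ℓ)`. The quasi-periodicity factor
  -- thus becomes quadratic in `z` and `w`, apart from the term `πi m`.
  have e : c ^ 2 * z ^ 2 = (w + m * ℓ) ^ 2 := by rw [← h]; ring
  field_simp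
  linear_combination e

theorem sum_eval_sub_netSum {n : ℕ} (v m : Fin n → ℤ) (z w : Fin n → ℂ) (κ b b' l p : ℂ) :
    (κ + b * (∑ i, v i * z i) ^ 2 + b' * (∑ i, v i * w i) ^ 2 + l * (∑ i, v i * w i) +
      p * (∑ i, v i * m i : ℤ)) -
      netSum v (fun i ↦ κ + b * z i ^ 2 + b' * w i ^ 2 + l * w i + p * m i)
        (fun i j ↦ κ + b * (z i + z j) ^ 2 + b' * (w i + w j) ^ 2 + l * (w i + w j) +
          p * (m i + m j : ℤ)) =
      -twistExponent v * κ + l * ∑ i, (v i - (v i : ℂ) ^ 2) * w i +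
        p * ∑ i, (v i - (v i : ℂ) ^ 2) * m i := by
  have h : netSum v (fun i ↦ κ + b * z i ^ 2 + b' * w i ^ 2 + l * w i + p * m i)
        (fun i j ↦ κ + b * (z i + z j) ^ 2 + b' * (w i + w j) ^ 2 + l * (w i + w j) +
          p * (m i + m j : ℤ)) =
      netSum v (fun _ ↦ κ) (fun _ _ ↦ κ) +
        b * netSum v (fun i ↦ z i ^ 2) (fun i j ↦ (z i + z j) ^ 2) +
        b' * netSum v (fun i ↦ w i ^ 2) (fun i j ↦ (w i + w j) ^ 2) +
        l * netSum v w (fun i j ↦ w i + w j) +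
        p * netSum v (fun i ↦ (m i : ℂ)) (fun i j ↦ (m i : ℂ) + m j) := by
    have e (a b x : ℂ) : a * (b * x) = b * (a * x) := by ring
    simp only [netSum, Int.cast_add, mul_add, Finset.sum_add_distrib, e _ b, e _ b', e _ l, e _ p,
      ← Finset.mul_sum]
    ring
  rw [h, netSum_quadratic, netSum_quadratic]
  push_cast
  linear_combination netSum_const v κ + l * netSum_linear v w +
    p * netSum_linear v fun i ↦ (m i : ℂ)

/-- Since `v - v²` is even, the signs produced by quasi-periodicity cancel, and the choice of
representatives modulo `log q` leaves no trace. -/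
theorem exp_pi_mul_I_mul_sum {n : ℕ} (v m : Fin n → ℤ) :
    Complex.exp (Real.pi * Complex.I * ∑ i, (v i - (v i : ℂ) ^ 2) * m i) = 1 := by
  have h : Even (∑ i, (v i - v i ^ 2) * m i) := by
    refine Finset.even_sum _ fun i _ ↦ Even.mul_right ?_ _
    grind [Int.even_mul_pred_self (v i)]
  have e : (Real.pi * Complex.I * ∑ i, (v i - (v i : ℂ) ^ 2) * m i) =
      (∑ i, (v i - v i ^ 2) * m i : ℤ) * (Real.pi * Complex.I) := by
    push_cast
    ring
  rw [e, Complex.exp_int_mul, Complex.exp_pi_mul_I, h.neg_one_zpow]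

theorem exp_neg_half_mul_sum {n : ℕ} (v : Fin n → ℤ) (w : Fin n → ℂ) :
    Complex.exp (-(1 / 2) * ∑ i, (v i - (v i : ℂ) ^ 2) * w i) =
      ∏ i, Complex.exp (w i) ^ (v i * (v i - 1) / 2) := by
  simp only [← Complex.exp_int_mul, ← Complex.exp_sum, Finset.mul_sum]
  congr 1
  refine Finset.sum_congr rfl fun i _ ↦ ?_
  obtain ⟨t, ht⟩ := Int.even_mul_pred_self (v i)
  have ht' : (v i : ℂ) * (v i - 1) = t + t := by exact_mod_cast ht
  rw [ht, ← two_mul, Int.mul_ediv_cancel_left _ two_ne_zero]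
  linear_combination w i / 2 * ht'

/-- The value of the net polynomial in terms of the theta function of the Tate curve. -/
noncomputable def tateNetValue {n : ℕ} (q A : ℝ) (u : Fin n → ℝ) (v : Fin n → ℤ) : ℝ :=
  (-1) ^ twistExponent v * A ^ (-twistExponent v) * (∏ i, u i ^ (v i * (v i - 1) / 2)) *
    (theta q (∏ i, u i ^ v i) /
      netDenominator v (fun i ↦ theta q (u i)) fun i j ↦ theta q (u i * u j))

/-- In the exponents only three parts survive the quotient: `κ` gives the power of `A`, the linear
term `-w/2` gives the monomial in the `uᵢ`, and the term in `πi m` gives `1`. The complex constants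
`b` and `ℓ` disappear, which shows that the value is real. -/
theorem ofReal_tateNetValue {n : ℕ} {L : PeriodPair} {q A c : ℝ} {b ℓ : ℂ} (hq₁ : ‖q‖ < 1)
    (hℓ : Complex.exp ℓ = q) (hA : A ≠ 0)
    (hσ : ∀ z, weierstrassSigma L z = A * Complex.exp (b * z ^ 2) * oddTheta q (c * z))
    {z w : Fin n → ℂ} {u : Fin n → ℝ} {m : Fin n → ℤ} (hw : ∀ i, Complex.exp (w i) = u i)
    (hz : ∀ i, c * z i = w i + m i * ℓ) (v : Fin n → ℤ) :
    (tateNetValue q A u v : ℂ) = netValue L v z := by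
  have hq₁' : ‖(q : ℂ)‖ < 1 := by simpa using hq₁
  -- A complex logarithm is taken because `A` may be negative; it matters only through the integral
  -- multiple `-e(v) κ`.
  obtain ⟨κ, hκ⟩ : ∃ κ : ℂ, Complex.exp κ = A :=
    ⟨Complex.log A, Complex.exp_log (by exact_mod_cast hA)⟩
  rw [← hκ] at hσ
  have eval {z w : ℂ} {m : ℤ} (h : c * z = w + m * ℓ) := sigma_eval hq₁' hℓ hσ h
  have hsum : c * ∑ i, v i * z i = ∑ i, v i * w i + (∑ i, v i * m i : ℤ) * ℓ := by
    push_cast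
    rw [Finset.mul_sum, Finset.sum_mul, ← Finset.sum_add_distrib]
    exact Finset.sum_congr rfl fun i _ ↦ by linear_combination v i * hz i
  have hpair : ∀ i j, c * (z i + z j) = w i + w j + (m i + m j : ℤ) * ℓ := fun i j ↦ by
    push_cast
    linear_combination hz i + hz j
  have hθ : ∀ U : ℝ, theta (q : ℂ) U = Complex.ofRealHom (theta q U) := fun U ↦
    (ofReal_theta hq₁ U).symm
  have hprod : Complex.exp (∑ i, v i * w i) = (∏ i, u i ^ v i : ℝ) := by
    push_cast
    simp only [Complex.exp_sum, Complex.exp_int_mul, hw]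
  have hden := netDenominator_mul v
    (fun i ↦ Complex.exp (κ + (b - c ^ 2 / (2 * ℓ)) * z i ^ 2 + 1 / (2 * ℓ) * w i ^ 2 +
      -(1 / 2) * w i + Real.pi * Complex.I * m i)) (fun i ↦ theta (q : ℂ) (Complex.exp (w i)))
    (fun i j ↦ Complex.exp (κ + (b - c ^ 2 / (2 * ℓ)) * (z i + z j) ^ 2 +
      1 / (2 * ℓ) * (w i + w j) ^ 2 + -(1 / 2) * (w i + w j) +
        Real.pi * Complex.I * (m i + m j : ℤ)))
    (fun i j ↦ theta (q : ℂ) (Complex.exp (w i + w j)))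
  simp only [← eval (hz _), ← eval (hpair _ _), netDenominator_exp] at hden
  have hθden : netDenominator v (fun i ↦ theta (q : ℂ) (Complex.exp (w i)))
      (fun i j ↦ theta (q : ℂ) (Complex.exp (w i + w j))) = Complex.ofRealHom
        (netDenominator v (fun i ↦ theta q (u i)) fun i j ↦ theta q (u i * u j)) := by
    rw [map_netDenominator]
    simp only [Complex.exp_add, hw, ← Complex.ofReal_mul, hθ]
  have key := congrArg Complex.exp (sum_eval_sub_netSum v m z w κ (b - c ^ 2 / (2 * ℓ))
    (1 / (2 * ℓ)) (-(1 / 2)) (Real.pi * Complex.I))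
  rw [Complex.exp_sub,
    Complex.exp_add (_ + _) (Real.pi * Complex.I * ∑ i, (v i - (v i : ℂ) ^ 2) * m i),
    exp_pi_mul_I_mul_sum, Complex.exp_add (_ * κ), exp_neg_half_mul_sum, mul_one,
    ← Int.cast_neg, Complex.exp_int_mul, hκ] at key
  simp only [hw] at key
  rw [netValue, eval hsum, hprod, hθ, mul_div_assoc]
  refine Eq.trans ?_ (congrArg (fun d ↦ _ * (_ / d)) hden.symm)
  rw [hθden, mul_div_mul_comm, key, tateNetValue]
  push_cast
  simp only [Complex.ofRealHom_eq_coe]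
  ring

end Evaluation

/-! ### Calculus of parities. -/

section Parity

theorem parity_of_pos {x : ℝ} (h : 0 < x) : parity x = 0 := if_neg h.not_gt

theorem parity_of_neg {x : ℝ} (h : x < 0) : parity x = 1 := if_pos h

theorem parity_mul {x y : ℝ} (hx : x ≠ 0) (hy : y ≠ 0) : parity (x * y) = parity x + parity y := by
  rcases hx.lt_or_gt with hx | hx <;> rcases hy.lt_or_gt with hy | hy
  · rw [parity_of_pos (mul_pos_of_neg_of_neg hx hy), parity_of_neg hx, parity_of_neg hy]
    rfl
  · rw [parity_of_neg (mul_neg_of_neg_of_pos hx hy), parity_of_neg hx, parity_of_pos hy, add_zero]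
  · rw [parity_of_neg (mul_neg_of_pos_of_neg hx hy), parity_of_pos hx, parity_of_neg hy, zero_add]
  · rw [parity_of_pos (mul_pos hx hy), parity_of_pos hx, parity_of_pos hy, zero_add]

theorem parity_inv (x : ℝ) : parity x⁻¹ = parity x := by
  simp only [parity, inv_lt_zero]

theorem parity_div {x y : ℝ} (hx : x ≠ 0) (hy : y ≠ 0) : parity (x / y) = parity x + parity y := by
  rw [div_eq_mul_inv, parity_mul hx (inv_ne_zero hy), parity_inv]

theorem parity_zpow {x : ℝ} (hx : x ≠ 0) (m : ℤ) : parity (x ^ m) = m * parity x := by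
  rcases hx.lt_or_gt with hx | hx
  · rw [parity_of_neg hx, mul_one]
    rcases Int.even_or_odd m with hm | hm
    · rw [parity_of_pos (hm.zpow_pos hx.ne), (ZMod.intCast_eq_zero_iff_even).mpr hm]
    · rw [parity_of_neg (hm.zpow_neg hx), (ZMod.intCast_eq_one_iff_odd).mpr hm]
  · rw [parity_of_pos (zpow_pos hx m), parity_of_pos hx, mul_zero]

theorem parity_prod {ι : Type*} (s : Finset ι) {f : ι → ℝ} (hf : ∀ i ∈ s, f i ≠ 0) :
    parity (∏ i ∈ s, f i) = ∑ i ∈ s, parity (f i) := by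
  classical
  induction s using Finset.induction_on with
  | empty => exact parity_of_pos one_pos
  | insert a s ha ih =>
    rw [Finset.prod_insert ha, Finset.sum_insert ha, parity_mul (hf a (Finset.mem_insert_self a s))
      (Finset.prod_ne_zero_iff.mpr fun i hi ↦ hf i (Finset.mem_insert_of_mem hi)),
      ih fun i hi ↦ hf i (Finset.mem_insert_of_mem hi)]

theorem parity_netDenominator {n : ℕ} {D : Fin n → ℝ} {T : Fin n → Fin n → ℝ} (v : Fin n → ℤ)
    (hD : ∀ i, 0 < D i) (hT : ∀ i j, i < j → T i j ≠ 0) :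
    parity (netDenominator v D T) = ∑ i, ∑ j with i < j, (v i * v j : ℤ) * parity (T i j) := by
  have hT' : ∀ i, ∀ j ∈ Finset.univ.filter (i < ·), T i j ^ (v i * v j) ≠ 0 := fun i j hj ↦
    zpow_ne_zero _ (hT i j (Finset.mem_filter.mp hj).2)
  have h : 0 < ∏ i, D i ^ (2 * v i ^ 2 - ∑ j, v i * v j) :=
    Finset.prod_pos fun i _ ↦ zpow_pos (hD i) _
  rw [netDenominator, parity_mul h.ne' (Finset.prod_ne_zero_iff.mpr fun i _ ↦
    Finset.prod_ne_zero_iff.mpr (hT' i)), parity_of_pos h, zero_add,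
    parity_prod _ fun i _ ↦ Finset.prod_ne_zero_iff.mpr (hT' i)]
  refine Finset.sum_congr rfl fun i _ ↦ (parity_prod _ (hT' i)).trans ?_
  exact Finset.sum_congr rfl fun j hj ↦ parity_zpow (hT i j (Finset.mem_filter.mp hj).2) _

/-- For `v = 2a` and `v = 2a + 1` the left side is `a(2a - 1)` and `a(2a + 1)`, both congruent to
`a`. This turns the exponents of the monomial into the floors of the formula. -/
theorem intCast_choose_two_zmod_two (v : ℤ) :
    ((v * (v - 1) / 2 : ℤ) : ZMod 2) = ((⌊(v : ℝ) / 2⌋ : ℤ) : ZMod 2) := by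
  have hfl : ⌊(v : ℝ) / 2⌋ = v / 2 := by
    simpa using Int.floor_div_natCast (v : ℝ) 2
  rw [hfl]
  obtain ⟨a, rfl | rfl⟩ := Int.even_or_odd' v
  · have h₁ : 2 * a * (2 * a - 1) / 2 = a * (2 * a - 1) := by
      rw [mul_assoc, Int.mul_ediv_cancel_left _ two_ne_zero]
    have h₂ : 2 * a / 2 = a := Int.mul_ediv_cancel_left _ two_ne_zero
    rw [h₁, h₂, ZMod.intCast_eq_intCast_iff_dvd_sub]
    exact ⟨a * (1 - a), by push_cast; ring⟩
  · have h₁ : (2 * a + 1) * (2 * a + 1 - 1) / 2 = (2 * a + 1) * a := by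
      rw [add_sub_cancel_right, mul_left_comm, Int.mul_ediv_cancel_left _ two_ne_zero]
    have h₂ : (2 * a + 1) / 2 = a := by omega
    rw [h₁, h₂, ZMod.intCast_eq_intCast_iff_dvd_sub]
    exact ⟨-a ^ 2, by push_cast; ring⟩

end Parity

/-! ### Signs of the real theta function. -/

section Sign

variable {q : ℝ}

/-- A limit of positive partial products is only nonnegative; the nonvanishing of the product
supplies strictness. -/
theorem theta_pos (hq₁ : ‖q‖ < 1) {U : ℝ} (h : ∀ m, 0 < thetaFactor q U m)
    (h' : ∀ m : ℤ, q ^ m * U ≠ 1) : 0 < theta q U :=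
  lt_of_le_of_ne (ge_of_tendsto' (thetaFactor_multipliable hq₁ U).hasProd fun _ ↦
    Finset.prod_nonneg fun m _ ↦ (h m).le) (theta_ne_zero hq₁ h').symm

theorem theta_pos_of_neg (hq₀ : 0 < q) (hq₁ : ‖q‖ < 1) {U : ℝ} (hU : U < 0) : 0 < theta q U := by
  have h : ∀ m : ℤ, q ^ m * U < 0 := fun m ↦ mul_neg_of_pos_of_neg (zpow_pos hq₀ m) hU
  refine theta_pos hq₁ (fun m ↦ ?_) fun m ↦ ((h m).trans one_pos).ne
  rw [thetaFactor]
  split_ifs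
  · linarith [h m]
  · linarith [inv_lt_zero.mpr (h m)]

/-- The generator of the positive part of `q ^ ℤ`. -/
noncomputable def tateBase (q : ℝ) : ℝ := if 0 < q then q else q ^ 2

theorem tateBase_pos (hq₀ : q ≠ 0) : 0 < tateBase q := by
  rw [tateBase]
  split_ifs <;> positivity

theorem tateBase_lt_one (hq₁ : ‖q‖ < 1) : tateBase q < 1 := by
  rw [Real.norm_eq_abs] at hq₁
  rw [tateBase]
  split_ifs
  · exact (le_abs_self q).trans_lt hq₁
  · exact (sq_lt_one_iff_abs_lt_one q).mpr hq₁

theorem exists_tateBase_zpow (q : ℝ) (m : ℤ) : ∃ k : ℤ, tateBase q ^ m = q ^ k := by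
  rw [tateBase]
  split_ifs
  · exact ⟨m, rfl⟩
  · exact ⟨2 * m, by rw [zpow_mul]; rfl⟩

/-- These bounds make every theta factor positive on `(tateBase q, 1)`. For `q < 0` and `m < 0`, an
odd `m` gives a negative number, and an even `m` has `m ≤ -2`, hence `qᵐ ≥ q⁻²`; this is why the
base is `q²`. -/
theorem zpow_mul_bounds (hq₀ : q ≠ 0) (hq₁ : ‖q‖ < 1) {U : ℝ} (h₁ : tateBase q < U) (h₂ : U < 1)
    (m : ℤ) : (0 ≤ m → q ^ m * U < 1) ∧ (m < 0 → q ^ m * U < 0 ∨ 1 < q ^ m * U) := by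
  have hU : 0 < U := (tateBase_pos hq₀).trans h₁
  rw [Real.norm_eq_abs] at hq₁
  have habs : 0 < |q| := abs_pos.mpr hq₀
  refine ⟨fun hm ↦ ?_, fun hm ↦ ?_⟩
  · have : q ^ m ≤ 1 := (le_abs_self _).trans
      (by rw [abs_zpow]; exact zpow_le_one₀ habs hq₁.le hm)
    nlinarith
  · by_cases hneg : q ^ m < 0
    · exact .inl (mul_neg_of_neg_of_pos hneg hU)
    right
    have hpos : 0 < q ^ m := lt_of_le_of_ne (not_lt.mp hneg) (zpow_ne_zero m hq₀).symm
    have key : (tateBase q)⁻¹ ≤ q ^ m := by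
      rw [tateBase]
      split_ifs with hq
      · rw [← zpow_neg_one]
        rw [abs_of_pos hq] at hq₁
        exact zpow_le_zpow_right_of_le_one₀ hq hq₁.le (by omega)
      · have hq' : q < 0 := lt_of_le_of_ne (not_lt.mp hq) hq₀
        have hev : Even m := by
          rw [← Int.not_odd_iff_even]
          exact fun h ↦ hneg (h.zpow_neg hq')
        rw [← hev.zpow_abs, ← sq_abs, ← zpow_natCast, ← zpow_neg]
        exact zpow_le_zpow_right_of_le_one₀ habs hq₁.le (by grind)
    have hb := tateBase_pos hq₀
    calc (1 : ℝ) = (tateBase q)⁻¹ * tateBase q := (inv_mul_cancel₀ hb.ne').symm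
      _ < (tateBase q)⁻¹ * U := by gcongr
      _ ≤ q ^ m * U := by gcongr

theorem theta_pos_of_lt_one (hq₀ : q ≠ 0) (hq₁ : ‖q‖ < 1) {U : ℝ} (h₁ : tateBase q < U)
    (h₂ : U < 1) : 0 < theta q U := by
  have h := zpow_mul_bounds hq₀ hq₁ h₁ h₂
  refine theta_pos hq₁ (fun m ↦ ?_) fun m hm ↦ ?_
  · rw [thetaFactor]
    split_ifs with hm
    · exact sub_pos.mpr ((h m).1 hm)
    · rcases (h m).2 (not_le.mp hm) with h' | h'
      · linarith [inv_lt_zero.mpr h']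
      · exact sub_pos.mpr (inv_lt_one_of_one_lt₀ h')
  · rcases le_or_gt 0 m with hm' | hm'
    · linarith [(h m).1 hm']
    · rcases (h m).2 hm' with h' | h' <;> linarith

/-- For `q < 0` two steps of the functional equation give the factor `(qU)⁻¹ U⁻¹`, which is negative
because `q` is. -/
theorem theta_tateBase_mul (hq₀ : q ≠ 0) (hq₁ : ‖q‖ < 1) {U : ℝ} (hU : 0 < U) :
    ∃ r < 0, theta q (tateBase q * U) = r * theta q U := by
  rw [tateBase]
  split_ifs with hq
  · exact ⟨-U⁻¹, by simpa using hU, theta_mul_left hq₀ hq₁ hU.ne'⟩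
  · have hq' : q < 0 := lt_of_le_of_ne (not_lt.mp hq) hq₀
    refine ⟨(q * U)⁻¹ * U⁻¹, mul_neg_of_neg_of_pos (inv_lt_zero.mpr
      (mul_neg_of_neg_of_pos hq' hU)) (inv_pos.mpr hU), ?_⟩
    rw [pow_two, mul_assoc, theta_mul_left hq₀ hq₁ (mul_ne_zero hq₀ hU.ne'),
      theta_mul_left hq₀ hq₁ hU.ne']
    ring

theorem parity_theta_zpow_mul (hq₀ : q ≠ 0) (hq₁ : ‖q‖ < 1) {U : ℝ} (hU : 0 < U)
    (h : ∀ m : ℤ, q ^ m * U ≠ 1) (m : ℤ) :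
    parity (theta q (tateBase q ^ m * U)) = m + parity (theta q U) := by
  have hb := tateBase_pos hq₀
  have step : ∀ m : ℤ, parity (theta q (tateBase q ^ (m + 1) * U)) =
      1 + parity (theta q (tateBase q ^ m * U)) := by
    intro m
    obtain ⟨r, hr, e⟩ := theta_tateBase_mul hq₀ hq₁ (mul_pos (zpow_pos hb m) hU)
    rw [zpow_add_one₀ hb.ne', mul_comm _ (tateBase q), mul_assoc, e, parity_mul hr.ne,
      parity_of_neg hr]
    refine theta_ne_zero hq₁ fun j ↦ ?_
    obtain ⟨k, hk⟩ := exists_tateBase_zpow q m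
    rw [hk, ← mul_assoc, ← zpow_add₀ hq₀]
    exact h _
  induction m using Int.induction_on with
  | zero => simp
  | succ m ih =>
    rw [step, ih]
    push_cast
    ring
  | pred m ih =>
    have h := step (-m - 1)
    rw [sub_add_cancel, ih] at h
    push_cast at h ⊢
    linear_combination -h

/-- Write `U = Qᵐ V` with `Q = tateBase q` and `V ∈ (Q, 1)`. Then `m = ⌊log_Q U⌋`, the value at `V`
is positive, and each factor `Q` flips the sign. -/
theorem parity_theta_of_pos (hq₀ : q ≠ 0) (hq₁ : ‖q‖ < 1) {U : ℝ} (hU : 0 < U)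
    (h : ∀ m : ℤ, U ≠ q ^ m) :
    parity (theta q U) = (⌊Real.logb (tateBase q) U⌋ : ℤ) := by
  have hb := tateBase_pos hq₀
  have hb₁ := tateBase_lt_one hq₁
  set m := ⌊Real.logb (tateBase q) U⌋ with hm
  have hV : 0 < (tateBase q ^ m)⁻¹ * U := by positivity
  have hUV : U = tateBase q ^ m * ((tateBase q ^ m)⁻¹ * U) := by field_simp
  have hlog : Real.logb (tateBase q) ((tateBase q ^ m)⁻¹ * U) =
      Int.fract (Real.logb (tateBase q) U) := by
    have hlog₀ := (Real.log_neg hb hb₁).ne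
    rw [Real.logb_mul (by positivity) hU.ne', Real.logb_inv, Int.fract, ← hm, Real.logb,
      Real.log_zpow, mul_div_cancel_right₀ _ hlog₀]
    ring
  have hV₁ : (tateBase q ^ m)⁻¹ * U ≠ 1 := by
    obtain ⟨k, hk⟩ := exists_tateBase_zpow q m
    rw [hk]
    intro h'
    exact h k (by field_simp at h'; exact h')
  have h₁ : (tateBase q ^ m)⁻¹ * U < 1 := by
    refine lt_of_le_of_ne ?_ hV₁
    rw [← Real.logb_nonneg_iff_of_base_lt_one hb hb₁ hV, hlog]
    exact Int.fract_nonneg _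
  have h₂ : tateBase q < (tateBase q ^ m)⁻¹ * U := by
    rw [← Real.logb_lt_logb_iff_of_base_lt_one hb hb₁ hV hb, hlog,
      Real.logb_self_eq_one_iff.mpr ⟨hb.ne', hb₁.ne, by linarith⟩]
    exact Int.fract_lt_one _
  rw [hUV, parity_theta_zpow_mul hq₀ hq₁ hV, parity_of_pos (theta_pos_of_lt_one hq₀ hq₁ h₂ h₁),
    add_zero]
  intro j hj
  obtain ⟨k, hk⟩ := exists_tateBase_zpow q m
  apply h (k - j)
  rw [hk] at hj
  rw [zpow_sub₀ hq₀]
  field_simp at hj ⊢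
  linear_combination hj

/-- The two cases in the definition of `β` merge because `Real.logb` ignores the sign of its
argument and `log_{q²} = ½ log_{|q|}`. -/
theorem tateBeta_eq (q u : ℝ) : tateBeta q u = Real.logb (tateBase q) u := by
  rw [tateBeta, tateBase]
  split_ifs
  · exact Real.logb_abs _ _
  · rw [Real.logb, Real.logb, Real.log_abs, Real.log_pow]
    push_cast
    ring

end Sign

/-! ### Independence of the parameters and the sign formula. -/

section SignFormula

variable {n : ℕ} {q : ℝ} {u : Fin n → ℝ}

theorem prod_zpow_single (u : Fin n → ℝ) (i : Fin n) (a : ℤ) :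
    ∏ l, u l ^ (Pi.single i a : Fin n → ℤ) l = u i ^ a := by
  rw [Finset.prod_eq_single i (fun l _ hl ↦ by rw [Pi.single_eq_of_ne hl, zpow_zero])
    (fun h ↦ absurd (Finset.mem_univ i) h), Pi.single_eq_same]

theorem mul_ne_zpow (hu₀ : ∀ i, u i ≠ 0)
    (hu : ∀ v : Fin n → ℤ, ∀ m : ℤ, ∏ i, u i ^ v i = q ^ m → v = 0) {i j : Fin n} (hij : i < j)
    (m : ℤ) : u i * u j ≠ q ^ m := by
  intro h
  have h' : ∏ l, u l ^ (Pi.single i 1 + Pi.single j 1 : Fin n → ℤ) l = q ^ m := by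
    simp only [Pi.add_apply, zpow_add₀ (hu₀ _), Finset.prod_mul_distrib, prod_zpow_single, zpow_one,
      h]
  have := congrFun (hu _ m h') i
  simp [Pi.single_eq_of_ne hij.ne] at this

theorem logb_prod_zpow (hu₀ : ∀ i, u i ≠ 0) (Q : ℝ) (v : Fin n → ℤ) :
    Real.logb Q (∏ i, u i ^ v i) = ∑ i, v i * Real.logb Q (u i) := by
  rw [Real.logb, Real.log_prod fun i _ ↦ zpow_ne_zero _ (hu₀ i), Finset.sum_div]
  exact Finset.sum_congr rfl fun i _ ↦ by rw [Real.log_zpow, mul_div_assoc, Real.logb]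

theorem eq_zero_of_sum_logb_eq_intCast (hq₀ : q ≠ 0) (hq₁ : ‖q‖ < 1) (hu₀ : ∀ i, u i ≠ 0)
    (hu : ∀ v : Fin n → ℤ, ∀ m : ℤ, ∏ i, u i ^ v i = q ^ m → v = 0) {v : Fin n → ℤ} {m : ℤ}
    (h : ∑ i, v i * Real.logb (tateBase q) (u i) = m) : v = 0 := by
  have hb := tateBase_pos hq₀
  have hlog := (Real.log_neg hb (tateBase_lt_one hq₁)).ne
  have hp : ∏ i, u i ^ v i ≠ 0 := Finset.prod_ne_zero_iff.mpr fun i _ ↦ zpow_ne_zero _ (hu₀ i)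
  rw [← logb_prod_zpow hu₀, Real.logb, div_eq_iff hlog, ← Real.log_zpow, ← Real.log_abs] at h
  have h' := Real.log_injOn_pos (abs_pos.mpr hp) (zpow_pos hb m) h
  -- Logarithms determine the product only up to sign; squaring removes the sign and gives `2v = 0`.
  obtain ⟨k, hk⟩ := exists_tateBase_zpow q (2 * m)
  have h2 : ∏ i, u i ^ (v + v) i = q ^ k := by
    simp only [Pi.add_apply, zpow_add₀ (hu₀ _), Finset.prod_mul_distrib]
    rw [← hk, ← abs_mul_abs_self, h', two_mul, zpow_add₀ hb.ne']
  have := hu _ _ h2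
  exact funext fun i ↦ by have := congrFun this i; simp at this; simpa using this

theorem irrational_tateBeta (hq₀ : q ≠ 0) (hq₁ : ‖q‖ < 1) (hu₀ : ∀ i, u i ≠ 0)
    (hu : ∀ v : Fin n → ℤ, ∀ m : ℤ, ∏ i, u i ^ v i = q ^ m → v = 0) (i : Fin n) :
    Irrational (tateBeta q (u i)) := by
  rintro ⟨r, hr⟩
  rw [tateBeta_eq] at hr
  have h : ∑ l, (Pi.single i (r.den : ℤ) : Fin n → ℤ) l * Real.logb (tateBase q) (u l) =
      r.num := by
    rw [Finset.sum_eq_single i (fun l _ hl ↦ by rw [Pi.single_eq_of_ne hl]; simp)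
      (fun h ↦ absurd (Finset.mem_univ i) h), Pi.single_eq_same, ← hr]
    have := Rat.den_mul_eq_num r
    exact_mod_cast this
  have := congrFun (eq_zero_of_sum_logb_eq_intCast hq₀ hq₁ hu₀ hu h) i
  simp at this

theorem linearIndependent_tateBeta (hq₀ : q ≠ 0) (hq₁ : ‖q‖ < 1) (hu₀ : ∀ i, u i ≠ 0)
    (hu : ∀ v : Fin n → ℤ, ∀ m : ℤ, ∏ i, u i ^ v i = q ^ m → v = 0) :
    LinearIndependent ℚ fun i ↦ tateBeta q (u i) := by
  rw [← LinearIndependent.iff_fractionRing ℤ ℚ, Fintype.linearIndependent_iff]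
  intro v hv i
  simp only [tateBeta_eq, zsmul_eq_mul] at hv
  exact congrFun (eq_zero_of_sum_logb_eq_intCast (m := 0) hq₀ hq₁ hu₀ hu (by simpa using hv)) i

variable {k : ℕ}

/-- If `uᵢ` and `uⱼ` have opposite signs, their product is negative and theta is positive there.
Mixed pairs therefore do not occur in the formula. -/
theorem parity_theta_pair (hq₀ : q ≠ 0) (hq₁ : ‖q‖ < 1) (hu₀ : ∀ i, u i ≠ 0)
    (hu : ∀ v : Fin n → ℤ, ∀ m : ℤ, ∏ i, u i ^ v i = q ^ m → v = 0)
    (hneg : ∀ i : Fin n, (i : ℕ) < k → u i < 0) (hpos : ∀ i : Fin n, k ≤ (i : ℕ) → 0 < u i)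
    (hqpos : ∀ i, u i < 0 → 0 < q) {i j : Fin n} (hij : i < j) :
    parity (theta q (u i * u j)) = (if (j : ℕ) < k then
      (⌊tateBeta q (u i) + tateBeta q (u j)⌋ : ZMod 2) else 0) +
      if k ≤ (i : ℕ) then (⌊tateBeta q (u i) + tateBeta q (u j)⌋ : ZMod 2) else 0 := by
  have hij' : (i : ℕ) < j := hij
  have hsame (h : 0 < u i * u j) : parity (theta q (u i * u j)) =
      (⌊tateBeta q (u i) + tateBeta q (u j)⌋ : ZMod 2) := by
    rw [parity_theta_of_pos hq₀ hq₁ h (mul_ne_zpow hu₀ hu hij), Real.logb_mul (hu₀ i) (hu₀ j),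
      tateBeta_eq, tateBeta_eq]
  rcases lt_or_ge (j : ℕ) k with hj | hj
  · rw [if_pos hj, if_neg (by omega), add_zero,
      hsame (mul_pos_of_neg_of_neg (hneg i (by omega)) (hneg j hj))]
  · rw [if_neg (by omega), zero_add]
    split_ifs with hi
    · exact hsame (mul_pos (hpos i hi) (hpos j hj))
    · have hi' := hneg i (by omega)
      exact parity_of_pos (theta_pos_of_neg (hqpos i hi') hq₁
        (mul_neg_of_neg_of_pos hi' (hpos j hj)))

theorem parity_prod_zpow (hu₀ : ∀ i, u i ≠ 0) (hneg : ∀ i : Fin n, (i : ℕ) < k → u i < 0)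
    (hpos : ∀ i : Fin n, k ≤ (i : ℕ) → 0 < u i) (v : Fin n → ℤ) :
    parity (∏ i, u i ^ v i) =
      (∑ i ∈ Finset.univ.filter (fun i : Fin n ↦ (i : ℕ) < k), v i : ℤ) := by
  rw [parity_prod _ fun i _ ↦ zpow_ne_zero _ (hu₀ i), Finset.sum_filter]
  push_cast
  refine Finset.sum_congr rfl fun i _ ↦ ?_
  rw [parity_zpow (hu₀ i)]
  split_ifs with hi
  · rw [parity_of_neg (hneg i hi), mul_one]
  · rw [parity_of_pos (hpos i (not_lt.mp hi)), mul_zero]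

/-- The sign of the product is governed by the parity of the sum of the first `k` entries of `v`;
when it is negative, theta is positive and no floor appears. -/
theorem parity_theta_prod (hq₀ : q ≠ 0) (hq₁ : ‖q‖ < 1) (hu₀ : ∀ i, u i ≠ 0)
    (hu : ∀ v : Fin n → ℤ, ∀ m : ℤ, ∏ i, u i ^ v i = q ^ m → v = 0)
    (hneg : ∀ i : Fin n, (i : ℕ) < k → u i < 0) (hpos : ∀ i : Fin n, k ≤ (i : ℕ) → 0 < u i)
    (hqpos : ∀ i, u i < 0 → 0 < q) {v : Fin n → ℤ} (hv : v ≠ 0) :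
    parity (theta q (∏ i, u i ^ v i)) =
      ((if Even (∑ i ∈ Finset.univ.filter (fun i : Fin n ↦ (i : ℕ) < k), v i) then
      ⌊∑ i, v i * tateBeta q (u i)⌋ else 0 : ℤ) : ZMod 2) := by
  have hp : ∏ i, u i ^ v i ≠ 0 := Finset.prod_ne_zero_iff.mpr fun i _ ↦ zpow_ne_zero _ (hu₀ i)
  have h := parity_prod_zpow hu₀ hneg hpos v
  split_ifs with hev
  · rw [(ZMod.intCast_eq_zero_iff_even).mpr hev] at h
    have hp' : 0 < ∏ i, u i ^ v i := by
      by_contra hcon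
      rw [parity_of_neg (lt_of_le_of_ne (not_lt.mp hcon) hp)] at h
      exact one_ne_zero h
    rw [parity_theta_of_pos hq₀ hq₁ hp' fun m hm ↦ hv (hu v m hm), logb_prod_zpow hu₀]
    simp only [tateBeta_eq]
  · rw [(ZMod.intCast_eq_one_iff_odd).mpr (Int.not_even_iff_odd.mp hev)] at h
    have hp' : ∏ i, u i ^ v i < 0 := by
      by_contra hcon
      rw [parity_of_pos (lt_of_le_of_ne (not_lt.mp hcon) hp.symm)] at h
      exact one_ne_zero h.symm
    -- A negative product requires some negative `uᵢ`, and this occurs only for `q > 0`.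
    have hq : 0 < q := by
      by_contra hcon
      exact hp'.not_ge (Finset.prod_nonneg fun i _ ↦
        zpow_nonneg (not_lt.mp fun h' ↦ hcon (hqpos i h')) _)
    rw [parity_of_pos (theta_pos_of_neg hq hq₁ hp'), Int.cast_zero]

/-- This is the role of the normalization of the `uᵢ`: the factors of the denominator indexed by
single points carry no sign. -/
theorem theta_pos_of_isNormalized (hq₀ : q ≠ 0) (hq₁ : ‖q‖ < 1) {U : ℝ} (h : IsNormalized q U) :
    0 < theta q U := by
  rcases hq₀.lt_or_gt with hq | hq
  · refine theta_pos_of_lt_one hq₀ hq₁ ?_ (h.2 hq).2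
    rw [tateBase, if_neg hq.not_gt]
    exact (h.2 hq).1
  · obtain ⟨h₁, h₂⟩ := h.1 hq
    rcases lt_or_ge U 0 with hU | hU
    · exact theta_pos_of_neg hq hq₁ hU
    · rw [abs_of_nonneg hU] at h₁ h₂
      refine theta_pos_of_lt_one hq₀ hq₁ ?_ h₂
      rwa [tateBase, if_pos hq]

theorem intCast_signFormula (k : ℕ) (β : Fin n → ℝ) (v : Fin n → ℤ) :
    (signFormula k β v : ZMod 2) =
      ∑ i, ∑ j with i < j, ((v i * v j : ℤ) : ZMod 2) *
        ((if (j : ℕ) < k then (⌊β i + β j⌋ : ZMod 2) else 0) +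
          if k ≤ (i : ℕ) then (⌊β i + β j⌋ : ZMod 2) else 0) +
      ((if Even (∑ i ∈ Finset.univ.filter (fun i : Fin n ↦ (i : ℕ) < k), v i) then
        ⌊∑ i, v i * β i⌋ else 0 : ℤ) : ZMod 2) +
      ∑ i ∈ Finset.univ.filter (fun i : Fin n ↦ (i : ℕ) < k), ((⌊(v i : ℝ) / 2⌋ : ℤ) : ZMod 2) := by
  simp only [signFormula, ← Finset.filter_filter, Finset.sum_filter, mul_add,
    Finset.sum_add_distrib]
  push_cast
  congr 2
  congr 1
  · refine Finset.sum_congr rfl fun i _ ↦ Finset.sum_congr rfl fun j _ ↦ ?_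
    split_ifs <;> simp [mul_comm]
  · refine Finset.sum_congr rfl fun i _ ↦ ?_
    split_ifs
    · refine Finset.sum_congr rfl fun j _ ↦ ?_
      split_ifs <;> simp [mul_comm]
    · simp

theorem theta_ne_zero_of_ne_zpow (hq₁ : ‖q‖ < 1) {U : ℝ} (h : ∀ m : ℤ, U ≠ q ^ m) :
    theta q U ≠ 0 :=
  theta_ne_zero hq₁ fun m hm ↦ h (-m) <| by
    rw [zpow_neg]
    exact eq_inv_of_mul_eq_one_right hm

theorem tateNetValue_ne_zero_and_parity {A : ℝ} (hA : A ≠ 0) (hq₀ : q ≠ 0) (hq₁ : ‖q‖ < 1)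
    (hu₀ : ∀ i, u i ≠ 0) (hu : ∀ v : Fin n → ℤ, ∀ m : ℤ, ∏ i, u i ^ v i = q ^ m → v = 0)
    (hneg : ∀ i : Fin n, (i : ℕ) < k → u i < 0) (hpos : ∀ i : Fin n, k ≤ (i : ℕ) → 0 < u i)
    (hu' : ∀ i, IsNormalized q (u i)) {v : Fin n → ℤ} (hv : v ≠ 0) :
    tateNetValue q A u v ≠ 0 ∧ parity (tateNetValue q A u v) =
      twistExponent v * (1 + parity A) + signFormula k (fun i ↦ tateBeta q (u i)) v := by
  -- For `q < 0` the normalization gives `uᵢ > q²`.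
  have hqpos : ∀ i, u i < 0 → 0 < q := fun i hi ↦ by
    by_contra hq
    have := ((hu' i).2 (lt_of_le_of_ne (not_lt.mp hq) hq₀)).1
    linarith [sq_nonneg q]
  have hθ : theta q (∏ i, u i ^ v i) ≠ 0 :=
    theta_ne_zero_of_ne_zpow hq₁ fun m hm ↦ hv (hu v m hm)
  have hT : ∀ i j, i < j → theta q (u i * u j) ≠ 0 := fun i j hij ↦
    theta_ne_zero_of_ne_zpow hq₁ (mul_ne_zpow hu₀ hu hij)
  have hD := fun i ↦ theta_pos_of_isNormalized hq₀ hq₁ (hu' i)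
  have hden := netDenominator_ne_zero (v := v) (fun i ↦ (hD i).ne') hT
  have h₁ : (-1 : ℝ) ^ twistExponent v ≠ 0 := zpow_ne_zero _ (by norm_num)
  have h₂ := zpow_ne_zero (-twistExponent v) hA
  have h₃ : ∏ i, u i ^ (v i * (v i - 1) / 2) ≠ 0 :=
    Finset.prod_ne_zero_iff.mpr fun i _ ↦ zpow_ne_zero _ (hu₀ i)
  refine ⟨mul_ne_zero (mul_ne_zero (mul_ne_zero h₁ h₂) h₃) (div_ne_zero hθ hden), ?_⟩
  have hpairs : ∑ i, ∑ j with i < j, ((v i * v j : ℤ) : ZMod 2) * parity (theta q (u i * u j)) =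
      ∑ i, ∑ j with i < j, ((v i * v j : ℤ) : ZMod 2) * ((if (j : ℕ) < k then
        (⌊tateBeta q (u i) + tateBeta q (u j)⌋ : ZMod 2) else 0) +
          if k ≤ (i : ℕ) then (⌊tateBeta q (u i) + tateBeta q (u j)⌋ : ZMod 2) else 0) :=
    Finset.sum_congr rfl fun i _ ↦ Finset.sum_congr rfl fun j hj ↦ by
      rw [parity_theta_pair hq₀ hq₁ hu₀ hu hneg hpos hqpos (Finset.mem_filter.mp hj).2]
  have hchoose : ∑ i ∈ Finset.univ.filter (fun i : Fin n ↦ (i : ℕ) < k),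
        ((v i * (v i - 1) / 2 : ℤ) : ZMod 2) =
      ∑ i ∈ Finset.univ.filter (fun i : Fin n ↦ (i : ℕ) < k), ((⌊(v i : ℝ) / 2⌋ : ℤ) : ZMod 2) :=
    Finset.sum_congr rfl fun i _ ↦ intCast_choose_two_zmod_two (v i)
  rw [tateNetValue, parity_mul (mul_ne_zero (mul_ne_zero h₁ h₂) h₃) (div_ne_zero hθ hden),
    parity_mul (mul_ne_zero h₁ h₂) h₃, parity_mul h₁ h₂, parity_zpow (by norm_num),
    parity_zpow hA, parity_of_neg (x := -1) (by norm_num), parity_div hθ hden,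
    parity_netDenominator v hD hT, parity_prod_zpow hu₀ hneg hpos, hpairs,
    parity_theta_prod hq₀ hq₁ hu₀ hu hneg hpos hqpos hv, intCast_signFormula, Int.cast_sum, hchoose,
    Int.cast_neg, ZMod.neg_eq_self_mod_two]
  ring

end SignFormula

/-! ### Assembly of the theorem. -/

/-- The Tate parameters of linearly independent points are multiplicatively independent modulo `q`,
and they determine the net polynomials up to a constant `A`. -/
theorem exists_tateNetValue {n : ℕ} (i₀ : Fin n) {E : WeierstrassCurve ℝ}
    {P : Fin n → E.toAffine.Point}
    (hP : LinearIndependent ℤ P) {L : PeriodPair} (hL : IsLatticeOf L E) {z : Fin n → ℂ}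
    (hz : ∀ i, CorrespondsToPoint L E (z i) (P i)) {q : ℝ} (hq₀ : q ≠ 0) (hq₁ : |q| < 1)
    {C : WeierstrassCurve.VariableChange ℝ} (hC : C • E = tateCurve q) {u : Fin n → ℝ}
    (hu : ∀ i, IsTateParameter q E C (u i) (P i)) :
    (∀ v : Fin n → ℤ, ∀ m : ℤ, ∏ i, u i ^ v i = q ^ m → v = 0) ∧
      ∃ A : ℝ, A ≠ 0 ∧ ∀ v, (tateNetValue q A u v : ℂ) = netValue L v z := by
  have hq₀' : (q : ℂ) ≠ 0 := by exact_mod_cast hq₀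
  have hq₁' : ‖(q : ℂ)‖ < 1 := by simpa using hq₁
  have hlog : ∀ i, ∃ w : ℂ, Complex.exp w = u i := fun i ↦
    ⟨Complex.log (u i), Complex.exp_log (by exact_mod_cast (hu i).1)⟩
  choose w₀ hw₀ using hlog
  have hcmp := fun i ↦ tate_comparison hL hq₀ hq₁ hq₀' hq₁' hC (hz i) (hu i) (hw₀ i)
  obtain ⟨-, hΛ, h℘⟩ := hcmp i₀
  have hmem := fun i ↦ (mem_tatePeriods hq₀' hq₁').mp (hcmp i).1
  choose m hm using hmem
  set ℓ := Complex.log q with hℓ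
  have hexp : Complex.exp ℓ = q := Complex.exp_log hq₀'
  set c := (C.u : ℝ)
  -- The logarithm of `uᵢ` is chosen to differ from `c zᵢ` by a multiple of `ℓ` alone; no multiple
  -- of `2πi` remains.
  have hw : ∀ i, Complex.exp (c * z i + m i * ℓ) = u i := fun i ↦ by
    rw [Complex.exp_add, Complex.exp_int_mul, hexp, ← hm i, ← Complex.exp_add, add_sub_cancel,
      hw₀ i]
  constructor
  · intro v k hv
    have hmem : ∑ i, v i * z i ∈ L.lattice := by
      rw [hΛ, mem_tatePeriods]
      refine ⟨k - ∑ i, v i * m i, ?_⟩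
      have e : c * ∑ i, v i * z i =
          ∑ i, v i * (c * z i + m i * ℓ) - (∑ i, v i * m i : ℤ) * ℓ := by
        push_cast
        rw [Finset.mul_sum, Finset.sum_mul, ← Finset.sum_sub_distrib]
        exact Finset.sum_congr rfl fun i _ ↦ by ring
      have hv' : ∏ i, (u i : ℂ) ^ v i = (q : ℂ) ^ k := by exact_mod_cast hv
      rw [e, Complex.exp_sub, Complex.exp_sum, Complex.exp_int_mul, hexp, zpow_sub₀ hq₀', ← hv']
      simp only [Complex.exp_int_mul, hw]
    exact funext fun i ↦ Fintype.linearIndependent_iff.mp hP v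
      (sum_zsmul_eq_zero hL Finset.univ hz v hmem) i
  · obtain ⟨A, K, hA, hσ⟩ := weierstrassSigma_eq_oddTheta L hq₀' hq₁' hΛ h℘
    refine ⟨A, hA, fun v ↦ ofReal_tateNetValue (m := fun i ↦ -m i) (by simpa using hq₁) hexp hA hσ
      hw (fun i ↦ ?_) v⟩
    push_cast
    ring

end EllipticNet

theorem theorem1p4 {n : ℕ} (E : WeierstrassCurve ℝ) [E.IsElliptic]
    (P : Fin n → E.toAffine.Point) (hP : LinearIndependent ℤ P)
    (L : PeriodPair) (hL : EllipticNet.IsLatticeOf L E)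
    (z : Fin n → ℂ) (hz : ∀ i, EllipticNet.CorrespondsToPoint L E (z i) (P i))
    (q : ℝ) (hq₀ : q ≠ 0) (hq₁ : |q| < 1)
    (C : WeierstrassCurve.VariableChange ℝ) (hC : C • E = EllipticNet.tateCurve q)
    (u : Fin n → ℝ) (hu : ∀ i, EllipticNet.IsTateParameter q E C (u i) (P i))
    (hu' : ∀ i, EllipticNet.IsNormalized q (u i))
    (k : ℕ) (hk : k ≤ n) (hneg : ∀ i : Fin n, (i : ℕ) < k → u i < 0)
    (hpos : ∀ i : Fin n, k ≤ (i : ℕ) → 0 < u i) :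
    ∃ β : Fin n → ℝ, (∀ i, β i = EllipticNet.tateBeta q (u i)) ∧
      (∀ i, Irrational (β i)) ∧ LinearIndependent ℚ β ∧
      ∃ Ψ : (Fin n → ℤ) → ℝ, (∀ v, (Ψ v : ℂ) = EllipticNet.netValue L v z) ∧
        (∀ v, v ≠ 0 → Ψ v ≠ 0) ∧
        ((∀ v, v ≠ 0 →
            EllipticNet.parity (Ψ v) = (EllipticNet.signFormula k β v : ZMod 2)) ∨
          (∀ v, v ≠ 0 →
            EllipticNet.parity ((-1) ^ EllipticNet.twistExponent v * Ψ v) =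
              (EllipticNet.signFormula k β v : ZMod 2))) := by
  open EllipticNet in
  refine ⟨fun i ↦ tateBeta q (u i), fun _ ↦ rfl, ?_⟩
  -- The comparison of lattices needs one point. For `n = 0` the only index is `v = 0`, where the
  -- value is `0` because `σ(0) = 0`.
  rcases isEmpty_or_nonempty (Fin n) with hn | ⟨⟨i₀⟩⟩
  · have hv : ∀ v : Fin n → ℤ, v ≠ 0 → False := fun v hv ↦ hv (Subsingleton.elim _ _)
    refine ⟨fun i ↦ hn.elim i, linearIndependent_empty_type, fun _ ↦ 0, fun v ↦ ?_,
      fun v h ↦ (hv v h).elim, .inl fun v h ↦ (hv v h).elim⟩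
    simp [netValue, weierstrassSigma]
  obtain ⟨hind, A, hA, hval⟩ := exists_tateNetValue i₀ hP hL hz hq₀ hq₁ hC hu
  have hu₀ : ∀ i, u i ≠ 0 := fun i ↦ (hu i).1
  have key := fun {v} ↦ tateNetValue_ne_zero_and_parity (v := v) hA hq₀ hq₁ hu₀ hind hneg hpos hu'
  refine ⟨irrational_tateBeta hq₀ hq₁ hu₀ hind, linearIndependent_tateBeta hq₀ hq₁ hu₀ hind,
    tateNetValue q A u, hval, fun v hv ↦ (key hv).1, ?_⟩
  -- The parity carries the extra term `e(v) (1 + parity A)`: it vanishes for `A < 0` and is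
  -- absorbed by the twist `(-1)^e(v)` for `A > 0`.
  rcases hA.lt_or_gt with hA | hA
  · refine .inl fun v hv ↦ ?_
    rw [(key hv).2, parity_of_neg hA, CharTwo.add_self_eq_zero, mul_zero, zero_add]
  · refine .inr fun v hv ↦ ?_
    rw [parity_mul (zpow_ne_zero _ (by norm_num)) (key hv).1, (key hv).2, parity_of_pos hA,
      parity_zpow (by norm_num), parity_of_neg (x := -1) (by norm_num), add_zero, ← add_assoc,
      CharTwo.add_self_eq_zero, zero_add]
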